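/- Let $\mathbb S^3\subset\mathbb R^4$ be the unit quaternions $p=x_1+iy_1+jx_2+ky_2$, also written $p=(z_1,z_2)$ with $z_1=x_1+iy_1$, $z_2=x_2+iy_2$, with the round metric $g$ and the orthonormal frame $E_1(p)=j\cdot p$, $E_2(p)=k\cdot p$, $T(p)=i\cdot p$; the plane $\mathcal H_p$ spanned by $E_1(p),E_2(p)$ is called horizontal. Let $\varphi_t(p)=\exp(it)\cdot p$ and $r_\theta(z_1,z_2)=(z_1,e^{i\theta}z_2)$, let $L=\mathbb S^1\times\{0\}$, $C_0=\{0\}\times\mathbb S^1$, and let $d_L$ be the distance to $L$ in $(\mathbb S^3,g)$. For a $C^2$ surface $\Sigma\subset\mathbb S^3$ with unit normal $N$, a point $p\in\Sigma$ is singular if $T_p\Sigma=\mathcal H_p$. At the other points the horizontal Gauss map is $\nu_h=N_h/|N_h|$, where $N_h$ is the horizontal projection of $N$, and the mean curvature $H$ of $\Sigma$ with respect to $N$ is given by $-2H=\operatorname{div}_\Sigma\nu_h$. For $\lambda\ge 0$ put $\kappa=\sqrt{1+\lambda^2}$ and $\gamma_\theta(s)=(z_1(s),z_2(\theta,s))$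 with $$z_1(s)=e^{-i\lambda s}\Big(\cos(\kappa s)+\tfrac{i\lambda}{\kappa}\sin(\kappa s)\Big),\qquad z_2(\theta,s)=\tfrac1\kappa\sin(\kappa s)\,e^{i(\theta-\lambda s)} .$$ Let $\mathcal S_\lambda=\{\gamma_\theta(s):\theta\in[0,2\pi),\ s\in[0,\pi/\kappa]\}$, with south pole $e=\gamma_\theta(0)=(1,0,0,0)$, north pole $e^\lambda=\gamma_\theta(\pi/\kappa)$ and equator $C_\lambda=\{\gamma_\theta(\pi/(2\kappa)):\theta\in[0,2\pi)\}$ (for $\lambda=0$ this is the circle $C_0$ above). With $\tau_\lambda=\pi(1-\lambda/\kappa)$, the totally geodesic sphere $\{\sin(\tau_\lambda/2)\,x_1-\cos(\tau_\lambda/2)\,y_1=0\}$ contains $C_\lambda$; let $\mathcal S_\lambda^+$ and $\mathcal S_\lambda^-$ be the parts of $\mathcal S_\lambda$ where $\sin(\tau_\lambda/2)\,x_1-\cos(\tau_\lambda/2)\,y_1$ is $\ge0$ and $\le 0$, respectively. Let $\mathcal W_\lambda=\{p\in\mathbb S^3: d_L(p)\le\arctan(1/\lambda)\}$ for $\lambda>0$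 and $\mathcal W_0=\mathbb S^3-C_0$. **Proposition 3.2.** Let $\lambda\ge0$, and let $(\mathcal S,q)$ be $(\mathcal S_\lambda^+,e)$ or $(\mathcal S_\lambda^-,e^\lambda)$. For $t\in[0,2\pi)$ let $\mathcal S(t)=\varphi_t(\mathcal S)$ and $e_t=\varphi_t(q)$. There is a $C^1$ unit normal $N$ on $\mathcal S$ such that, with $N_t=\varphi_t\circ N\circ\varphi_t^{-1}$, the following holds. 1. For every $t\in[0,2\pi)$, $\mathcal S(t)$ is an embedded $C^2$ surface with boundary $\varphi_t(C_\lambda)$, is $C^\infty$ away from $e_t$, satisfies $r_\theta(\mathcal S(t))=\mathcal S(t)$ for all $\theta$, has $e_t$ as its only singular point, and has $N_t$ as a $C^1$ unit normal; its mean curvature with respect to $N_t$ is $\lambda$ at every point other than $e_t$. 2. If $\lambda>0$, the family $\{\mathcal S(t)\}_{t\in[0,2\pi)}$ is a foliation of $\mathcal W_\lambda$. 3. If $\lambda=0$, the family $\{\mathcal S(t)-C_0\}_{t\in[0,2\pi)}$ is a foliation of $\mathcal W_0$. 4. There is a continuous unit horizontal vector field $X$ on $\mathcal W_\lambda-L$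 which is $C^\infty$ on $\operatorname{int}(\mathcal W_\lambda)-L$, which on each $(\mathcal S(t)\cap\mathcal W_\lambda)-\{e_t\}$ equals the horizontal Gauss map of $\mathcal S(t)$ associated with $N_t$, and whose divergence in $(\mathbb S^3,g)$ satisfies $$\operatorname{div}X=-2\lambda\quad\text{on }\operatorname{int}(\mathcal W_\lambda)-L .$$ Here a foliation of $\mathcal W\subset\mathbb S^3$ is a family of pairwise disjoint connected embedded $C^2$ surfaces, possibly with boundary, with union $\mathcal W$, such that around each point of $\mathcal W$ there is a homeomorphism from a neighbourhood in $\mathcal W$ onto an open subset of (closed half-plane)$\,\times\mathbb R$ that sends the leaves to the slices with constant last coordinate, and around each interior point of $\mathcal W$ the leaves are the level sets of a $C^2$ submersion. -/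

import Mathlib

open scoped Topology ContDiff

noncomputable section

namespace PansuSphere

/-! The space `ℝ⁴` of quaternions `x₁ + i y₁ + j x₂ + k y₂`, with `re = x₁`, `imI = y₁`,
`imJ = x₂`, `imK = y₂`, `z₁ = x₁ + i y₁`, `z₂ = x₂ + i y₂`. -/

/-- The quaternions, with their Euclidean scalar product. -/
abbrev Quat : Type := Quaternion ℝ

/-- The unit sphere `𝕊³`. -/
def S3 : Set Quat := {p | ‖p‖ = 1}

/-- The quaternion `i`. -/
def qI : Quat := ⟨0, 1, 0, 0⟩

/-- The quaternion `j`. -/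
def qJ : Quat := ⟨0, 0, 1, 0⟩

/-- The quaternion `k`. -/
def qK : Quat := ⟨0, 0, 0, 1⟩

/-- The vertical Hopf field `T(p) = i · p`. -/
def T (p : Quat) : Quat := qI * p

/-- The right invariant field `E₁(p) = j · p`. -/
def E1 (p : Quat) : Quat := qJ * p

/-- The right invariant field `E₂(p) = k · p`. -/
def E2 (p : Quat) : Quat := qK * p

/-- The horizontal plane at `p`. -/
def horizontal (p : Quat) : Submodule ℝ Quat := Submodule.span ℝ {E1 p, E2 p}

/-- The horizontal projection of a vector `v` that is tangent to `𝕊³` at `p`. -/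
def horizontalPart (p v : Quat) : Quat := inner ℝ v (E1 p) • E1 p + inner ℝ v (E2 p) • E2 p

/-- The quaternion `exp(it)`. -/
def expI (t : ℝ) : Quat := ⟨Real.cos t, Real.sin t, 0, 0⟩

/-- The vertical translation `φ_t(p) = exp(it) · p`. -/
def vertTrans (t : ℝ) (p : Quat) : Quat := expI t * p

/-- The rotation `r_θ(z₁, z₂) = (z₁, exp(iθ) z₂)`. -/
def rot (θ : ℝ) (p : Quat) : Quat :=
  ⟨p.re, p.imI, Real.cos θ * p.imJ - Real.sin θ * p.imK, Real.sin θ * p.imJ + Real.cos θ * p.imK⟩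

/-- Rotational invariance of a set. -/
def RotInvariant (A : Set Quat) : Prop := ∀ θ ∈ Set.Ico (0 : ℝ) (2 * Real.pi), rot θ '' A = A

/-- The vertical axis `L = 𝕊¹ × {0}`. -/
def axisL : Set Quat := {p | p ∈ S3 ∧ p.imJ = 0 ∧ p.imK = 0}

/-- The great circle `C₀ = {0} × 𝕊¹`. -/
def circleC0 : Set Quat := {p | p ∈ S3 ∧ p.re = 0 ∧ p.imI = 0}

/-- The Riemannian distance of the round sphere `𝕊³`. -/
def sphereDist (p q : Quat) : ℝ := Real.arccos (inner ℝ p q)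

/-- The Riemannian distance from a point of `𝕊³` to the vertical axis. -/
def distL (p : Quat) : ℝ := sInf (sphereDist p '' axisL)

/-! ### Surfaces in `𝕊³` -/

/-- The tangent space at `p` of a subset `M` of `ℝ⁴`, as the span of the tangent cone. For a `C¹`
submanifold, with or without boundary, this is the usual tangent space, also at boundary points. -/
def tangentSpan (M : Set Quat) (p : Quat) : Submodule ℝ Quat :=
  Submodule.span ℝ (tangentConeAt ℝ M p)

/-- Near `p`, the set `A` is a regular level set in `𝕊³` of a `C^k` function: `p` is an interior
point of `A` as an embedded `C^k` surface. -/
def IsInteriorPoint (k : WithTop ℕ∞) (A : Set Quat) (p : Quat) : Prop :=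
  ∃ (U : Set Quat) (f : Quat → ℝ), IsOpen U ∧ p ∈ U ∧ ContDiffOn ℝ k f U ∧
    (∃ v : Quat, inner ℝ p v = 0 ∧ fderiv ℝ f p v ≠ 0) ∧
    A ∩ U = {q | q ∈ S3 ∧ q ∈ U ∧ f q = 0}

/-- Near `p`, the set `A` is the part `g ≥ 0` of a level set `f = 0` in `𝕊³`, where `f`, `g` are
`C^k`, `g p = 0`, and the differentials of `f`, `g` at `p` are linearly independent on the tangent
space of `𝕊³`: `p` is a boundary point of `A` as an embedded `C^k` surface with boundary. -/
def IsBoundaryPoint (k : WithTop ℕ∞) (A : Set Quat) (p : Quat) : Prop :=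
  ∃ (U : Set Quat) (f g : Quat → ℝ), IsOpen U ∧ p ∈ U ∧ ContDiffOn ℝ k f U ∧
    ContDiffOn ℝ k g U ∧ g p = 0 ∧
    (∀ a b : ℝ, (∀ v : Quat, inner ℝ p v = 0 → a * fderiv ℝ f p v + b * fderiv ℝ g p v = 0) →
      a = 0 ∧ b = 0) ∧
    A ∩ U = {q | q ∈ S3 ∧ q ∈ U ∧ f q = 0 ∧ 0 ≤ g q}

/-- Embedded surface of class `C^k` in `𝕊³`, with (possibly empty) boundary; used for `k ≥ 1`. -/
def IsSurface (k : WithTop ℕ∞) (A : Set Quat) : Prop :=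
  A ⊆ S3 ∧ ∀ p ∈ A, IsInteriorPoint k A p ∨ IsBoundaryPoint k A p

/-- The boundary of an embedded surface of class `C^k`. -/
def surfaceBoundary (k : WithTop ℕ∞) (A : Set Quat) : Set Quat :=
  {p | p ∈ A ∧ IsBoundaryPoint k A p}

/-- The singular set: the points where the tangent plane is the horizontal plane. -/
def singularSet (A : Set Quat) : Set Quat := {p | p ∈ A ∧ tangentSpan A p = horizontal p}

/-- `N` is a `C¹` unit normal along the surface `A`, tangent to `𝕊³`. -/
def IsUnitNormal (A : Set Quat) (N : Quat → Quat) : Prop :=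
  ContDiffOn ℝ 1 N A ∧
    ∀ p ∈ A, ‖N p‖ = 1 ∧ inner ℝ (N p) p = 0 ∧ ∀ v ∈ tangentSpan A p, inner ℝ (N p) v = 0

/-- The horizontal Gauss map `ν_h = N_h / |N_h|`. -/
def horizontalGauss (N : Quat → Quat) (p : Quat) : Quat :=
  ‖horizontalPart p (N p)‖⁻¹ • horizontalPart p (N p)

/-- The divergence relative to `M` at `p` of a field `V` along `M` exists and equals `d`: `V` is
differentiable along `M` at `p`, and the trace of `v ↦ (D_v V)^⊤` on the tangent space of `M` is
`d`. For `M` in `𝕊³` the Levi-Civita connection of `𝕊³` gives the same trace as the connection of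
`ℝ⁴`. For `M = 𝕊³` this is the Riemannian divergence. -/
def HasDivergenceAlong (M : Set Quat) (V : Quat → Quat) (p : Quat) (d : ℝ) : Prop :=
  ∃ V' : Quat →L[ℝ] Quat, HasFDerivWithinAt V V' M p ∧
    LinearMap.trace ℝ (tangentSpan M p)
      ((tangentSpan M p).orthogonalProjectionOnto.toLinearMap ∘ₗ V'.toLinearMap ∘ₗ
        (tangentSpan M p).subtype) = d

/-- The sub-Riemannian mean curvature of `A` with respect to the unit normal `N` exists at the
regular point `p` and equals `H`, that is, `-2H = div_A ν_h`. -/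
def HasMeanCurvature (A : Set Quat) (N : Quat → Quat) (p : Quat) (H : ℝ) : Prop :=
  HasDivergenceAlong A (horizontalGauss N) p (-2 * H)

/-! ### Foliations -/

/-- The interior relative to `𝕊³`. -/
def relInterior (W : Set Quat) : Set Quat := {p | p ∈ S3 ∧ W ∈ 𝓝[S3] p}

/-- `q` and `q'` lie on a common member of the family. -/
def SameLeaf {ι : Type*} (leaf : ι → Set Quat) (q q' : Quat) : Prop :=
  ∃ t, q ∈ leaf t ∧ q' ∈ leaf t

/-- The family `leaf` is a foliation of the subset `W` of `𝕊³`: the leaves are connected embedded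
`C^k` surfaces (possibly with boundary), they partition `W`, around every point of `W` there is a
topological foliated chart of `W`, with values in half-plane times line, in which the leaves are
the slices of constant second coordinate, and around every interior point of `W` the leaves are the
level sets of a `C^k` submersion. (A chart meets each leaf in at most one slice.) -/
structure IsFoliation {ι : Type*} (k : WithTop ℕ∞) (W : Set Quat) (leaf : ι → Set Quat) :
    Prop where
  subset_sphere : W ⊆ S3
  isConnected : ∀ t, IsConnected (leaf t)
  isSurface : ∀ t, IsSurface k (leaf t)
  disjoint : ∀ s t, s ≠ t → Disjoint (leaf s) (leaf t)
  cover : ⋃ t, leaf t = W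
  chart : ∀ p : W, ∃ e : OpenPartialHomeomorph W (EuclideanHalfSpace 2 × ℝ), p ∈ e.source ∧
    ∀ q ∈ e.source, ∀ q' ∈ e.source,
      (SameLeaf leaf (q : Quat) (q' : Quat) ↔ (e q).2 = (e q').2)
  submersion : ∀ p ∈ relInterior W, ∃ (U : Set Quat) (f : Quat → ℝ), IsOpen U ∧ p ∈ U ∧
    ContDiffOn ℝ k f U ∧ (∃ v : Quat, inner ℝ p v = 0 ∧ fderiv ℝ f p v ≠ 0) ∧
    U ∩ S3 ⊆ W ∧ ∀ q ∈ U ∩ S3, ∀ q' ∈ U ∩ S3, (SameLeaf leaf q q' ↔ f q = f q')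

/-! ### Pansu spheres -/

/-- The frequency `√(1 + λ²)`. -/
def freq (lam : ℝ) : ℝ := Real.sqrt (1 + lam ^ 2)

/-- The sub-Riemannian geodesic `γ_θ` of curvature `λ` that leaves `e = (1, 0, 0, 0)` with velocity
`cos θ E₁ + sin θ E₂`. -/
def geod (lam θ s : ℝ) : Quat :=
  ⟨Real.cos (lam * s) * Real.cos (freq lam * s) +
      lam / freq lam * (Real.sin (lam * s) * Real.sin (freq lam * s)),
    -(Real.sin (lam * s) * Real.cos (freq lam * s)) +
      lam / freq lam * (Real.cos (lam * s) * Real.sin (freq lam * s)),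
    1 / freq lam * Real.sin (freq lam * s) * Real.cos (θ - lam * s),
    1 / freq lam * Real.sin (freq lam * s) * Real.sin (θ - lam * s)⟩

/-- The Pansu sphere `S_λ`. -/
def pansu (lam : ℝ) : Set Quat :=
  {p | ∃ θ ∈ Set.Ico (0 : ℝ) (2 * Real.pi), ∃ s ∈ Set.Icc (0 : ℝ) (Real.pi / freq lam),
    p = geod lam θ s}

/-- The south pole `e`. -/
def southPole : Quat := ⟨1, 0, 0, 0⟩

/-- The north pole `e^λ`, the common endpoint of the curves `γ_θ`. -/
def northPole (lam : ℝ) : Quat := geod lam 0 (Real.pi / freq lam)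

/-- The equatorial circle `C_λ`. -/
def equator (lam : ℝ) : Set Quat :=
  {p | ∃ θ ∈ Set.Ico (0 : ℝ) (2 * Real.pi), p = geod lam θ (Real.pi / (2 * freq lam))}

/-- The angle `τ_λ`, the spherical coordinate `τ` of the north pole. -/
def tauAngle (lam : ℝ) : ℝ := Real.pi * (1 - lam / freq lam)

/-- The linear form whose zero set in `𝕊³` is the rotationally invariant totally geodesic sphere of
spherical coordinate `τ = τ_λ / 2` modulo `π`, which contains `C_λ`. It is positive at `e`. -/
def heightForm (lam : ℝ) (p : Quat) : ℝ :=
  Real.sin (tauAngle lam / 2) * p.re - Real.cos (tauAngle lam / 2) * p.imI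

/-- The closed half-sphere `S_λ⁺` of `S_λ`, on the side of the south pole. -/
def halfPlus (lam : ℝ) : Set Quat := {p | p ∈ pansu lam ∧ 0 ≤ heightForm lam p}

/-- The closed half-sphere `S_λ⁻` of `S_λ`, on the side of the north pole. -/
def halfMinus (lam : ℝ) : Set Quat := {p | p ∈ pansu lam ∧ heightForm lam p ≤ 0}

/-- The vertical solid tube `W_λ`, with `W_0 = 𝕊³ - C₀`. -/
def solidTube (lam : ℝ) : Set Quat :=
  if lam = 0 then S3 \ circleC0 else {p | p ∈ S3 ∧ distL p ≤ Real.arctan (1 / lam)}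

/-- The translate `φ_t ∘ N ∘ φ_t⁻¹` of a field `N`. -/
def translateField (t : ℝ) (N : Quat → Quat) (p : Quat) : Quat :=
  vertTrans t (N (vertTrans (-t) p))

theorem freq_pos (lam : ℝ) : 0 < freq lam := Real.sqrt_pos.mpr (by positivity)

/-- The equatorial circle lies in the totally geodesic sphere that cuts off the half-spheres. -/
theorem heightForm_equator (lam : ℝ) : ∀ p ∈ equator lam, heightForm lam p = 0 := by
  rintro p ⟨θ, -, rfl⟩
  have h := (freq_pos lam).ne'
  have h1 : freq lam * (Real.pi / (2 * freq lam)) = Real.pi / 2 := by field_simp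
  have h2 : tauAngle lam / 2 = Real.pi / 2 - lam * (Real.pi / (2 * freq lam)) := by
    unfold tauAngle; field_simp
  simp only [heightForm, geod, h1, h2, Real.sin_pi_div_two_sub, Real.cos_pi_div_two_sub,
    Real.cos_pi_div_two, Real.sin_pi_div_two]
  ring

/-- The south pole lies strictly on the positive side. -/
theorem heightForm_southPole (lam : ℝ) (hlam : 0 ≤ lam) : 0 < heightForm lam southPole := by
  have h := freq_pos lam
  have h1 : lam < freq lam := by
    unfold freq
    exact Real.lt_sqrt_of_sq_lt (by linarith)
  have h2 : 0 < 1 - lam / freq lam := by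
    rw [sub_pos, div_lt_one h]; exact h1
  have h3 : 1 - lam / freq lam ≤ 1 := by
    have : 0 ≤ lam / freq lam := by positivity
    linarith
  simp only [heightForm, southPole, mul_one, mul_zero, sub_zero]
  apply Real.sin_pos_of_pos_of_lt_pi
  · unfold tauAngle; positivity
  · unfold tauAngle; nlinarith [Real.pi_pos]

end PansuSphere

end

open PansuSphere

/-!
The two half-spheres are treated at once, with a sign `ε = ±1` (`half_eq_leaf`). In the complex
coordinates `z₁`, `z₂`, the curves `γ_θ` all have the same first coordinate, a fixed rotation of
`e^{iμu}(μ cos u - i sin u)` with `μ = λ/κ` and the latitude `u = π/2 - κs`, and `|z₂| = cos u / κ`.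
So the leaf `φ_t(S_λ^±)` is the set of points of `𝕊³` with `z₁` on an arc of a rotated profile
curve, or equally the graph `z₁ = e^{it} ψ(|z₂|)` over the disc `κ|z₂| ≤ 1` (`mem_leaf_iff`).

*Regularity.* The graph is of class `C²` also at the pole `z₂ = 0`, because `ψ'(r) = r φ(r)` with a
smooth `φ` (`contDiffOn_radial`). At the equator `ψ` is not differentiable, but there the height
above the totally geodesic sphere is a smooth coordinate of the profile curve, which gives a chart
with boundary (`isBoundaryPoint_gP`). Off the equator there are no boundary points, since the
one-sided tangent directions fill the tangent plane (`not_isBoundaryPoint`).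

*Foliation.* The function `z₁ · conj ψ(|z₂|)` on the tube is multiplied by `e^{is}` under `φ_s`, and
its argument at a point is the parameter `t` of the leaf through the point. Hence the leaves
partition the tube, and the slope of this function is a local submersion with the leaves as level
sets (`fderiv_slope_ne_zero`); together with a Cayley transform of `±κ z₂` it gives the charts up to
the boundary (`exists_chart`).

*Curvature and divergence.* At a point with unit numbers `η`, `ξ`, with `r = |z₂|` and `w = sin u`,
the position is `(η(λr - iw), ξr)`, the velocity of `γ_θ` is a multiple of
`Y = (-iηr, ξ(-w + iλr))`, and the horizontal Gauss map is `X = (ηr, -ξ(λr + iw))`.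
Differentiation along the geodesic gives `D_Y X = -2λ Y - T` (`deriv_gY`). In the directions
spanned by `X` and `T` the derivative of `X` contributes nothing to the trace, because `X` is a
unit field orthogonal to the Killing field `T` (`inner_deriv_eq_zero`). So both the divergence
along the leaf and the divergence in `𝕊³` are `⟪Y, D_Y X⟫ = -2λ` (`hasMeanCurvature_leaf`,
`hasDivergenceAlong_gaussField`).
-/

noncomputable section

namespace PansuSphere

open Filter Set

/-! ### Complex coordinates -/

/-- The first complex coordinate `z₁ = x₁ + i y₁`. -/
def zOne : Quat →L[ℝ] ℂ :=
  LinearMap.toContinuousLinearMap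
    { toFun := fun p => ⟨p.re, p.imI⟩
      map_add' := fun p q => by apply Complex.ext <;> simp
      map_smul' := fun a p => by apply Complex.ext <;> simp }

/-- The second complex coordinate `z₂ = x₂ + i y₂`. -/
def zTwo : Quat →L[ℝ] ℂ :=
  LinearMap.toContinuousLinearMap
    { toFun := fun p => ⟨p.imJ, p.imK⟩
      map_add' := fun p q => by apply Complex.ext <;> simp
      map_smul' := fun a p => by apply Complex.ext <;> simp }

/-- The quaternion `a + b j` with complex coordinates `a`, `b`. -/
def mk (a b : ℂ) : Quat := ⟨a.re, a.im, b.re, b.im⟩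

@[simp] theorem mk_re (a b : ℂ) : (mk a b).re = a.re := rfl
@[simp] theorem mk_imI (a b : ℂ) : (mk a b).imI = a.im := rfl
@[simp] theorem mk_imJ (a b : ℂ) : (mk a b).imJ = b.re := rfl
@[simp] theorem mk_imK (a b : ℂ) : (mk a b).imK = b.im := rfl
@[simp] theorem qI_re : qI.re = 0 := rfl
@[simp] theorem qI_imI : qI.imI = 1 := rfl
@[simp] theorem qI_imJ : qI.imJ = 0 := rfl
@[simp] theorem qI_imK : qI.imK = 0 := rfl
@[simp] theorem qJ_re : qJ.re = 0 := rfl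
@[simp] theorem qJ_imI : qJ.imI = 0 := rfl
@[simp] theorem qJ_imJ : qJ.imJ = 1 := rfl
@[simp] theorem qJ_imK : qJ.imK = 0 := rfl
@[simp] theorem qK_re : qK.re = 0 := rfl
@[simp] theorem qK_imI : qK.imI = 0 := rfl
@[simp] theorem qK_imJ : qK.imJ = 0 := rfl
@[simp] theorem qK_imK : qK.imK = 1 := rfl
@[simp] theorem expI_re (t : ℝ) : (expI t).re = Real.cos t := rfl
@[simp] theorem expI_imI (t : ℝ) : (expI t).imI = Real.sin t := rfl
@[simp] theorem expI_imJ (t : ℝ) : (expI t).imJ = 0 := rfl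
@[simp] theorem expI_imK (t : ℝ) : (expI t).imK = 0 := rfl

/-- The map `mk` as a continuous linear map. -/
def mkL : ℂ × ℂ →L[ℝ] Quat :=
  LinearMap.toContinuousLinearMap
    { toFun := fun z => mk z.1 z.2
      map_add' := fun p q => by ext <;> simp
      map_smul' := fun a p => by ext <;> simp }

@[simp] theorem zOne_re (p : Quat) : (zOne p).re = p.re := rfl
@[simp] theorem zOne_im (p : Quat) : (zOne p).im = p.imI := rfl
@[simp] theorem zTwo_re (p : Quat) : (zTwo p).re = p.imJ := rfl
@[simp] theorem zTwo_im (p : Quat) : (zTwo p).im = p.imK := rfl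
@[simp] theorem zOne_mk (a b : ℂ) : zOne (mk a b) = a := rfl
@[simp] theorem zTwo_mk (a b : ℂ) : zTwo (mk a b) = b := rfl
@[simp] theorem mk_zOne_zTwo (p : Quat) : mk (zOne p) (zTwo p) = p := rfl

theorem quat_ext {p q : Quat} (h1 : zOne p = zOne q) (h2 : zTwo p = zTwo q) : p = q := by
  rw [← mk_zOne_zTwo p, ← mk_zOne_zTwo q, h1, h2]

theorem mk_add (a b c d : ℂ) : mk a b + mk c d = mk (a + c) (b + d) := by
  apply quat_ext <;> simp

theorem mk_sub (a b c d : ℂ) : mk a b - mk c d = mk (a - c) (b - d) := by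
  apply quat_ext <;> simp

theorem smul_mk (x : ℝ) (a b : ℂ) : x • mk a b = mk (x * a) (x * b) := by
  apply quat_ext <;> simp

theorem inner_eq (p q : Quat) : inner ℝ p q =
    p.re * q.re + p.imI * q.imI + p.imJ * q.imJ + p.imK * q.imK := by
  rw [Quaternion.inner_def]; simp

theorem inner_mk (a b c d : ℂ) : inner ℝ (mk a b) (mk c d) =
    (a * (starRingEnd ℂ) c).re + (b * (starRingEnd ℂ) d).re := by
  rw [inner_eq]; simp [mk]; ring

theorem norm_sq_eq (p : Quat) : ‖p‖ ^ 2 = ‖zOne p‖ ^ 2 + ‖zTwo p‖ ^ 2 := by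
  rw [← real_inner_self_eq_norm_sq, inner_eq, ← Complex.normSq_eq_norm_sq,
    ← Complex.normSq_eq_norm_sq, Complex.normSq_apply, Complex.normSq_apply]
  simp; ring

theorem mem_S3 {p : Quat} : p ∈ S3 ↔ ‖zOne p‖ ^ 2 + ‖zTwo p‖ ^ 2 = 1 := by
  rw [← norm_sq_eq]
  constructor
  · intro h; rw [show ‖p‖ = 1 from h]; norm_num
  · intro h
    have := norm_nonneg p
    change ‖p‖ = 1
    nlinarith

theorem inner_self_of_mem_S3 {p : Quat} (hp : p ∈ S3) : inner ℝ p p = 1 := by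
  rw [real_inner_self_eq_norm_sq, show ‖p‖ = 1 from hp]; norm_num

/-- The unit complex number `exp(ix)`. -/
def cis (x : ℝ) : ℂ := Complex.exp (x * Complex.I)

@[simp] theorem cis_re (x : ℝ) : (cis x).re = Real.cos x := Complex.exp_ofReal_mul_I_re x
@[simp] theorem cis_im (x : ℝ) : (cis x).im = Real.sin x := Complex.exp_ofReal_mul_I_im x
@[simp] theorem norm_cis (x : ℝ) : ‖cis x‖ = 1 := Complex.norm_exp_ofReal_mul_I x
theorem cis_add (x y : ℝ) : cis (x + y) = cis x * cis y := by
  rw [cis, cis, cis, ← Complex.exp_add]; congr 1; push_cast; ring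
@[simp] theorem cis_zero : cis 0 = 1 := by simp [cis]
theorem cis_ne_zero (x : ℝ) : cis x ≠ 0 := Complex.exp_ne_zero _
theorem cis_neg_mul (x : ℝ) : cis (-x) * cis x = 1 := by rw [← cis_add]; simp
theorem cis_mul_neg (x : ℝ) : cis x * cis (-x) = 1 := by rw [← cis_add]; simp

theorem contDiff_cis {n : WithTop ℕ∞} : ContDiff ℝ n cis := by
  unfold cis
  exact (Complex.ofRealCLM.contDiff.mul contDiff_const).cexp

theorem hasDerivAt_cis (x : ℝ) : HasDerivAt cis (Complex.I * cis x) x := by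
  have h : HasDerivAt (fun x : ℝ => (x : ℂ) * Complex.I) (1 * Complex.I) x :=
    (Complex.ofRealCLM.hasDerivAt).mul_const _
  have := h.cexp
  refine this.congr_deriv ?_
  rw [cis]; ring

theorem exists_cis (z : ℂ) (hz : ‖z‖ = 1) : ∃ t ∈ Ico (0 : ℝ) (2 * Real.pi), z = cis t := by
  have h2 : (0 : ℝ) < 2 * Real.pi := by positivity
  refine ⟨toIcoMod h2 0 z.arg, by simpa using toIcoMod_mem_Ico h2 0 z.arg, ?_⟩
  rw [toIcoMod, sub_eq_add_neg, cis_add]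
  have h3 : cis (-(toIcoDiv h2 0 z.arg • (2 * Real.pi))) = 1 := by
    rw [cis, Complex.exp_eq_one_iff]
    exact ⟨-toIcoDiv h2 0 z.arg, by push_cast; simp; ring⟩
  rw [h3, mul_one, cis]
  have := Complex.norm_mul_exp_arg_mul_I z
  rw [hz] at this
  simpa using this.symm

theorem cis_injOn : InjOn cis (Ico (0 : ℝ) (2 * Real.pi)) := by
  intro s hs t ht h
  rw [cis, cis, Complex.exp_eq_exp_iff_exists_int] at h
  obtain ⟨n, hn⟩ := h
  have h1 : s = t + n * (2 * Real.pi) := by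
    have := congrArg Complex.im hn
    simpa using this
  have h2 : (0 : ℝ) < 2 * Real.pi := by positivity
  have h3 : (n : ℝ) < 1 := by
    by_contra hh; push Not at hh
    nlinarith [hs.1, hs.2, ht.1, ht.2]
  have h4 : (-1 : ℝ) < n := by
    by_contra hh; push Not at hh
    nlinarith [hs.1, hs.2, ht.1, ht.2]
  have h5 : n = 0 := by
    have : n < 1 := by exact_mod_cast h3
    have : -1 < n := by exact_mod_cast h4
    omega
  rw [h1, h5]; simp

theorem vertTrans_eq (t : ℝ) (p : Quat) : vertTrans t p = mk (cis t * zOne p) (cis t * zTwo p) := by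
  ext <;> simp [vertTrans]

theorem T_eq (p : Quat) : T p = mk (Complex.I * zOne p) (Complex.I * zTwo p) := by
  ext <;> simp [T]

theorem rot_eq (θ : ℝ) (p : Quat) : rot θ p = mk (zOne p) (cis θ * zTwo p) := by
  have h : rot θ p = mk ⟨p.re, p.imI⟩
      ⟨Real.cos θ * p.imJ - Real.sin θ * p.imK, Real.sin θ * p.imJ + Real.cos θ * p.imK⟩ := rfl
  rw [h]
  ext <;> simp; ring

theorem vertTrans_neg_vertTrans (t : ℝ) (p : Quat) : vertTrans (-t) (vertTrans t p) = p := by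
  rw [vertTrans_eq (-t), vertTrans_eq]
  apply quat_ext <;> simp [← mul_assoc, cis_neg_mul]

theorem vertTrans_vertTrans_neg (t : ℝ) (p : Quat) : vertTrans t (vertTrans (-t) p) = p := by
  simpa using vertTrans_neg_vertTrans (-t) p

theorem mem_vertTrans_image {t : ℝ} {A : Set Quat} {p : Quat} :
    p ∈ vertTrans t '' A ↔ vertTrans (-t) p ∈ A := by
  constructor
  · rintro ⟨q, hq, rfl⟩; rwa [vertTrans_neg_vertTrans]
  · intro h; exact ⟨_, h, vertTrans_vertTrans_neg t p⟩

/-- The decomposition of a vector in the orthonormal frame `p`, `T(p)`, `E₁(p)`, `E₂(p)`. -/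
theorem eq_frame_sum {p : Quat} (hp : p ∈ S3) (v : Quat) :
    v = inner ℝ v p • p + inner ℝ v (T p) • T p + horizontalPart p v := by
  have h : p.re ^ 2 + p.imI ^ 2 + p.imJ ^ 2 + p.imK ^ 2 = 1 := by
    have := inner_self_of_mem_S3 hp
    rw [inner_eq] at this; linarith
  simp only [horizontalPart, inner_eq, T, E1, E2]
  ext
  · simp; linear_combination (-v.re) * h
  · simp; linear_combination (-v.imI) * h
  · simp; linear_combination (-v.imJ) * h
  · simp; linear_combination (-v.imK) * h

theorem inner_E1_T (p : Quat) : inner ℝ (E1 p) (T p) = 0 ∧ inner ℝ (E2 p) (T p) = 0 ∧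
    inner ℝ (E1 p) p = 0 ∧ inner ℝ (E2 p) p = 0 ∧ inner ℝ (T p) p = 0 := by
  simp only [inner_eq, T, E1, E2]
  refine ⟨?_, ?_, ?_, ?_, ?_⟩ <;> simp <;> ring

theorem mem_horizontal {p : Quat} (hp : p ∈ S3) {v : Quat} :
    v ∈ horizontal p ↔ inner ℝ v p = 0 ∧ inner ℝ v (T p) = 0 := by
  obtain ⟨h1, h2, h3, h4, -⟩ := inner_E1_T p
  constructor
  · intro h
    obtain ⟨a, b, rfl⟩ := Submodule.mem_span_pair.1 h
    simp [inner_add_left, inner_smul_left, h1, h2, h3, h4]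
  · rintro ⟨ha, hb⟩
    rw [eq_frame_sum hp v, ha, hb, zero_smul, zero_smul, zero_add, zero_add]
    exact Submodule.mem_span_pair.2 ⟨_, _, rfl⟩

theorem finrank_quat : Module.finrank ℝ Quat = 4 := Quaternion.finrank_eq_four

theorem eq_of_orthonormal {e : Fin 4 → Quat} (he : Orthonormal ℝ e) (v : Quat) :
    v = inner ℝ (e 0) v • e 0 + inner ℝ (e 1) v • e 1 + inner ℝ (e 2) v • e 2 +
      inner ℝ (e 3) v • e 3 := by
  have hc : Fintype.card (Fin 4) = Module.finrank ℝ Quat := by rw [finrank_quat]; simp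
  let b := basisOfOrthonormalOfCardEqFinrank he hc
  have hb : (b : Fin 4 → Quat) = e := coe_basisOfOrthonormalOfCardEqFinrank he hc
  let B := b.toOrthonormalBasis (by rw [hb]; exact he)
  have hB : (B : Fin 4 → Quat) = e := by simp [B, hb]
  have := B.sum_repr' v
  rw [hB, Fin.sum_univ_four] at this
  exact this.symm

/-! ### Tangent cones -/

/-- The right derivative of a curve that returns to `A` at arbitrarily small times is a one-sided
tangent direction of `A`. -/
theorem mem_tangentConeAt_of_curve {A : Set Quat} {p v : Quat} {c : ℝ → Quat}
    (hc0 : c 0 = p) (hc : HasDerivWithinAt c v (Ioi 0) 0) (hA : ∃ᶠ s in 𝓝[>] (0 : ℝ), c s ∈ A) :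
    v ∈ posTangentConeAt A p := by
  refine mem_tangentConeAt_of_frequently (𝓝[>] (0 : ℝ)) (fun s => Real.toNNReal s⁻¹)
    (fun s => c s - p) ?_ ?_ ?_
  · have := hc.continuousWithinAt.tendsto
    rw [hc0] at this
    simpa using this.sub_const p
  · simpa using hA
  · have := (hasDerivWithinAt_iff_tendsto_slope' (by simp)).1 hc
    refine this.congr' ?_
    filter_upwards [self_mem_nhdsWithin] with s hs
    have hs' : (0 : ℝ) < s := hs
    rw [slope, NNReal.smul_def, Real.coe_toNNReal _ (by positivity)]
    simp [hc0]

theorem tangentConeAt_of_posTangentConeAt {A : Set Quat} {p v : Quat}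
    (h : v ∈ posTangentConeAt A p) : v ∈ tangentConeAt ℝ A p := by
  obtain ⟨α, l, hl, c, d, h1, h2, h3⟩ := exists_fun_of_mem_tangentConeAt h
  exact mem_tangentConeAt_of_seq l (fun n => (c n : ℝ)) d h1 h2 h3

theorem mem_tangentSpan_of_pos {A : Set Quat} {p v : Quat}
    (h : v ∈ posTangentConeAt A p) : v ∈ tangentSpan A p :=
  Submodule.subset_span (tangentConeAt_of_posTangentConeAt h)

/-- Two maps that agree on `A` have derivatives that agree on the tangent space of `A`. -/
theorem fderiv_eq_of_eqOn {F : Type*} [NormedAddCommGroup F] [NormedSpace ℝ F] {A : Set Quat}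
    {p : Quat} {f g : Quat → F} {f' g' : Quat →L[ℝ] F} (hf : HasFDerivWithinAt f f' A p)
    (hg : HasFDerivWithinAt g g' A p) (h : f =ᶠ[𝓝[A] p] g) (hp : p ∈ A) {v : Quat}
    (hv : v ∈ tangentSpan A p) : f' v = g' v := by
  have h1 := (hg.congr_of_eventuallyEq h (h.self_of_nhdsWithin hp)).unique_on hf
  have h2 : tangentSpan A p ≤ LinearMap.eqLocus g'.toLinearMap f'.toLinearMap :=
    Submodule.span_le.2 h1
  exact (h2 hv).symm

theorem inner_eq_zero_of_mem_tangentSpan {A : Set Quat} (hA : A ⊆ S3) {p : Quat} (hp : p ∈ A)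
    {v : Quat} (hv : v ∈ tangentSpan A p) : inner ℝ p v = 0 := by
  have h1 : HasFDerivWithinAt (fun q : Quat => inner ℝ q q)
      ((fderivInnerCLM ℝ (p, p)).comp ((ContinuousLinearMap.id ℝ Quat).prod
        (ContinuousLinearMap.id ℝ Quat))) A p :=
    (hasFDerivWithinAt_id p A).inner ℝ (hasFDerivWithinAt_id p A)
  have h2 : HasFDerivWithinAt (fun _ : Quat => (1 : ℝ)) (0 : Quat →L[ℝ] ℝ) A p :=
    hasFDerivWithinAt_const _ _ _
  have := fderiv_eq_of_eqOn h1 h2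
    (eventually_of_mem self_mem_nhdsWithin fun q hq => inner_self_of_mem_S3 (hA hq)) hp hv
  simp [real_inner_comm] at this
  exact this

/-- The trace in the definition of the divergence, in terms of an orthonormal basis. -/
theorem trace_eq_sum {n : ℕ} {W : Submodule ℝ Quat} {e : Fin n → Quat} (he : Orthonormal ℝ e)
    (hW : W = Submodule.span ℝ (range e)) (V' : Quat →L[ℝ] Quat) :
    LinearMap.trace ℝ W (W.orthogonalProjectionOnto.toLinearMap ∘ₗ V'.toLinearMap ∘ₗ W.subtype) =
      ∑ i, inner ℝ (e i) (V' (e i)) := by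
  subst hW
  let b := Module.Basis.span he.linearIndependent
  have hb : ∀ i, (b i : Quat) = e i := fun i => by
    rw [Module.Basis.span_apply]
  let B := b.toOrthonormalBasis (by
    rw [orthonormal_iff_ite] at he ⊢
    intro i j
    rw [Submodule.coe_inner, hb, hb]; exact he i j)
  rw [LinearMap.trace_eq_sum_inner _ B]
  refine Finset.sum_congr rfl fun i _ => ?_
  have hBi : (B i : Quat) = e i := by simp [B, hb]
  rw [LinearMap.comp_apply, ContinuousLinearMap.coe_coe]
  rw [Submodule.coe_inner, hBi]
  rw [← hBi]
  exact (Submodule.inner_orthogonalProjectionOnto_eq_of_mem_left (B i) _).trans (by simp)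

/-! ### Radial functions -/

section Radial

variable {E F : Type*} [NormedAddCommGroup E] [InnerProductSpace ℝ E]
  [NormedAddCommGroup F] [NormedSpace ℝ F]

theorem hasFDerivAt_norm {z : E} (hz : z ≠ 0) :
    HasFDerivAt (fun z : E => ‖z‖) (‖z‖⁻¹ • innerSL ℝ z) z := by
  have h0 : ‖z‖ ≠ 0 := norm_ne_zero_iff.2 hz
  have h1 := (hasStrictFDerivAt_norm_sq z).hasFDerivAt.sqrt (by positivity)
  have h2 : (fun z : E => Real.sqrt (‖z‖ ^ 2)) = fun z => ‖z‖ := by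
    funext z; rw [Real.sqrt_sq (norm_nonneg z)]
  rw [h2] at h1
  refine h1.congr_fderiv ?_
  ext v
  simp only [one_div, Real.sqrt_sq (norm_nonneg z)]
  simp
  field_simp

/-- The function `⟪z, v⟫ φ(|z|)` is of class `C¹`, also at the origin: the factor `⟪z, v⟫` makes up
for the corner of `|z|`. -/
theorem contDiffOn_inner_smul_radial {φ : ℝ → F} {R : ℝ} (hφ : ContDiffOn ℝ 1 φ (Ioo (-R) R))
    (v : E) : ContDiffOn ℝ 1 (fun z : E => inner ℝ v z • φ ‖z‖) (Metric.ball 0 R) := by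
  have hmem : ∀ z ∈ Metric.ball (0 : E) R, ‖z‖ ∈ Ioo (-R) R := by
    intro z hz
    have := mem_ball_zero_iff.1 hz
    exact ⟨by linarith [norm_nonneg z], this⟩
  have hd : ∀ r ∈ Ioo (-R) R, HasDerivAt φ (deriv φ r) r := fun r hr =>
    ((hφ.differentiableOn (by norm_num)).differentiableAt (isOpen_Ioo.mem_nhds hr)).hasDerivAt
  have hc : ContinuousOn φ (Ioo (-R) R) := hφ.continuousOn
  have hdc : ContinuousOn (deriv φ) (Ioo (-R) R) :=
    hφ.continuousOn_deriv_of_isOpen isOpen_Ioo (by norm_num)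
  let D : E → E →L[ℝ] F := fun z => (innerSL ℝ v).smulRight (φ ‖z‖) +
    ((inner ℝ v z * ‖z‖⁻¹) • innerSL ℝ z).smulRight (deriv φ ‖z‖)
  have hD : ∀ z ∈ Metric.ball (0 : E) R,
      HasFDerivAt (fun z : E => inner ℝ v z • φ ‖z‖) (D z) z := by
    intro z hz
    by_cases hz0 : z = 0
    · subst hz0
      have h1 : HasFDerivAt (fun z : E => inner ℝ v z • φ 0) ((innerSL ℝ v).smulRight (φ 0)) 0 :=
        ((innerSL ℝ v).smulRight (φ 0)).hasFDerivAt
      have h2 : HasFDerivAt (fun z : E => inner ℝ v z • (φ ‖z‖ - φ 0)) (0 : E →L[ℝ] F) 0 := by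
        rw [hasFDerivAt_iff_isLittleO]
        have h3 : (fun z : E => φ ‖z‖ - φ 0) =o[𝓝 0] (fun _ : E => (1 : ℝ)) := by
          rw [Asymptotics.isLittleO_one_iff]
          have h4 : ContinuousAt (fun z : E => φ ‖z‖) 0 :=
            ContinuousAt.comp (g := φ) (f := fun z : E => ‖z‖)
              (hc.continuousAt (isOpen_Ioo.mem_nhds (hmem 0 hz))) continuous_norm.continuousAt
          have := h4.tendsto.sub_const (φ 0)
          simpa using this
        have h4 : (fun z : E => (inner ℝ v z : ℝ)) =O[𝓝 0] (fun z : E => ‖z‖) :=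
          ((innerSL ℝ v).isBigO_id (𝓝 0)).norm_right
        have := h4.smul_isLittleO h3
        simp only [sub_zero, inner_zero_right, zero_smul]
        refine Asymptotics.isLittleO_norm_right.1 ?_
        simpa using this
      have := h1.add h2
      refine (this.congr_fderiv ?_).congr_of_eventuallyEq (Eventually.of_forall fun z => ?_)
      · ext w; simp [D]
      · simp [← smul_add]
    · have h1 := (hd _ (hmem z hz)).hasFDerivAt.comp z (hasFDerivAt_norm hz0)
      have h2 := ((innerSL ℝ v).hasFDerivAt (x := z)).smul h1
      refine h2.congr_fderiv ?_
      ext w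
      simp [D, smul_smul]
      rw [add_comm]
  have h1 : (1 : WithTop ℕ∞) = 0 + 1 := by norm_num
  rw [h1, contDiffOn_succ_iff_fderiv_of_isOpen Metric.isOpen_ball]
  refine ⟨fun z hz => (hD z hz).differentiableAt.differentiableWithinAt, by simp, ?_⟩
  rw [contDiffOn_zero]
  refine ContinuousOn.congr (f := D) ?_ fun z hz => (hD z hz).fderiv
  have hφc : ContinuousOn (fun z : E => φ ‖z‖) (Metric.ball 0 R) :=
    hc.comp continuous_norm.continuousOn hmem
  have hφ'c : ContinuousOn (fun z : E => deriv φ ‖z‖) (Metric.ball 0 R) :=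
    hdc.comp continuous_norm.continuousOn hmem
  have hB : Continuous fun z : E => (inner ℝ v z * ‖z‖⁻¹) • innerSL ℝ z := by
    rw [continuous_iff_continuousAt]
    intro z
    by_cases hz0 : z = 0
    · subst hz0
      rw [ContinuousAt, inner_zero_right, zero_mul, zero_smul]
      refine squeeze_zero_norm (a := fun z : E => ‖v‖ * ‖z‖) (fun z => ?_) ?_
      · rw [norm_smul, innerSL_apply_norm, norm_mul, norm_inv, norm_norm]
        by_cases hz : ‖z‖ = 0
        · simp [hz]
        · rw [mul_assoc, inv_mul_cancel₀ hz, mul_one]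
          exact norm_inner_le_norm v z
      · have : Continuous fun z : E => ‖v‖ * ‖z‖ := by fun_prop
        simpa using this.tendsto 0
    · have h0 : ‖z‖ ≠ 0 := norm_ne_zero_iff.2 hz0
      have h1 : ContinuousAt (fun z : E => ‖z‖⁻¹) z := continuous_norm.continuousAt.inv₀ h0
      have h2 : ContinuousAt (fun z : E => (inner ℝ v z : ℝ)) z := by fun_prop
      have h3 : ContinuousAt (fun z : E => innerSL ℝ z) z := (innerSL ℝ).continuous.continuousAt
      exact (h2.mul h1).smul h3
  have hS : Continuous fun x : (E →L[ℝ] ℝ) × F => x.1.smulRight x.2 :=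
    isBoundedBilinearMap_smulRight.continuous
  exact (hS.comp_continuousOn (continuousOn_const.prodMk hφc)).add
    (hS.comp_continuousOn (hB.continuousOn.prodMk hφ'c))

variable {ψ φ : ℝ → F} {R : ℝ}

/-- If `ψ'(r) = r φ(r)`, then the derivative of `ψ(|z|)` is `φ(|z|) ⟪z, ·⟫`, without singularity at
the origin. -/
theorem hasFDerivAt_radial (hψ : ∀ r ∈ Ioo (-R) R, HasDerivAt ψ (r • φ r) r) {z : E}
    (hz : z ∈ Metric.ball 0 R) :
    HasFDerivAt (fun z : E => ψ ‖z‖) ((innerSL ℝ z).smulRight (φ ‖z‖)) z := by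
  have hmem : ‖z‖ ∈ Ioo (-R) R := by
    have := mem_ball_zero_iff.1 hz
    exact ⟨by linarith [norm_nonneg z], this⟩
  by_cases hz0 : z = 0
  · subst hz0
    have h1 := hψ _ hmem
    simp only [norm_zero, zero_smul] at h1
    rw [hasDerivAt_iff_isLittleO] at h1
    rw [hasFDerivAt_iff_isLittleO]
    have h2 : Tendsto (fun z : E => ‖z‖) (𝓝 0) (𝓝 0) := by
      simpa using (continuous_norm (E := E)).tendsto 0
    refine Asymptotics.isLittleO_norm_right.1 ?_
    simpa [Function.comp_def] using h1.comp_tendsto h2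
  · refine ((hψ _ hmem).hasFDerivAt.comp z (hasFDerivAt_norm hz0)).congr_fderiv ?_
    have h0 : ‖z‖ ≠ 0 := norm_ne_zero_iff.2 hz0
    ext w
    simp [smul_smul]
    congr 1
    field_simp

/-- If `ψ'(r) = r φ(r)` with `φ` of class `C¹`, then `ψ(|z|)` is of class `C²`, also at the
origin. -/
theorem contDiffOn_radial [FiniteDimensional ℝ E]
    (hψ : ∀ r ∈ Ioo (-R) R, HasDerivAt ψ (r • φ r) r) (hφ : ContDiffOn ℝ 1 φ (Ioo (-R) R)) :
    ContDiffOn ℝ 2 (fun z : E => ψ ‖z‖) (Metric.ball 0 R) := by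
  have h1 : (2 : WithTop ℕ∞) = 1 + 1 := by norm_num
  rw [h1, contDiffOn_succ_iff_fderiv_of_isOpen Metric.isOpen_ball]
  refine ⟨fun z hz => (hasFDerivAt_radial hψ hz).differentiableAt.differentiableWithinAt,
    by simp, ?_⟩
  rw [contDiffOn_clm_apply]
  intro v
  refine (contDiffOn_inner_smul_radial hφ v).congr fun z hz => ?_
  rw [(hasFDerivAt_radial hψ hz).fderiv]
  simp [real_inner_comm]

end Radial

/-! ### Smooth inverse functions on the line -/

/-- The inverse of an injective `C^n` function with nonzero derivative on an open set is `C^n`. -/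
theorem contDiffOn_invFunOn {h : ℝ → ℝ} {h' : ℝ → ℝ} {I : Set ℝ} {n : WithTop ℕ∞} (hn : n ≠ 0)
    (hI : IsOpen I) (hh : ContDiff ℝ n h) (hd : ∀ x ∈ I, HasDerivAt h (h' x) x)
    (hne : ∀ x ∈ I, h' x ≠ 0) (hinj : InjOn h I) :
    IsOpen (h '' I) ∧ ContDiffOn ℝ n (Function.invFunOn h I) (h '' I) := by
  have key : ∀ x ∈ I, ∃ g : ℝ → ℝ, ContDiffAt ℝ n g (h x) ∧
      ∀ᶠ y in 𝓝 (h x), g y ∈ I ∧ h (g y) = y := by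
    intro x hx
    let e : ℝ ≃L[ℝ] ℝ := ContinuousLinearEquiv.unitsEquivAut ℝ (Units.mk0 (h' x) (hne x hx))
    have hf : HasFDerivAt h (e : ℝ →L[ℝ] ℝ) x := by
      refine (hd x hx).hasFDerivAt.congr_fderiv ?_
      ext; simp [e]
    have hc : ContDiffAt ℝ n h x := hh.contDiffAt
    refine ⟨hc.localInverse hf hn, hc.to_localInverse hf hn, ?_⟩
    have h1 : ∀ᶠ y in 𝓝 (h x), hc.localInverse hf hn y ∈ I := by
      refine (hc.to_localInverse hf hn).continuousAt.eventually_mem ?_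
      rw [hc.localInverse_apply_image hf hn]
      exact hI.mem_nhds hx
    exact h1.and (hc.hasStrictFDerivAt' hf hn).eventually_right_inverse
  constructor
  · rw [isOpen_iff_mem_nhds]
    rintro _ ⟨x, hx, rfl⟩
    obtain ⟨g, -, hg⟩ := key x hx
    filter_upwards [hg] with y hy using ⟨g y, hy.1, hy.2⟩
  · rintro _ ⟨x, hx, rfl⟩
    obtain ⟨g, hg1, hg⟩ := key x hx
    refine (hg1.congr_of_eventuallyEq ?_).contDiffWithinAt
    filter_upwards [hg] with y hy
    have hy' : y ∈ h '' I := ⟨g y, hy.1, hy.2⟩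
    refine hinj (Function.invFunOn_mem hy') hy.1 ?_
    rw [Function.invFunOn_eq hy', hy.2]

/-! ### Interior and boundary points -/

theorem IsInteriorPoint.diff_closed {k : WithTop ℕ∞} {A C : Set Quat} {p : Quat}
    (h : IsInteriorPoint k A p) (hC : IsClosed C) (hp : p ∉ C) : IsInteriorPoint k (A \ C) p := by
  obtain ⟨U, f, hU, hpU, hf, hv, hA⟩ := h
  refine ⟨U \ C, f, hU.sdiff hC, ⟨hpU, hp⟩, hf.mono sdiff_subset, hv, ?_⟩
  ext q
  have := Set.ext_iff.1 hA q
  simp only [mem_inter_iff, Set.mem_sdiff, mem_ofPred_eq] at this ⊢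
  tauto

theorem IsBoundaryPoint.diff_closed {k : WithTop ℕ∞} {A C : Set Quat} {p : Quat}
    (h : IsBoundaryPoint k A p) (hC : IsClosed C) (hp : p ∉ C) : IsBoundaryPoint k (A \ C) p := by
  obtain ⟨U, f, g, hU, hpU, hf, hg, hg0, hv, hA⟩ := h
  refine ⟨U \ C, f, g, hU.sdiff hC, ⟨hpU, hp⟩, hf.mono sdiff_subset, hg.mono sdiff_subset, hg0, hv,
    ?_⟩
  ext q
  have := Set.ext_iff.1 hA q
  simp only [mem_inter_iff, Set.mem_sdiff, mem_ofPred_eq] at this ⊢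
  tauto

theorem IsSurface.diff_closed {k : WithTop ℕ∞} {A C : Set Quat} (h : IsSurface k A)
    (hC : IsClosed C) : IsSurface k (A \ C) :=
  ⟨sdiff_subset.trans h.1, fun p hp =>
    (h.2 p hp.1).imp (fun h => h.diff_closed hC hp.2) (fun h => h.diff_closed hC hp.2)⟩

theorem IsBoundaryPoint.of_le {k l : WithTop ℕ∞} (hkl : k ≤ l) {A : Set Quat} {p : Quat}
    (h : IsBoundaryPoint l A p) : IsBoundaryPoint k A p := by
  obtain ⟨U, f, g, hU, hpU, hf, hg, hg0, hv, hA⟩ := h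
  exact ⟨U, f, g, hU, hpU, hf.of_le hkl, hg.of_le hkl, hg0, hv, hA⟩

/-- A point is not a boundary point if the one-sided tangent directions of `A` at the point are not
contained in a proper half-plane of a tangent plane `span {v, w}`: then the differentials of both
defining functions of a boundary chart vanish on this plane, so that they are proportional. -/
theorem not_isBoundaryPoint {k : WithTop ℕ∞} (hk : k ≠ 0) {A : Set Quat} {p v w n : Quat}
    (hp : p ∈ A) (hspan : ∀ x : Quat, inner ℝ p x = 0 → ∃ a b c : ℝ, x = a • v + b • w + c • n)
    (h : ∀ l : Quat →L[ℝ] ℝ, (∀ x ∈ posTangentConeAt A p, 0 ≤ l x) → l v = 0 ∧ l w = 0) :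
    ¬ IsBoundaryPoint k A p := by
  rintro ⟨U, f, g, hU, hpU, hf, hg, hg0, hind, hA⟩
  have hUp := hU.mem_nhds hpU
  have hfd : HasFDerivAt f (fderiv ℝ f p) p :=
    ((hf.contDiffAt hUp).differentiableAt hk).hasFDerivAt
  have hgd : HasFDerivAt g (fderiv ℝ g p) p :=
    ((hg.contDiffAt hUp).differentiableAt hk).hasFDerivAt
  have hmem : ∀ᶠ q in 𝓝[A] p, f q = 0 ∧ 0 ≤ g q := by
    filter_upwards [self_mem_nhdsWithin, nhdsWithin_le_nhds hUp] with q hqA hqU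
    have : q ∈ A ∩ U := ⟨hqA, hqU⟩
    rw [hA] at this
    exact this.2.2
  have hf0 : f p = 0 := (hmem.self_of_nhdsWithin hp).1
  have h1 : ∀ x ∈ posTangentConeAt A p, 0 ≤ fderiv ℝ g p x := fun x hx =>
    IsLocalMinOn.hasFDerivWithinAt_nonneg (f := g) (s := A) (a := p)
      (hmem.mono fun q hq => by rw [hg0]; exact hq.2) hgd.hasFDerivWithinAt hx
  have h2 : ∀ x ∈ posTangentConeAt A p, 0 ≤ fderiv ℝ f p x := fun x hx =>
    IsLocalMinOn.hasFDerivWithinAt_nonneg (f := f) (s := A) (a := p)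
      (hmem.mono fun q hq => by rw [hf0, hq.1]) hfd.hasFDerivWithinAt hx
  obtain ⟨gv, gw⟩ := h _ h1
  obtain ⟨fv, fw⟩ := h _ h2
  have h3 := hind (fderiv ℝ g p n) (-fderiv ℝ f p n) fun x hx => by
    obtain ⟨a, b, c, rfl⟩ := hspan x hx
    simp only [map_add, map_smul, gv, gw, fv, fw, smul_eq_mul]
    ring
  have h4 := hind 1 0 fun x hx => by
    obtain ⟨a, b, c, rfl⟩ := hspan x hx
    have : fderiv ℝ f p n = 0 := by linarith [h3.2]
    simp [fv, fw, this]
  exact one_ne_zero h4.1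

/-! ### Divergence of unit horizontal fields -/

/-- The field `T` as a continuous linear map. -/
def TL : Quat →L[ℝ] Quat :=
  mkL.comp ((Complex.I • zOne).prod (Complex.I • zTwo))

theorem TL_apply (p : Quat) : TL p = T p := by
  rw [T_eq]; rfl

theorem inner_T_left (p q : Quat) : inner ℝ (T p) q = - inner ℝ p (T q) := by
  simp only [inner_eq, T]; simp; ring

/-- A unit horizontal field `X` along `A` satisfies `⟪D_v X, v⟫ = 0` in the tangent directions
`v = a X + b T`: the field `T` is Killing and `X` has constant length. -/
theorem inner_deriv_eq_zero {A : Set Quat} {p : Quat} (hp : p ∈ A)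
    {X : Quat → Quat} {V' : Quat →L[ℝ] Quat} (hX : HasFDerivWithinAt X V' A p)
    (h1 : ∀ᶠ q in 𝓝[A] p, inner ℝ (X q) (X q) = 1)
    (h2 : ∀ᶠ q in 𝓝[A] p, inner ℝ (X q) (T q) = 0) (hXp : inner ℝ (X p) p = 0) {a b : ℝ}
    (hv : a • X p + b • T p ∈ tangentSpan A p) :
    inner ℝ (a • X p + b • T p) (V' (a • X p + b • T p)) = 0 := by
  set v := a • X p + b • T p with hvdef
  have e1 := fderiv_eq_of_eqOn (hX.inner ℝ hX)
    (hasFDerivWithinAt_const (1 : ℝ) p A) h1 hp hv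
  have hT : HasFDerivWithinAt T TL A p := by
    have := (TL.hasFDerivAt (x := p)).hasFDerivWithinAt (s := A)
    exact this.congr (fun q _ => (TL_apply q).symm) (TL_apply p).symm
  have e2 := fderiv_eq_of_eqOn (hX.inner ℝ hT)
    (hasFDerivWithinAt_const (0 : ℝ) p A) h2 hp hv
  simp [TL_apply, real_inner_comm] at e1 e2
  have e3 : inner ℝ (X p) (T v) = 0 := by
    have h3 : inner ℝ (X p) (T (X p)) = 0 := by
      have := inner_T_left (X p) (X p)
      rw [real_inner_comm] at this; linarith
    have h4 : T (T p) = -p := by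
      ext <;> simp [T]
    have h5 : T v = a • T (X p) + b • T (T p) := by
      rw [← TL_apply, ← TL_apply, ← TL_apply, hvdef, map_add, map_smul, map_smul]
    rw [h5, h4, inner_add_right, inner_smul_right, inner_smul_right, h3, inner_neg_right, hXp]
    simp
  rw [hvdef, inner_add_left, inner_smul_left, inner_smul_left]
  have e5 : inner ℝ (T p) (V' v) = 0 := by linarith [real_inner_comm (X p) (T v)]
  simp [← hvdef, e1, e5]

/-! ### The profile curve of a Pansu sphere -/

/-- The ratio `μ = λ / κ`. -/
def ratio (lam : ℝ) : ℝ := lam / freq lam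

theorem freq_sq (lam : ℝ) : freq lam ^ 2 = 1 + lam ^ 2 := Real.sq_sqrt (by positivity)

theorem freq_mul_ratio (lam : ℝ) : freq lam * ratio lam = lam := by
  have := (freq_pos lam).ne'
  unfold ratio; field_simp

theorem ratio_nonneg {lam : ℝ} (h : 0 ≤ lam) : 0 ≤ ratio lam := div_nonneg h (freq_pos lam).le

theorem ratio_lt_one {lam : ℝ} (h : 0 ≤ lam) : ratio lam < 1 := by
  rw [ratio, div_lt_one (freq_pos lam)]
  nlinarith [freq_sq lam, freq_pos lam]

theorem one_sub_ratio_sq (lam : ℝ) : 1 - ratio lam ^ 2 = 1 / freq lam ^ 2 := by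
  have := (freq_pos lam).ne'
  rw [ratio]; field_simp; rw [freq_sq]; ring

/-- The profile curve `u ↦ e^{iμu}(μ cos u - i sin u)`: up to a rotation, the values of `z₁` along
the geodesics of a Pansu sphere, where `u = π/2 - κ s` is the latitude, measured from the
equator. -/
def prof (lam u : ℝ) : ℂ := cis (ratio lam * u) * ⟨ratio lam * Real.cos u, -Real.sin u⟩

/-- The tangent vectors of the profile curve are real multiples of `-i e^{iμu}`: the unit number
`e^{iμu}` is normal to the curve, and it is the source of the unit normal of the surface. -/
theorem hasDerivAt_prof (lam u : ℝ) : HasDerivAt (prof lam)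
    (((1 / freq lam ^ 2 * Real.cos u : ℝ) : ℂ) * (-Complex.I * cis (ratio lam * u))) u := by
  have h1 : HasDerivAt (fun u => cis (ratio lam * u))
      ((ratio lam : ℝ) • (Complex.I * cis (ratio lam * u))) u := by
    have := (hasDerivAt_cis (ratio lam * u)).scomp u ((hasDerivAt_id u).const_mul (ratio lam))
    simpa [Function.comp_def] using this
  have h2 : HasDerivAt (fun u => ((ratio lam * Real.cos u : ℝ) : ℂ) +
      ((-Real.sin u : ℝ) : ℂ) * Complex.I)
      (((ratio lam * -Real.sin u : ℝ) : ℂ) + ((-Real.cos u : ℝ) : ℂ) * Complex.I) u :=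
    ((Real.hasDerivAt_cos u).const_mul (ratio lam)).ofReal_comp.add
      ((Real.hasDerivAt_sin u).neg.ofReal_comp.mul_const _)
  have h3 := h1.mul h2
  have h4 : (fun u => cis (ratio lam * u) * (((ratio lam * Real.cos u : ℝ) : ℂ) +
      ((-Real.sin u : ℝ) : ℂ) * Complex.I)) = prof lam := by
    funext u; rw [prof]; congr 1; apply Complex.ext <;>
      simp [-Complex.ofReal_cos, -Complex.ofReal_sin]
  have h5 : HasDerivAt (prof lam) _ u := h3.congr_of_eventuallyEq (Eventually.of_forall fun u =>
    (congrFun h4 u).symm)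
  refine h5.congr_deriv ?_
  rw [← one_sub_ratio_sq]
  simp only [Complex.real_smul]
  push_cast
  linear_combination (-(ratio lam : ℂ) * Complex.sin u * cis (ratio lam * u)) * Complex.I_sq

theorem contDiff_prof (lam : ℝ) {n : WithTop ℕ∞} : ContDiff ℝ n (prof lam) := by
  have h4 : (fun u => cis (ratio lam * u) * (((ratio lam * Real.cos u : ℝ) : ℂ) +
      ((-Real.sin u : ℝ) : ℂ) * Complex.I)) = prof lam := by
    funext u; rw [prof]; congr 1; apply Complex.ext <;>
      simp [-Complex.ofReal_cos, -Complex.ofReal_sin]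
  rw [← h4]
  refine (contDiff_cis.comp (contDiff_const.mul contDiff_id)).mul (ContDiff.add ?_ ?_)
  · exact Complex.ofRealCLM.contDiff.comp (contDiff_const.mul Real.contDiff_cos)
  · exact (Complex.ofRealCLM.contDiff.comp Real.contDiff_sin.neg).mul contDiff_const

theorem norm_prof_sq (lam u : ℝ) : ‖prof lam u‖ ^ 2 = 1 - (Real.cos u / freq lam) ^ 2 := by
  rw [prof, norm_mul, norm_cis, one_mul, ← Complex.normSq_eq_norm_sq, Complex.normSq_apply]
  rw [div_pow, div_eq_mul_one_div, ← one_sub_ratio_sq]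
  simp only
  linear_combination Real.sin_sq_add_cos_sq u

/-- The height of the point of latitude `u` above the totally geodesic sphere through the
equator. -/
def height (lam u : ℝ) : ℝ := -(prof lam u).im

theorem contDiff_height (lam : ℝ) {n : WithTop ℕ∞} : ContDiff ℝ n (height lam) :=
  (Complex.imCLM.contDiff.comp (contDiff_prof lam)).neg

theorem hasDerivAt_height (lam u : ℝ) : HasDerivAt (height lam)
    (1 / freq lam ^ 2 * Real.cos u * Real.cos (ratio lam * u)) u := by
  have := (Complex.imCLM.hasFDerivAt.comp_hasDerivAt u (hasDerivAt_prof lam u)).neg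
  refine HasDerivAt.congr_deriv (f := height lam) this ?_
  simp [-Complex.ofReal_mul, -Complex.ofReal_cos]

/-- Here `0 ≤ μ < 1` keeps `μu` inside `(-π/2, π/2)`. -/
theorem height_deriv_pos {lam : ℝ} (hlam : 0 ≤ lam) {u : ℝ}
    (hu : u ∈ Ioo (-(Real.pi / 2)) (Real.pi / 2)) :
    0 < 1 / freq lam ^ 2 * Real.cos u * Real.cos (ratio lam * u) := by
  have h1 := Real.cos_pos_of_mem_Ioo hu
  have hk := freq_pos lam
  have h0 := ratio_nonneg hlam
  have h1' := ratio_lt_one hlam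
  have h2 : 0 < Real.cos (ratio lam * u) := by
    refine Real.cos_pos_of_mem_Ioo ⟨?_, ?_⟩
    · nlinarith [hu.1, hu.2]
    · nlinarith [hu.1, hu.2]
  positivity

theorem strictMonoOn_height {lam : ℝ} (hlam : 0 ≤ lam) :
    StrictMonoOn (height lam) (Icc (-(Real.pi / 2)) (Real.pi / 2)) := by
  refine strictMonoOn_of_deriv_pos (convex_Icc _ _)
    (contDiff_height lam (n := 0)).continuous.continuousOn fun u hu => ?_
  rw [interior_Icc] at hu
  rw [(hasDerivAt_height lam u).deriv]
  exact height_deriv_pos hlam hu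

theorem height_zero (lam : ℝ) : height lam 0 = 0 := by simp [height, prof]

/-- The interval of latitudes, with sign prescribed by `ε = ±1`. -/
def latitudes (ε : ℝ) : Set ℝ := {u | u ∈ Icc (-(Real.pi / 2)) (Real.pi / 2) ∧ 0 ≤ ε * u}

theorem sign_height {lam : ℝ} (hlam : 0 ≤ lam) {ε : ℝ} (hε : ε = 1 ∨ ε = -1) {u : ℝ}
    (hu : u ∈ Icc (-(Real.pi / 2)) (Real.pi / 2)) : 0 ≤ ε * height lam u ↔ 0 ≤ ε * u := by
  have h0 : (0 : ℝ) ∈ Icc (-(Real.pi / 2)) (Real.pi / 2) :=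
    ⟨by linarith [Real.pi_pos], by linarith [Real.pi_pos]⟩
  have hm := strictMonoOn_height hlam
  rcases hε with rfl | rfl
  · have := hm.le_iff_le h0 hu
    rw [height_zero] at this
    rwa [one_mul, one_mul]
  · have := hm.le_iff_le hu h0
    rw [height_zero] at this
    rwa [neg_one_mul, neg_one_mul, neg_nonneg, neg_nonneg]

/-- The leaf `φ_t(S_λ^±)`, in terms of the profile curve. -/
def leaf (lam ε t : ℝ) : Set Quat :=
  {p | p ∈ S3 ∧ ∃ u ∈ latitudes ε, zOne p = cis (t + tauAngle lam / 2) * prof lam u}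

theorem tauAngle_half (lam : ℝ) : tauAngle lam / 2 = Real.pi / 2 - ratio lam * (Real.pi / 2) := by
  rw [tauAngle, ratio]; ring

theorem zOne_geod_eq (lam θ s : ℝ) : zOne (geod lam θ s) =
    ⟨Real.cos (lam * s) * Real.cos (freq lam * s) +
      lam / freq lam * (Real.sin (lam * s) * Real.sin (freq lam * s)),
    -(Real.sin (lam * s) * Real.cos (freq lam * s)) +
      lam / freq lam * (Real.cos (lam * s) * Real.sin (freq lam * s))⟩ := rfl

theorem zTwo_geod_eq (lam θ s : ℝ) : zTwo (geod lam θ s) =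
    ⟨1 / freq lam * Real.sin (freq lam * s) * Real.cos (θ - lam * s),
    1 / freq lam * Real.sin (freq lam * s) * Real.sin (θ - lam * s)⟩ := rfl

theorem zOne_geod (lam θ s : ℝ) : zOne (geod lam θ s) =
    cis (tauAngle lam / 2) * prof lam (Real.pi / 2 - freq lam * s) := by
  have h1 : cis (tauAngle lam / 2) * prof lam (Real.pi / 2 - freq lam * s) =
      cis (Real.pi / 2 - lam * s) *
        ⟨ratio lam * Real.sin (freq lam * s), -Real.cos (freq lam * s)⟩ := by
    rw [prof, ← mul_assoc, ← cis_add, Real.sin_pi_div_two_sub, Real.cos_pi_div_two_sub,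
      tauAngle_half]
    congr 2
    linear_combination -s * freq_mul_ratio lam
  rw [h1, zOne_geod_eq]
  apply Complex.ext
  · simp [ratio, Real.cos_pi_div_two_sub, Real.sin_pi_div_two_sub]; ring
  · simp [ratio, Real.cos_pi_div_two_sub, Real.sin_pi_div_two_sub]; ring

theorem zTwo_geod (lam θ s : ℝ) : zTwo (geod lam θ s) =
    ((Real.sin (freq lam * s) / freq lam : ℝ) : ℂ) * cis (θ - lam * s) := by
  rw [zTwo_geod_eq]
  apply Complex.ext
  · rw [Complex.re_ofReal_mul, cis_re]; ring
  · rw [Complex.im_ofReal_mul, cis_im]; ring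

theorem heightForm_eq (lam : ℝ) (p : Quat) :
    heightForm lam p = -(cis (-(tauAngle lam / 2)) * zOne p).im := by
  simp [heightForm]; ring

/-- Polar coordinates with a prescribed shift `a` of the angle. -/
theorem exists_polar {z : ℂ} {c : ℝ} (h : ‖z‖ = c) (a : ℝ) :
    ∃ φ ∈ Ico (0 : ℝ) (2 * Real.pi), z = (c : ℂ) * cis (φ + a) := by
  by_cases hz : z = 0
  · subst hz
    have : c = 0 := by simpa using h.symm
    exact ⟨0, ⟨le_rfl, by positivity⟩, by simp [this]⟩
  · have hc : (c : ℂ) ≠ 0 := by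
      rw [← h]; exact_mod_cast norm_ne_zero_iff.2 hz
    have h1 : ‖z / c * cis (-a)‖ = 1 := by
      rw [norm_mul, norm_cis, norm_div, h, Complex.norm_real, Real.norm_of_nonneg, mul_one,
        div_self]
      · exact_mod_cast hc
      · rw [← h]; exact norm_nonneg _
    obtain ⟨φ, hφ, h2⟩ := exists_cis _ h1
    refine ⟨φ, hφ, ?_⟩
    rw [cis_add, ← h2, mul_assoc, cis_neg_mul]
    field_simp

theorem norm_zTwo_of_prof {lam u t : ℝ} {p : Quat} (hp : p ∈ S3)
    (hu : u ∈ Icc (-(Real.pi / 2)) (Real.pi / 2)) (h : zOne p = cis t * prof lam u) :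
    ‖zTwo p‖ = Real.cos u / freq lam := by
  have h1 := mem_S3.1 hp
  rw [h, norm_mul, norm_cis, one_mul, norm_prof_sq] at h1
  have h2 : 0 ≤ Real.cos u / freq lam :=
    div_nonneg (Real.cos_nonneg_of_mem_Icc hu) (freq_pos lam).le
  rw [← abs_of_nonneg (norm_nonneg (zTwo p)), ← abs_of_nonneg h2]
  exact (sq_eq_sq_iff_abs_eq_abs _ _).1 (by linarith)

theorem geod_mem_S3 (lam θ s : ℝ) : geod lam θ s ∈ S3 := by
  rw [mem_S3, zOne_geod, zTwo_geod, norm_mul, norm_mul, norm_cis, norm_cis, one_mul, mul_one,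
    norm_prof_sq, Complex.norm_real, Real.norm_eq_abs, sq_abs, Real.cos_pi_div_two_sub]
  ring

/-- A Pansu sphere consists of all points of `𝕊³` whose first coordinate lies on the profile curve:
the curves `γ_θ` have the same first coordinate, and their second coordinates fill a circle. -/
theorem mem_pansu {lam : ℝ} {p : Quat} : p ∈ pansu lam ↔ p ∈ S3 ∧
    ∃ u ∈ Icc (-(Real.pi / 2)) (Real.pi / 2), zOne p = cis (tauAngle lam / 2) * prof lam u := by
  have hk := freq_pos lam
  constructor
  · rintro ⟨θ, -, s, hs, rfl⟩
    refine ⟨geod_mem_S3 _ _ _, Real.pi / 2 - freq lam * s, ?_, zOne_geod _ _ _⟩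
    have h1 : freq lam * s ≤ Real.pi := by
      have := hs.2; rw [le_div_iff₀ hk] at this; linarith
    have h2 : 0 ≤ freq lam * s := mul_nonneg hk.le hs.1
    constructor <;> linarith
  · rintro ⟨hp, u, hu, h⟩
    set s := (Real.pi / 2 - u) / freq lam with hs
    have hks : freq lam * s = Real.pi / 2 - u := by rw [hs]; field_simp
    obtain ⟨θ, hθ, h2⟩ := exists_polar (norm_zTwo_of_prof hp hu h) (-(lam * s))
    refine ⟨θ, hθ, s, ⟨?_, ?_⟩, quat_ext ?_ ?_⟩
    · exact div_nonneg (by linarith [hu.2]) hk.le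
    · rw [hs]; gcongr; linarith [hu.1]
    · rw [zOne_geod, hks, h]; congr 2; ring
    · rw [zTwo_geod, hks, h2, Real.sin_pi_div_two_sub, sub_eq_add_neg]

theorem height_of_prof {lam u t : ℝ} {p : Quat}
    (h : zOne p = cis (t + tauAngle lam / 2) * prof lam u) :
    -(cis (-(t + tauAngle lam / 2)) * zOne p).im = height lam u := by
  rw [h, ← mul_assoc, cis_neg_mul, one_mul, height]

/-- The height has the sign of the latitude, so the half-spheres are cut off at latitude `0`. -/
theorem half_eq_leaf {lam : ℝ} (hlam : 0 ≤ lam) :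
    halfPlus lam = leaf lam 1 0 ∧ halfMinus lam = leaf lam (-1) 0 := by
  constructor
  · ext p
    simp only [halfPlus, leaf, mem_ofPred_eq, mem_pansu, zero_add, latitudes]
    constructor
    · rintro ⟨⟨hp, u, hu, h⟩, hh⟩
      refine ⟨hp, u, ⟨hu, (sign_height hlam (Or.inl rfl) hu).1 ?_⟩, h⟩
      rw [heightForm_eq, ← zero_add (tauAngle lam / 2), height_of_prof (by rw [zero_add, h])] at hh
      linarith
    · rintro ⟨hp, u, ⟨hu, hs⟩, h⟩
      refine ⟨⟨hp, u, hu, h⟩, ?_⟩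
      have := (sign_height hlam (Or.inl rfl) hu).2 hs
      rw [heightForm_eq, ← zero_add (tauAngle lam / 2), height_of_prof (by rw [zero_add, h])]
      linarith
  · ext p
    simp only [halfMinus, leaf, mem_ofPred_eq, mem_pansu, zero_add, latitudes]
    constructor
    · rintro ⟨⟨hp, u, hu, h⟩, hh⟩
      refine ⟨hp, u, ⟨hu, (sign_height hlam (Or.inr rfl) hu).1 ?_⟩, h⟩
      rw [heightForm_eq, ← zero_add (tauAngle lam / 2), height_of_prof (by rw [zero_add, h])] at hh
      linarith
    · rintro ⟨hp, u, ⟨hu, hs⟩, h⟩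
      refine ⟨⟨hp, u, hu, h⟩, ?_⟩
      have := (sign_height hlam (Or.inr rfl) hu).2 hs
      rw [heightForm_eq, ← zero_add (tauAngle lam / 2), height_of_prof (by rw [zero_add, h])]
      linarith

theorem vertTrans_mem_S3 {t : ℝ} {p : Quat} : vertTrans t p ∈ S3 ↔ p ∈ S3 := by
  rw [mem_S3, mem_S3, vertTrans_eq]; simp

theorem vertTrans_leaf (lam ε t : ℝ) : vertTrans t '' leaf lam ε 0 = leaf lam ε t := by
  ext p
  rw [mem_vertTrans_image]
  simp only [leaf, mem_ofPred_eq, vertTrans_mem_S3, zero_add]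
  rw [vertTrans_eq, zOne_mk]
  refine and_congr_right fun _ => exists_congr fun u => and_congr_right fun _ => ?_
  rw [cis_add]
  constructor
  · intro h
    rw [mul_assoc, ← h, ← mul_assoc, cis_mul_neg, one_mul]
  · intro h
    rw [h, ← mul_assoc, ← mul_assoc, cis_neg_mul, one_mul]

/-! ### Leaves as graphs over the disc of the second coordinate -/

/-- The latitude of the points of a leaf with `|z₂| = r`. -/
def lat (lam ε r : ℝ) : ℝ := ε * Real.arccos (freq lam * r)

/-- The function whose graph `z₁ = e^{it} ψ(|z₂|)` is a leaf. -/
def psi (lam ε r : ℝ) : ℂ := cis (tauAngle lam / 2) * prof lam (lat lam ε r)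

section

variable {lam ε : ℝ}

theorem lat_mem (hε : ε = 1 ∨ ε = -1) (r : ℝ) (hr : 0 ≤ r) : lat lam ε r ∈ latitudes ε := by
  have h1 := Real.arccos_nonneg (freq lam * r)
  have h2 : Real.arccos (freq lam * r) ≤ Real.pi / 2 :=
    Real.arccos_le_pi_div_two.2 (mul_nonneg (freq_pos lam).le hr)
  have := Real.pi_pos
  rcases hε with rfl | rfl
  · exact ⟨⟨by simp only [lat]; linarith, by simp only [lat]; linarith⟩,
      by simp only [lat]; linarith⟩
  · exact ⟨⟨by simp only [lat]; linarith, by simp only [lat]; linarith⟩,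
      by simp only [lat]; linarith⟩

theorem cos_lat (hε : ε = 1 ∨ ε = -1) {r : ℝ} (hr : 0 ≤ r) (hr1 : freq lam * r ≤ 1) :
    Real.cos (lat lam ε r) = freq lam * r := by
  have h : 0 ≤ freq lam * r := mul_nonneg (freq_pos lam).le hr
  rcases hε with rfl | rfl
  · rw [lat, one_mul, Real.cos_arccos (by linarith) hr1]
  · rw [lat, neg_one_mul, Real.cos_neg, Real.cos_arccos (by linarith) hr1]

theorem sin_lat (hε : ε = 1 ∨ ε = -1) (r : ℝ) :
    Real.sin (lat lam ε r) = ε * √(1 - (freq lam * r) ^ 2) := by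
  rcases hε with rfl | rfl
  · rw [lat, one_mul, Real.sin_arccos, one_mul]
  · rw [lat, neg_one_mul, Real.sin_neg, Real.sin_arccos, neg_one_mul]

theorem lat_cos (hε : ε = 1 ∨ ε = -1) {u : ℝ} (hu : u ∈ latitudes ε) :
    lat lam ε (Real.cos u / freq lam) = u := by
  have hk := (freq_pos lam).ne'
  have h1 : freq lam * (Real.cos u / freq lam) = Real.cos u := by field_simp
  have := Real.pi_pos
  rw [lat, h1]
  rcases hε with rfl | rfl
  · rw [one_mul, Real.arccos_cos (by linarith [hu.2]) (by linarith [hu.1.2])]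
  · rw [← Real.cos_neg, Real.arccos_cos (by linarith [hu.2]) (by linarith [hu.1.1])]; ring

/-- A leaf is the graph `z₁ = e^{it} ψ(|z₂|)` over the disc `κ|z₂| ≤ 1`. -/
theorem mem_leaf_iff (hε : ε = 1 ∨ ε = -1) {t : ℝ} {p : Quat} : p ∈ leaf lam ε t ↔
    p ∈ S3 ∧ freq lam * ‖zTwo p‖ ≤ 1 ∧ zOne p = cis t * psi lam ε ‖zTwo p‖ := by
  have hk := freq_pos lam
  constructor
  · rintro ⟨hp, u, hu, h⟩
    have h1 := norm_zTwo_of_prof hp hu.1 h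
    refine ⟨hp, ?_, ?_⟩
    · rw [h1, mul_div_cancel₀ _ hk.ne']; exact Real.cos_le_one u
    · rw [h1, psi, lat_cos hε hu, h, cis_add, mul_assoc]
  · rintro ⟨hp, -, h⟩
    refine ⟨hp, lat lam ε ‖zTwo p‖, lat_mem hε _ (norm_nonneg (zTwo p)), ?_⟩
    rw [h, psi, cis_add, mul_assoc]

theorem norm_psi_sq (hε : ε = 1 ∨ ε = -1) {r : ℝ} (hr : 0 ≤ r) (hr1 : freq lam * r ≤ 1) :
    ‖psi lam ε r‖ ^ 2 = 1 - r ^ 2 := by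
  have hk := (freq_pos lam).ne'
  rw [psi, norm_mul, norm_cis, one_mul, norm_prof_sq, cos_lat hε hr hr1]
  field_simp

theorem continuous_psi : Continuous (psi lam ε) := by
  have h1 : Continuous (lat lam ε) := by unfold lat; fun_prop
  exact continuous_const.mul ((contDiff_prof lam (n := 0)).continuous.comp h1)

theorem contDiffAt_lat {n : WithTop ℕ∞} {r : ℝ} (hr : |r| < 1 / freq lam) :
    ContDiffAt ℝ n (lat lam ε) r := by
  have hk := freq_pos lam
  rw [lt_div_iff₀ hk, mul_comm] at hr
  have h2 : |freq lam * r| < 1 := by rwa [abs_mul, abs_of_pos hk]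
  rw [abs_lt] at h2
  have h1 : ContDiffAt ℝ n Real.arccos (freq lam * r) :=
    Real.contDiffAt_arccos (by linarith) (by linarith)
  exact contDiffAt_const.mul (h1.comp r (contDiffAt_const.mul contDiffAt_id))

/-- The function `φ` with `ψ'(r) = r φ(r)`, where `ψ` is `psi lam ε`. -/
def psiDeriv (lam ε r : ℝ) : ℂ :=
  Complex.I * cis (tauAngle lam / 2 + ratio lam * lat lam ε r) *
    ((ε / √(1 - (freq lam * r) ^ 2) : ℝ) : ℂ)

/-- The factor `r = cos u / κ` comes from the derivative of the profile curve; it makes the leaf of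
class `C²` at its pole. -/
theorem hasDerivAt_psi (hε : ε = 1 ∨ ε = -1) {r : ℝ}
    (hr : r ∈ Ioo (-(1 / freq lam)) (1 / freq lam)) :
    HasDerivAt (psi lam ε) (r • psiDeriv lam ε r) r := by
  have hk := freq_pos lam
  have h2 : |freq lam * r| < 1 := by
    rw [abs_mul, abs_of_pos hk]
    have := abs_lt.2 hr
    rw [lt_div_iff₀ hk] at this; linarith
  have h2' := abs_lt.1 h2
  have h3 : 0 < 1 - (freq lam * r) ^ 2 := by
    have := (sq_lt_one_iff_abs_lt_one _).2 h2; linarith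
  have h4 : HasDerivAt (lat lam ε) (ε * (-(1 / √(1 - (freq lam * r) ^ 2)) * freq lam)) r := by
    have h5 : HasDerivAt (fun r => freq lam * r) (freq lam) r := by
      simpa using (hasDerivAt_id r).const_mul (freq lam)
    exact ((Real.hasDerivAt_arccos (by linarith) (by linarith)).comp r h5).const_mul ε
  have h6 := ((hasDerivAt_prof lam (lat lam ε r)).scomp r h4).const_mul (cis (tauAngle lam / 2))
  refine HasDerivAt.congr_deriv (f := psi lam ε) h6 ?_
  have hc : Real.cos (lat lam ε r) = freq lam * r := by
    rcases hε with rfl | rfl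
    · rw [lat, one_mul, Real.cos_arccos (by linarith) (by linarith)]
    · rw [lat, neg_one_mul, Real.cos_neg, Real.cos_arccos (by linarith) (by linarith)]
  have h5 : √(1 - (freq lam * r) ^ 2) ≠ 0 := (Real.sqrt_pos.2 h3).ne'
  have hkc : (freq lam : ℂ) ≠ 0 := by exact_mod_cast hk.ne'
  have h5c : (√(1 - (freq lam * r) ^ 2) : ℂ) ≠ 0 := by exact_mod_cast h5
  rw [hc, psiDeriv, cis_add]
  simp only [Complex.real_smul]
  push_cast at h5c ⊢
  field_simp

theorem contDiffOn_psiDeriv {n : WithTop ℕ∞} :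
    ContDiffOn ℝ n (psiDeriv lam ε) (Ioo (-(1 / freq lam)) (1 / freq lam)) := by
  have hk := freq_pos lam
  intro r hr
  have h1 : |r| < 1 / freq lam := abs_lt.2 hr
  have h2 : |freq lam * r| < 1 := by
    rw [abs_mul, abs_of_pos hk]
    rw [lt_div_iff₀ hk] at h1; linarith
  have h3 : 0 < 1 - (freq lam * r) ^ 2 := by
    have := (sq_lt_one_iff_abs_lt_one _).2 h2; linarith
  refine ContDiffAt.contDiffWithinAt ?_
  refine (contDiffAt_const.mul ?_).mul ?_
  · exact contDiff_cis.contDiffAt.comp r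
      (contDiffAt_const.add (contDiffAt_const.mul (contDiffAt_lat h1)))
  · refine Complex.ofRealCLM.contDiff.contDiffAt.comp r (contDiffAt_const.div ?_ ?_)
    · refine ContDiffAt.sqrt ?_ h3.ne'
      exact contDiffAt_const.sub ((contDiffAt_const.mul contDiffAt_id).pow 2)
    · exact (Real.sqrt_pos.2 h3).ne'

theorem contDiffOn_psi_norm (hε : ε = 1 ∨ ε = -1) : ContDiffOn ℝ 2 (fun z : ℂ => psi lam ε ‖z‖)
    (Metric.ball 0 (1 / freq lam)) :=
  contDiffOn_radial (fun _ hr => hasDerivAt_psi hε hr) contDiffOn_psiDeriv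

end

/-! ### The adapted orthonormal frame -/

theorem inner_frame {η ξ : ℂ} (hη : ‖η‖ = 1) (hξ : ‖ξ‖ = 1) (a b c d : ℂ) :
    inner ℝ (mk (η * a) (ξ * b)) (mk (η * c) (ξ * d)) =
      a.re * c.re + a.im * c.im + (b.re * d.re + b.im * d.im) := by
  have h1 : ∀ ζ : ℂ, ‖ζ‖ = 1 → ζ.re * ζ.re + ζ.im * ζ.im = 1 := by
    intro ζ h
    rw [← Complex.normSq_apply, Complex.normSq_eq_norm_sq, h]; norm_num
  rw [inner_eq]
  simp only [mk_re, mk_imI, mk_imJ, mk_imK, Complex.mul_re, Complex.mul_im]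
  linear_combination (a.re * c.re + a.im * c.im) * h1 η hη + (b.re * d.re + b.im * d.im) * h1 ξ hξ

/-- The point of a leaf with parameters `η`, `ξ` (unit), `r = |z₂|` and `w` the sine of the
latitude. -/
def pF (lam : ℝ) (η ξ : ℂ) (r w : ℝ) : Quat := mk (η * ⟨lam * r, -w⟩) (ξ * ⟨r, 0⟩)

/-- The horizontal Gauss map of the leaf. -/
def xF (lam : ℝ) (η ξ : ℂ) (r w : ℝ) : Quat := mk (η * ⟨r, 0⟩) (ξ * ⟨-(lam * r), -w⟩)

/-- The unit vector tangent to the sub-Riemannian geodesics that rule the leaf. -/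
def yF (lam : ℝ) (η ξ : ℂ) (r w : ℝ) : Quat := mk (η * ⟨0, -r⟩) (ξ * ⟨-w, lam * r⟩)

/-- The unit normal of the leaf. -/
def nF (lam : ℝ) (η ξ : ℂ) (r w : ℝ) : Quat :=
  (√(1 - (lam * r) ^ 2))⁻¹ •
    mk (η * ⟨1 - (lam * r) ^ 2, lam * r * w⟩) (ξ * ⟨-(lam * r ^ 2), 0⟩)

/-- The unit tangent vector of the leaf orthogonal to the geodesics. -/
def sF (lam : ℝ) (η ξ : ℂ) (r w : ℝ) : Quat :=
  (√(1 - (lam * r) ^ 2))⁻¹ •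
    mk (η * ⟨0, -(lam * r ^ 2)⟩) (ξ * ⟨-(w * (lam * r)), -(1 - (lam * r) ^ 2)⟩)

section Frame

variable {lam r w : ℝ} {η ξ : ℂ}

theorem frame_pos (h : w ^ 2 + (1 + lam ^ 2) * r ^ 2 = 1) : 0 < 1 - (lam * r) ^ 2 := by
  by_contra hh
  push Not at hh
  have h1 : w ^ 2 + r ^ 2 ≤ 0 := by nlinarith
  have h2 : r ^ 2 = 0 := by nlinarith [sq_nonneg w, sq_nonneg r]
  rw [mul_pow, h2] at hh
  linarith

theorem orthonormal_frame (hη : ‖η‖ = 1) (hξ : ‖ξ‖ = 1) (h : w ^ 2 + (1 + lam ^ 2) * r ^ 2 = 1) :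
    Orthonormal ℝ ![pF lam η ξ r w, nF lam η ξ r w, yF lam η ξ r w, sF lam η ξ r w] := by
  have hD := frame_pos h
  have hs : √(1 - (lam * r) ^ 2) ≠ 0 := (Real.sqrt_pos.2 hD).ne'
  have hsq : √(1 - (lam * r) ^ 2) ^ 2 = 1 - (lam * r) ^ 2 := Real.sq_sqrt hD.le
  have haux : ∀ Q : ℝ, Q = 1 - (lam * r) ^ 2 →
      (√(1 - (lam * r) ^ 2))⁻¹ * ((√(1 - (lam * r) ^ 2))⁻¹ * Q) = 1 := by
    intro Q hQ
    rw [hQ, ← mul_assoc, ← mul_inv, ← sq, hsq, inv_mul_cancel₀ hD.ne']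
  have hpp : inner ℝ (pF lam η ξ r w) (pF lam η ξ r w) = 1 := by
    rw [pF, inner_frame hη hξ]; linear_combination h
  have hpn : inner ℝ (pF lam η ξ r w) (nF lam η ξ r w) = 0 := by
    rw [pF, nF, inner_smul_right, inner_frame hη hξ]
    refine mul_eq_zero_of_right _ ?_
    linear_combination -(lam * r) * h
  have hpy : inner ℝ (pF lam η ξ r w) (yF lam η ξ r w) = 0 := by
    rw [pF, yF, inner_frame hη hξ]; ring
  have hps : inner ℝ (pF lam η ξ r w) (sF lam η ξ r w) = 0 := by
    rw [pF, sF, inner_smul_right, inner_frame hη hξ]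
    refine mul_eq_zero_of_right _ ?_
    ring
  have hnn : inner ℝ (nF lam η ξ r w) (nF lam η ξ r w) = 1 := by
    rw [nF, inner_smul_right, real_inner_smul_left, inner_frame hη hξ]
    refine haux _ ?_
    linear_combination (lam * r) ^ 2 * h
  have hny : inner ℝ (nF lam η ξ r w) (yF lam η ξ r w) = 0 := by
    rw [nF, yF, real_inner_smul_left, inner_frame hη hξ]
    refine mul_eq_zero_of_right _ ?_
    ring
  have hns : inner ℝ (nF lam η ξ r w) (sF lam η ξ r w) = 0 := by
    rw [nF, sF, real_inner_smul_left, inner_smul_right, inner_frame hη hξ]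
    refine mul_eq_zero_of_right _ (mul_eq_zero_of_right _ ?_)
    ring
  have hyy : inner ℝ (yF lam η ξ r w) (yF lam η ξ r w) = 1 := by
    rw [yF, inner_frame hη hξ]; linear_combination h
  have hys : inner ℝ (yF lam η ξ r w) (sF lam η ξ r w) = 0 := by
    rw [yF, sF, inner_smul_right, inner_frame hη hξ]
    refine mul_eq_zero_of_right _ ?_
    linear_combination (lam * r) * h
  have hss : inner ℝ (sF lam η ξ r w) (sF lam η ξ r w) = 1 := by
    rw [sF, inner_smul_right, real_inner_smul_left, inner_frame hη hξ]
    refine haux _ ?_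
    linear_combination (lam * r) ^ 2 * h
  rw [orthonormal_iff_ite]
  intro i j
  fin_cases i <;> fin_cases j <;>
    simp only [Fin.zero_eta, Fin.mk_one, Fin.reduceFinMk, Matrix.cons_val] <;>
    first
      | (simp only [hpp, hpn, hpy, hps, hnn, hny, hns, hyy, hys, hss]; simp)
      | (rw [real_inner_comm]; simp only [hpn, hpy, hps, hny, hns, hys]; simp)

theorem T_pF : T (pF lam η ξ r w) = mk (η * ⟨w, lam * r⟩) (ξ * ⟨0, r⟩) := by
  rw [T_eq]
  apply quat_ext
  · simp only [pF, zOne_mk]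
    rw [mul_left_comm]; congr 1; apply Complex.ext <;> simp
  · simp only [pF, zTwo_mk]
    rw [mul_left_comm]; congr 1; apply Complex.ext <;> simp

theorem smul_frame (x : ℝ) (a b : ℂ) : x • mk (η * a) (ξ * b) =
    mk (η * ⟨x * a.re, x * a.im⟩) (ξ * ⟨x * b.re, x * b.im⟩) := by
  have h : ∀ a : ℂ, (⟨x * a.re, x * a.im⟩ : ℂ) = x * a := fun a => by
    apply Complex.ext <;> simp
  rw [smul_mk, h, h]; congr 1 <;> ring

theorem mk_frame_congr {a b c d : ℂ} (h1 : a.re = c.re) (h2 : a.im = c.im) (h3 : b.re = d.re)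
    (h4 : b.im = d.im) : mk (η * a) (ξ * b) = mk (η * c) (ξ * d) := by
  rw [Complex.ext h1 h2, Complex.ext h3 h4]

theorem nF_eq (h : w ^ 2 + (1 + lam ^ 2) * r ^ 2 = 1) : nF lam η ξ r w =
    (√(1 - (lam * r) ^ 2))⁻¹ • (r • xF lam η ξ r w + w • T (pF lam η ξ r w)) := by
  rw [nF, xF, T_pF]
  congr 1
  rw [smul_frame, smul_frame, mk_add, ← mul_add, ← mul_add]
  apply mk_frame_congr <;> simp
  · linear_combination -h
  · ring
  · ring
  · ring

theorem sF_eq (h : w ^ 2 + (1 + lam ^ 2) * r ^ 2 = 1) : sF lam η ξ r w =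
    (√(1 - (lam * r) ^ 2))⁻¹ • (w • xF lam η ξ r w - r • T (pF lam η ξ r w)) := by
  rw [sF, xF, T_pF]
  congr 1
  rw [smul_frame, smul_frame, mk_sub, ← mul_sub, ← mul_sub]
  apply mk_frame_congr <;> simp
  · ring
  · ring
  · linear_combination h

theorem nF_eq' : nF lam η ξ r w =
    (√(1 - (lam * r) ^ 2))⁻¹ •
      (mk η 0 - (lam * r) • pF lam η ξ r w) := by
  have : mk η 0 = mk (η * 1) (ξ * 0) := by simp
  rw [nF, pF, this]
  congr 1
  rw [smul_frame, mk_sub, ← mul_sub, ← mul_sub]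
  apply mk_frame_congr <;> simp <;> ring

theorem smul_xF (h : w ^ 2 + (1 + lam ^ 2) * r ^ 2 = 1) : r • xF lam η ξ r w =
    mk η 0 - (lam * r) • pF lam η ξ r w - w • T (pF lam η ξ r w) := by
  have : mk η 0 = mk (η * 1) (ξ * 0) := by simp
  rw [xF, T_pF, pF, this, smul_frame, smul_frame, smul_frame, mk_sub, mk_sub, ← mul_sub, ← mul_sub,
    ← mul_sub, ← mul_sub]
  apply mk_frame_congr <;> simp
  · linear_combination h
  · ring
  · ring
  · ring

/-- The velocity `(0, iξr)` of the rotations `r_θ` is a combination of the two tangent vectors of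
the frame. -/
theorem smul_sF (h : w ^ 2 + (1 + lam ^ 2) * r ^ 2 = 1) :
    (r * √(1 - (lam * r) ^ 2)) • sF lam η ξ r w =
      (lam * r ^ 2) • yF lam η ξ r w - mk (η * 0) (ξ * ⟨0, r⟩) := by
  have hs : √(1 - (lam * r) ^ 2) ≠ 0 := (Real.sqrt_pos.2 (frame_pos h)).ne'
  rw [sF, smul_smul, mul_assoc, mul_inv_cancel₀ hs, mul_one, yF, smul_frame, smul_frame, mk_sub,
    ← mul_sub, ← mul_sub]
  apply mk_frame_congr <;> simp <;> ring

theorem xF_inner (hη : ‖η‖ = 1) (hξ : ‖ξ‖ = 1) (h : w ^ 2 + (1 + lam ^ 2) * r ^ 2 = 1) :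
    inner ℝ (xF lam η ξ r w) (xF lam η ξ r w) = 1 ∧
    inner ℝ (xF lam η ξ r w) (pF lam η ξ r w) = 0 ∧
    inner ℝ (xF lam η ξ r w) (T (pF lam η ξ r w)) = 0 ∧
    inner ℝ (yF lam η ξ r w) (T (pF lam η ξ r w)) = 0 ∧
    inner ℝ (xF lam η ξ r w) (yF lam η ξ r w) = 0 ∧
    inner ℝ (yF lam η ξ r w) (pF lam η ξ r w) = 0 := by
  refine ⟨?_, ?_, ?_, ?_, ?_, ?_⟩
  · rw [xF, inner_frame hη hξ]; linear_combination h
  · rw [xF, pF, inner_frame hη hξ]; ring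
  · rw [xF, T_pF, inner_frame hη hξ]; ring
  · rw [yF, T_pF, inner_frame hη hξ]; ring
  · rw [xF, yF, inner_frame hη hξ]; ring
  · rw [yF, pF, inner_frame hη hξ]; ring

end Frame

/-! ### Geodesics and parallels of the leaves -/

/-- The unit complex number `η` at latitude `u` of the leaf of parameter `t`. -/
def eta (lam t u : ℝ) : ℂ := cis (t + tauAngle lam / 2 + ratio lam * u)

/-- The point of the leaf of parameter `t` with latitude `u`, on the geodesic of angle `φ`. -/
def gP (lam t φ u : ℝ) : Quat :=
  pF lam (eta lam t u) (cis (φ + ratio lam * u)) (Real.cos u / freq lam) (Real.sin u)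

/-- The horizontal Gauss map of the leaf at `gP lam t φ u`. -/
def gX (lam t φ u : ℝ) : Quat :=
  xF lam (eta lam t u) (cis (φ + ratio lam * u)) (Real.cos u / freq lam) (Real.sin u)

/-- The velocity of the geodesic, up to the factor `κ`. -/
def gY (lam t φ u : ℝ) : Quat :=
  yF lam (eta lam t u) (cis (φ + ratio lam * u)) (Real.cos u / freq lam) (Real.sin u)

/-- The unit normal of the leaf at `gP lam t φ u`. -/
def gN (lam t φ u : ℝ) : Quat :=
  nF lam (eta lam t u) (cis (φ + ratio lam * u)) (Real.cos u / freq lam) (Real.sin u)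

/-- The unit vector tangent to the leaf and orthogonal to the geodesic. -/
def gS (lam t φ u : ℝ) : Quat :=
  sF lam (eta lam t u) (cis (φ + ratio lam * u)) (Real.cos u / freq lam) (Real.sin u)

theorem gP_rel (lam u : ℝ) :
    Real.sin u ^ 2 + (1 + lam ^ 2) * (Real.cos u / freq lam) ^ 2 = 1 := by
  have := (freq_pos lam).ne'
  rw [← freq_sq]
  field_simp
  exact Real.sin_sq_add_cos_sq u

theorem lam_mul_cos (lam u : ℝ) : lam * (Real.cos u / freq lam) = ratio lam * Real.cos u := by
  rw [ratio]; ring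

theorem zOne_gP (lam t φ u : ℝ) :
    zOne (gP lam t φ u) = cis (t + tauAngle lam / 2) * prof lam u := by
  rw [gP, pF, zOne_mk, prof, eta, cis_add, mul_assoc, lam_mul_cos]

theorem zTwo_gP (lam t φ u : ℝ) :
    zTwo (gP lam t φ u) = ((Real.cos u / freq lam : ℝ) : ℂ) * cis (φ + ratio lam * u) := by
  rw [gP, pF, zTwo_mk, mul_comm]; congr 1

theorem orthonormal_gP (lam t φ u : ℝ) :
    Orthonormal ℝ ![gP lam t φ u, gN lam t φ u, gY lam t φ u, gS lam t φ u] :=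
  orthonormal_frame (norm_cis _) (norm_cis _) (gP_rel lam u)

theorem gP_mem_S3 (lam t φ u : ℝ) : gP lam t φ u ∈ S3 := (orthonormal_gP lam t φ u).1 0

theorem gP_mem_leaf {lam ε t φ u : ℝ} (hu : u ∈ latitudes ε) : gP lam t φ u ∈ leaf lam ε t :=
  ⟨gP_mem_S3 _ _ _ _, u, hu, zOne_gP _ _ _ _⟩

theorem exists_gP {lam ε t : ℝ} {p : Quat} (hp : p ∈ leaf lam ε t) :
    ∃ φ, ∃ u ∈ latitudes ε, p = gP lam t φ u := by
  obtain ⟨hp, u, hu, h⟩ := hp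
  obtain ⟨φ, -, h2⟩ := exists_polar (norm_zTwo_of_prof hp hu.1 h) (ratio lam * u)
  exact ⟨φ, u, hu, quat_ext (by rw [zOne_gP, h]) (by rw [zTwo_gP, h2])⟩

theorem hasDerivAt_cis_mul {c m u a' b' : ℝ} {a b : ℝ → ℝ} (ha : HasDerivAt a a' u)
    (hb : HasDerivAt b b' u) : HasDerivAt (fun u => cis (c + m * u) * ⟨a u, b u⟩)
      (cis (c + m * u) * ⟨a' - m * b u, b' + m * a u⟩) u := by
  have h1 : HasDerivAt (fun u => cis (c + m * u)) ((m : ℝ) • (Complex.I * cis (c + m * u))) u := by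
    have := (hasDerivAt_cis (c + m * u)).scomp u (((hasDerivAt_id u).const_mul m).const_add c)
    simpa [Function.comp_def] using this
  have h2 : HasDerivAt (fun u => (a u : ℂ) + (b u : ℂ) * Complex.I)
      ((a' : ℂ) + (b' : ℂ) * Complex.I) u := ha.ofReal_comp.add (hb.ofReal_comp.mul_const _)
  have h3 := h1.mul h2
  have e : ∀ x y : ℝ, (⟨x, y⟩ : ℂ) = (x : ℂ) + (y : ℂ) * Complex.I := fun x y => by
    apply Complex.ext <;> simp
  simp only [e]
  refine h3.congr_deriv ?_
  rw [Complex.real_smul]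
  push_cast
  linear_combination (-(m : ℂ) * -(b u : ℂ) * cis (c + m * u)) * Complex.I_sq

theorem hasDerivAt_mk {f g : ℝ → ℂ} {f' g' : ℂ} {x : ℝ} (hf : HasDerivAt f f' x)
    (hg : HasDerivAt g g' x) : HasDerivAt (fun x => mk (f x) (g x)) (mk f' g') x :=
  mkL.hasFDerivAt.comp_hasDerivAt x (hf.prodMk hg)

theorem hasDerivAt_gP (lam t φ u : ℝ) :
    HasDerivAt (gP lam t φ) ((1 / freq lam) • gY lam t φ u) u := by
  have hk := (freq_pos lam).ne'
  have hs := Real.hasDerivAt_sin u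
  have hc := (Real.hasDerivAt_cos u).div_const (freq lam)
  have h := hasDerivAt_mk
    (hasDerivAt_cis_mul (c := t + tauAngle lam / 2) (m := ratio lam) (hc.const_mul lam) hs.neg)
    (hasDerivAt_cis_mul (c := φ) (m := ratio lam) hc (hasDerivAt_const u (0 : ℝ)))
  refine HasDerivAt.congr_deriv (f := gP lam t φ) h ?_
  rw [gY, yF, smul_frame]
  have h1 := one_sub_ratio_sq lam
  have h2 : ratio lam = lam / freq lam := rfl
  apply mk_frame_congr <;> simp
  · rw [h2]; ring
  · rw [lam_mul_cos]
    linear_combination (-Real.cos u) * h1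
  · ring
  · rw [h2]; ring

/-- The derivative `-2λ Y - T` of the Gauss map `X` along the geodesics with velocity `Y`: this is
where the mean curvature and the divergence come from. -/
theorem hasDerivAt_gX (lam t φ u : ℝ) : HasDerivAt (gX lam t φ)
    ((1 / freq lam) • (-(2 * lam) • gY lam t φ u - T (gP lam t φ u))) u := by
  have hk := (freq_pos lam).ne'
  have hs := Real.hasDerivAt_sin u
  have hc := (Real.hasDerivAt_cos u).div_const (freq lam)
  have h := hasDerivAt_mk
    (hasDerivAt_cis_mul (c := t + tauAngle lam / 2) (m := ratio lam) hc
      (hasDerivAt_const u (0 : ℝ)))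
    (hasDerivAt_cis_mul (c := φ) (m := ratio lam) (hc.const_mul lam).neg hs.neg)
  refine HasDerivAt.congr_deriv (f := gX lam t φ) h ?_
  rw [gY, yF, gP, T_pF, smul_frame, mk_sub, ← mul_sub, ← mul_sub, smul_frame]
  have h1 := freq_sq lam
  have h2 : ratio lam = lam / freq lam := rfl
  apply mk_frame_congr <;> simp [h2]
  · ring
  · field_simp; ring
  · field_simp; ring
  · field_simp
    rw [h1]; ring

theorem hasDerivAt_gP_angle (lam t φ u : ℝ) : HasDerivAt (fun φ => gP lam t φ u)
    (mk (eta lam t u * 0) (cis (φ + ratio lam * u) * ⟨0, Real.cos u / freq lam⟩)) φ := by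
  have h1 : HasDerivAt (fun φ => cis (φ + ratio lam * u)) (Complex.I * cis (φ + ratio lam * u)) φ :=
    (hasDerivAt_cis _).comp_add_const φ (ratio lam * u)
  have h := hasDerivAt_mk (hasDerivAt_const φ (eta lam t u *
    ⟨lam * (Real.cos u / freq lam), -Real.sin u⟩)) (h1.mul_const ⟨Real.cos u / freq lam, 0⟩)
  refine HasDerivAt.congr_deriv (f := fun φ => gP lam t φ u) h ?_
  rw [mul_zero]
  congr 1
  rw [mul_comm Complex.I, mul_assoc]
  congr 1
  apply Complex.ext <;> simp

/-! ### Tangent planes of the leaves -/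

section Tangent

variable {lam ε t φ u : ℝ}

theorem mem_posTangentConeAt_of_hasDerivAt {A : Set Quat} {c : ℝ → Quat} {u : ℝ} {v : Quat}
    (hc : HasDerivAt c v u) (a : ℝ) (hA : ∀ᶠ s in 𝓝[>] (0 : ℝ), c (u + a * s) ∈ A) :
    a • v ∈ posTangentConeAt A (c u) := by
  have h1 : HasDerivAt (fun s : ℝ => u + a * s) a 0 := by
    simpa using ((hasDerivAt_id (0 : ℝ)).const_mul a).const_add u
  have h2 : HasDerivAt (fun s : ℝ => c (u + a * s)) (a • v) 0 := by
    refine HasDerivAt.scomp (g₁ := c) (0 : ℝ) ?_ h1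
    simpa using hc
  exact mem_tangentConeAt_of_curve (c := fun s => c (u + a * s)) (by simp) h2.hasDerivWithinAt
    hA.frequently

theorem eventually_latitudes_down (hε : ε = 1 ∨ ε = -1) (hu : u ∈ latitudes ε) (h0 : u ≠ 0)
    {k : ℝ} (hk : 0 < k) : ∀ᶠ s in 𝓝[>] (0 : ℝ), u + (-ε * k) * s ∈ latitudes ε := by
  have h1 : ∀ᶠ s in 𝓝 (0 : ℝ), 0 < ε * (u + (-ε * k) * s) := by
    have hc : ContinuousAt (fun s : ℝ => ε * (u + (-ε * k) * s)) 0 := by fun_prop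
    refine hc.eventually (lt_mem_nhds ?_)
    have : ε * u ≠ 0 := mul_ne_zero (by rcases hε with rfl | rfl <;> norm_num) h0
    simpa using lt_of_le_of_ne hu.2 this.symm
  filter_upwards [nhdsWithin_le_nhds h1, self_mem_nhdsWithin] with s hs hs0
  have hs0' : 0 < k * s := mul_pos hk hs0
  obtain ⟨⟨h3, h4⟩, h5⟩ := hu
  have := Real.pi_pos
  rcases hε with rfl | rfl
  · exact ⟨⟨by linarith, by linarith⟩, hs.le⟩
  · exact ⟨⟨by linarith, by linarith⟩, hs.le⟩

theorem eventually_latitudes_up (hε : ε = 1 ∨ ε = -1) (hu : u ∈ latitudes ε)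
    (h0 : u ≠ ε * (Real.pi / 2)) {k : ℝ}
    (hk : 0 < k) : ∀ᶠ s in 𝓝[>] (0 : ℝ), u + (ε * k) * s ∈ latitudes ε := by
  have h1 : ∀ᶠ s in 𝓝 (0 : ℝ), ε * (u + (ε * k) * s) < Real.pi / 2 := by
    have hc : ContinuousAt (fun s : ℝ => ε * (u + (ε * k) * s)) 0 := by fun_prop
    refine hc.eventually (gt_mem_nhds ?_)
    simp only [mul_zero, add_zero]
    rcases hε with rfl | rfl
    · refine lt_of_le_of_ne (by linarith [hu.1.2]) fun h => h0 (by linarith)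
    · refine lt_of_le_of_ne (by linarith [hu.1.1]) fun h => h0 (by linarith)
  filter_upwards [nhdsWithin_le_nhds h1, self_mem_nhdsWithin] with s hs hs0
  have hs0' : 0 < k * s := mul_pos hk hs0
  obtain ⟨⟨h3, h4⟩, h5⟩ := hu
  have := Real.pi_pos
  rcases hε with rfl | rfl
  · exact ⟨⟨by linarith, by linarith⟩, by linarith⟩
  · exact ⟨⟨by linarith, by linarith⟩, by linarith⟩

/-- The geodesic run towards the equator. -/
theorem gY_down (hε : ε = 1 ∨ ε = -1) (hu : u ∈ latitudes ε) (h0 : u ≠ 0) :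
    -ε • gY lam t φ u ∈ posTangentConeAt (leaf lam ε t) (gP lam t φ u) := by
  have hk := freq_pos lam
  have := mem_posTangentConeAt_of_hasDerivAt (A := leaf lam ε t) (hasDerivAt_gP lam t φ u)
    (-ε * freq lam) ((eventually_latitudes_down hε hu h0 hk).mono fun s hs => gP_mem_leaf hs)
  rwa [smul_smul, mul_assoc, mul_one_div_cancel hk.ne', mul_one] at this

/-- The geodesic run towards the pole. -/
theorem gY_up (hε : ε = 1 ∨ ε = -1) (hu : u ∈ latitudes ε) (h0 : u ≠ ε * (Real.pi / 2)) :
    ε • gY lam t φ u ∈ posTangentConeAt (leaf lam ε t) (gP lam t φ u) := by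
  have hk := freq_pos lam
  have := mem_posTangentConeAt_of_hasDerivAt (A := leaf lam ε t) (hasDerivAt_gP lam t φ u)
    (ε * freq lam) ((eventually_latitudes_up hε hu h0 hk).mono fun s hs => gP_mem_leaf hs)
  rwa [smul_smul, mul_assoc, mul_one_div_cancel hk.ne', mul_one] at this

theorem angle_mem (hu : u ∈ latitudes ε) (a : ℝ) :
    a • mk (eta lam t u * 0) (cis (φ + ratio lam * u) * ⟨0, Real.cos u / freq lam⟩) ∈
      posTangentConeAt (leaf lam ε t) (gP lam t φ u) :=
  mem_posTangentConeAt_of_hasDerivAt (c := fun φ => gP lam t φ u) (hasDerivAt_gP_angle lam t φ u) a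
    (Eventually.of_forall fun _ => gP_mem_leaf hu)

theorem pole_mem_latitudes (hε : ε = 1 ∨ ε = -1) : ε * (Real.pi / 2) ∈ latitudes ε := by
  have := Real.pi_pos
  rcases hε with rfl | rfl
  · exact ⟨⟨by linarith, by linarith⟩, by linarith⟩
  · exact ⟨⟨by linarith, by linarith⟩, by linarith⟩

theorem trig_pole (hε : ε = 1 ∨ ε = -1) :
    Real.cos (ε * (Real.pi / 2)) = 0 ∧ Real.sin (ε * (Real.pi / 2)) = ε := by
  rcases hε with rfl | rfl
  · simp
  · simp

theorem gP_pole_eq (hε : ε = 1 ∨ ε = -1) (φ φ' : ℝ) :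
    gP lam t φ (ε * (Real.pi / 2)) = gP lam t φ' (ε * (Real.pi / 2)) := by
  apply quat_ext
  · rw [zOne_gP, zOne_gP]
  · rw [zTwo_gP, zTwo_gP, (trig_pole hε).1]; simp

/-- At the pole, geodesics start in all horizontal directions. -/
theorem pole_mem_posTangentConeAt (hε : ε = 1 ∨ ε = -1) {ζ : ℂ} (hζ : ‖ζ‖ = 1) :
    mk 0 ζ ∈ posTangentConeAt (leaf lam ε t) (gP lam t φ (ε * (Real.pi / 2))) := by
  obtain ⟨φ', -, h⟩ := exists_polar hζ (ratio lam * (ε * (Real.pi / 2)))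
  have hne : ε * (Real.pi / 2) ≠ 0 := by
    have := Real.pi_pos
    rcases hε with rfl | rfl
    · simp
    · simp
  have h1 := gY_down (lam := lam) (t := t) (φ := φ') hε (pole_mem_latitudes hε) hne
  rw [gP_pole_eq hε φ' φ] at h1
  convert h1 using 1
  rw [gY, yF, (trig_pole hε).1, (trig_pole hε).2, h, smul_frame]
  apply quat_ext
  · rw [zOne_mk, zOne_mk]
    refine (mul_eq_zero_of_right _ ?_).symm
    apply Complex.ext <;> simp
  · rw [zTwo_mk, zTwo_mk, Complex.ofReal_one, one_mul]
    refine (mul_one _).symm.trans ?_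
    congr 1
    apply Complex.ext
    · rcases hε with rfl | rfl <;> simp
    · simp

theorem pole_frame (hε : ε = 1 ∨ ε = -1) :
    gY lam t φ (ε * (Real.pi / 2)) =
      mk 0 (cis (φ + ratio lam * (ε * (Real.pi / 2))) * ⟨-ε, 0⟩) ∧
    gS lam t φ (ε * (Real.pi / 2)) =
      mk 0 (cis (φ + ratio lam * (ε * (Real.pi / 2))) * ⟨0, -1⟩) := by
  constructor
  · rw [gY, yF, (trig_pole hε).1, (trig_pole hε).2]
    apply quat_ext
    · rw [zOne_mk, zOne_mk]
      refine (mul_eq_zero_of_right _ ?_)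
      apply Complex.ext <;> simp
    · rw [zTwo_mk, zTwo_mk]; simp
  · rw [gS, sF, (trig_pole hε).1, (trig_pole hε).2]
    rw [smul_frame]
    apply quat_ext
    · rw [zOne_mk, zOne_mk]
      refine (mul_eq_zero_of_right _ ?_)
      apply Complex.ext <;> simp
    · rw [zTwo_mk, zTwo_mk]; congr 1; apply Complex.ext <;> simp

theorem cos_pos_of_not_pole (hε : ε = 1 ∨ ε = -1) (hu : u ∈ latitudes ε)
    (h : u ≠ ε * (Real.pi / 2)) : 0 < Real.cos u := by
  have := Real.pi_pos
  refine Real.cos_pos_of_mem_Ioo ?_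
  obtain ⟨⟨h3, h4⟩, h5⟩ := hu
  rcases hε with rfl | rfl
  · exact ⟨by linarith, lt_of_le_of_ne h4 (by simpa using h)⟩
  · exact ⟨lt_of_le_of_ne h3 fun h' => h (by linarith), by linarith⟩

theorem gY_gS_mem_tangentSpan (hε : ε = 1 ∨ ε = -1) (hu : u ∈ latitudes ε) :
    gY lam t φ u ∈ tangentSpan (leaf lam ε t) (gP lam t φ u) ∧
      gS lam t φ u ∈ tangentSpan (leaf lam ε t) (gP lam t φ u) := by
  have hε0 : ε ≠ 0 := by rcases hε with rfl | rfl <;> norm_num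
  by_cases hp : u = ε * (Real.pi / 2)
  · subst hp
    rw [(pole_frame hε).1, (pole_frame hε).2]
    constructor
    · refine mem_tangentSpan_of_pos (pole_mem_posTangentConeAt hε ?_)
      rw [norm_mul, norm_cis, one_mul]
      have : (⟨-ε, 0⟩ : ℂ) = ((-ε : ℝ) : ℂ) := rfl
      rw [this, Complex.norm_real]
      rcases hε with rfl | rfl <;> simp
    · refine mem_tangentSpan_of_pos (pole_mem_posTangentConeAt hε ?_)
      rw [norm_mul, norm_cis, one_mul]
      have : (⟨0, -1⟩ : ℂ) = -Complex.I := by apply Complex.ext <;> simp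
      rw [this]; simp
  · have h1 := mem_tangentSpan_of_pos (gY_up (lam := lam) (t := t) (φ := φ) hε hu hp)
    have h2 := mem_tangentSpan_of_pos (angle_mem (lam := lam) (t := t) (φ := φ) hu 1)
    rw [one_smul] at h2
    have h3 := (Submodule.smul_mem_iff _ hε0).1 h1
    refine ⟨h3, ?_⟩
    have hr : Real.cos u / freq lam ≠ 0 :=
      (div_pos (cos_pos_of_not_pole hε hu hp) (freq_pos lam)).ne'
    have hD : √(1 - (lam * (Real.cos u / freq lam)) ^ 2) ≠ 0 :=
      (Real.sqrt_pos.2 (frame_pos (gP_rel lam u))).ne'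
    refine (Submodule.smul_mem_iff _ (mul_ne_zero hr hD)).1 ?_
    rw [gS, smul_sF (gP_rel lam u)]
    exact Submodule.sub_mem _ (Submodule.smul_mem _ _ h3) h2

/-- Away from the equator, the one-sided tangent directions of a leaf lie in no proper half-plane of
its tangent plane: a linear form that is nonnegative on them vanishes on the plane. -/
theorem eq_zero_of_nonneg_posTangentConeAt (hε : ε = 1 ∨ ε = -1) (hu : u ∈ latitudes ε)
    (h0 : u ≠ 0) (l : Quat →L[ℝ] ℝ)
    (hl : ∀ x ∈ posTangentConeAt (leaf lam ε t) (gP lam t φ u), 0 ≤ l x) :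
    l (gY lam t φ u) = 0 ∧ l (gS lam t φ u) = 0 := by
  have hε0 : ε ≠ 0 := by rcases hε with rfl | rfl <;> norm_num
  by_cases hp : u = ε * (Real.pi / 2)
  · subst hp
    have key : ∀ ζ : ℂ, ‖ζ‖ = 1 → l (mk 0 ζ) = 0 := by
      intro ζ hζ
      have h1 := hl _ (pole_mem_posTangentConeAt hε hζ)
      have h2 := hl _ (pole_mem_posTangentConeAt (ζ := -ζ) hε (by rwa [norm_neg]))
      have h3 : mk 0 (-ζ) = (-1 : ℝ) • mk 0 ζ := by rw [smul_mk]; simp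
      rw [h3, map_smul, smul_eq_mul] at h2
      linarith
    rw [(pole_frame hε).1, (pole_frame hε).2]
    constructor
    · refine key _ ?_
      rw [norm_mul, norm_cis, one_mul]
      have : (⟨-ε, 0⟩ : ℂ) = ((-ε : ℝ) : ℂ) := rfl
      rw [this, Complex.norm_real]
      rcases hε with rfl | rfl <;> simp
    · refine key _ ?_
      rw [norm_mul, norm_cis, one_mul]
      have : (⟨0, -1⟩ : ℂ) = -Complex.I := by apply Complex.ext <;> simp
      rw [this]; simp
  · have h1 := hl _ (gY_up hε hu hp)
    have h2 := hl _ (gY_down hε hu h0)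
    have h3 := hl _ (angle_mem hu 1)
    have h4 := hl _ (angle_mem hu (-1))
    rw [map_smul, smul_eq_mul] at h1 h2 h3 h4
    have h5 : l (gY lam t φ u) = 0 := by
      have : ε * l (gY lam t φ u) = 0 := by linarith
      exact (mul_eq_zero.1 this).resolve_left hε0
    refine ⟨h5, ?_⟩
    have hr : Real.cos u / freq lam ≠ 0 :=
      (div_pos (cos_pos_of_not_pole hε hu hp) (freq_pos lam)).ne'
    have hD : √(1 - (lam * (Real.cos u / freq lam)) ^ 2) ≠ 0 :=
      (Real.sqrt_pos.2 (frame_pos (gP_rel lam u))).ne'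
    have h6 := congrArg l (smul_sF (η := eta lam t u) (ξ := cis (φ + ratio lam * u))
      (gP_rel lam u))
    rw [map_smul, map_sub, map_smul, smul_eq_mul, smul_eq_mul] at h6
    have h7 : l (yF lam (eta lam t u) (cis (φ + ratio lam * u)) (Real.cos u / freq lam)
      (Real.sin u)) = 0 := h5
    rw [h7] at h6
    refine (mul_eq_zero.1 ?_).resolve_left (mul_ne_zero hr hD)
    rw [gS, h6]; linarith

end Tangent

/-! ### The latitude as a smooth function near the equator -/

/-- The open range of heights of the points of latitude in `(-π/2, π/2)`. -/
def heights (lam : ℝ) : Set ℝ := height lam '' Ioo (-(Real.pi / 2)) (Real.pi / 2)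

/-- The inverse of the height function. -/
def heightInv (lam : ℝ) : ℝ → ℝ :=
  Function.invFunOn (height lam) (Ioo (-(Real.pi / 2)) (Real.pi / 2))

/-- The linear form that restricts to the height on the leaf of parameter `t`. -/
def formB (lam t : ℝ) : Quat →L[ℝ] ℝ :=
  -(Complex.imCLM.comp (cis (-(t + tauAngle lam / 2)) • zOne))

/-- The linear form dual to `formB` in the plane of the coordinate `z₁`. -/
def formA (lam t : ℝ) : Quat →L[ℝ] ℝ :=
  Complex.reCLM.comp (cis (-(t + tauAngle lam / 2)) • zOne)

theorem formB_apply (lam t : ℝ) (q : Quat) :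
    formB lam t q = -(cis (-(t + tauAngle lam / 2)) * zOne q).im := rfl

theorem formA_apply (lam t : ℝ) (q : Quat) :
    formA lam t q = (cis (-(t + tauAngle lam / 2)) * zOne q).re := rfl

/-- The points of `ℝ⁴` at which the latitude is smooth. -/
def equatorNhd (lam t : ℝ) : Set Quat := {q | formB lam t q ∈ heights lam}

/-- The latitude on the leaf of parameter `t`, as a function of the height. -/
def latB (lam t : ℝ) (q : Quat) : ℝ := heightInv lam (formB lam t q)

section

variable {lam ε t φ u : ℝ}

theorem heights_smooth (hlam : 0 ≤ lam) : IsOpen (heights lam) ∧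
    ContDiffOn ℝ ∞ (heightInv lam) (heights lam) :=
  contDiffOn_invFunOn (by simp) isOpen_Ioo (contDiff_height lam)
    (fun u _ => hasDerivAt_height lam u) (fun _ hu => (height_deriv_pos hlam hu).ne')
    ((strictMonoOn_height hlam).injOn.mono Ioo_subset_Icc_self)

theorem heightInv_mem {y : ℝ} (hy : y ∈ heights lam) :
    heightInv lam y ∈ Ioo (-(Real.pi / 2)) (Real.pi / 2) ∧ height lam (heightInv lam y) = y :=
  ⟨Function.invFunOn_mem hy, Function.invFunOn_eq hy⟩

theorem isOpen_equatorNhd (hlam : 0 ≤ lam) : IsOpen (equatorNhd lam t) :=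
  (heights_smooth hlam).1.preimage (formB lam t).continuous

theorem contDiffOn_latB (hlam : 0 ≤ lam) : ContDiffOn ℝ ∞ (latB lam t) (equatorNhd lam t) :=
  (heights_smooth hlam).2.comp (formB lam t).contDiff.contDiffOn fun _ hq => hq

theorem formB_gP (lam t φ u : ℝ) : formB lam t (gP lam t φ u) = height lam u :=
  height_of_prof (zOne_gP lam t φ u)

theorem mem_Ioo_of_gP_mem (hlam : 0 ≤ lam) (hu : u ∈ Icc (-(Real.pi / 2)) (Real.pi / 2))
    (h : gP lam t φ u ∈ equatorNhd lam t) :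
    u ∈ Ioo (-(Real.pi / 2)) (Real.pi / 2) ∧ latB lam t (gP lam t φ u) = u := by
  obtain ⟨h1, h2⟩ := heightInv_mem h
  rw [formB_gP] at h1 h2
  have h3 := (strictMonoOn_height hlam).injOn (Ioo_subset_Icc_self h1) hu h2
  rw [latB, formB_gP, h3]
  exact ⟨h3 ▸ h1, rfl⟩

theorem gP_mem_equatorNhd (hu : u ∈ Ioo (-(Real.pi / 2)) (Real.pi / 2)) :
    gP lam t φ u ∈ equatorNhd lam t := by
  rw [equatorNhd, mem_ofPred_eq, formB_gP]
  exact ⟨u, hu, rfl⟩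

theorem mem_Ioo_of_not_pole (hε : ε = 1 ∨ ε = -1) (hu : u ∈ latitudes ε)
    (h : u ≠ ε * (Real.pi / 2)) : u ∈ Ioo (-(Real.pi / 2)) (Real.pi / 2) := by
  have := Real.pi_pos
  obtain ⟨⟨h3, h4⟩, h5⟩ := hu
  rcases hε with rfl | rfl
  · exact ⟨by linarith, lt_of_le_of_ne h4 (by simpa using h)⟩
  · exact ⟨lt_of_le_of_ne h3 fun h' => h (by linarith), by linarith⟩

theorem not_pole_of_mem_Ioo (hε : ε = 1 ∨ ε = -1) (h : u ∈ Ioo (-(Real.pi / 2)) (Real.pi / 2)) :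
    u ≠ ε * (Real.pi / 2) := by
  rintro rfl
  rcases hε with rfl | rfl
  · linarith [h.2]
  · linarith [h.1]

/-! ### Charts of the leaves -/

theorem two_le_infty : (2 : WithTop ℕ∞) ≤ ∞ := WithTop.coe_le_coe.2 (le_top : (2 : ℕ∞) ≤ ⊤)

/-- A defining function of the leaf of parameter `t` near the equator. -/
def defFun (lam t : ℝ) (q : Quat) : ℝ := formA lam t q - (prof lam (latB lam t q)).re

theorem contDiffOn_defFun (hlam : 0 ≤ lam) :
    ContDiffOn ℝ ∞ (defFun lam t) (equatorNhd lam t) :=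
  (formA lam t).contDiff.contDiffOn.sub
    (Complex.reCLM.contDiff.comp_contDiffOn
      ((contDiff_prof lam).comp_contDiffOn (contDiffOn_latB hlam)))

/-- The height determines the latitude, and the point is on the leaf if the other coordinate of `z₁`
is that of the profile curve at this latitude. -/
theorem mem_leaf_iff_defFun (hlam : 0 ≤ lam) (hε : ε = 1 ∨ ε = -1) {q : Quat} (hq : q ∈ S3)
    (hqU : q ∈ equatorNhd lam t) :
    q ∈ leaf lam ε t ↔ defFun lam t q = 0 ∧ 0 ≤ ε * formB lam t q := by
  constructor
  · intro h
    obtain ⟨φ, u, hu, rfl⟩ := exists_gP h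
    obtain ⟨h1, h2⟩ := mem_Ioo_of_gP_mem hlam hu.1 hqU
    rw [defFun, h2, formB_gP, formA_apply, zOne_gP, ← mul_assoc, cis_neg_mul, one_mul]
    exact ⟨sub_self _, (sign_height hlam hε hu.1).2 hu.2⟩
  · rintro ⟨h1, h2⟩
    obtain ⟨h3, h4⟩ := heightInv_mem hqU
    have h5 := Ioo_subset_Icc_self h3
    refine ⟨hq, latB lam t q, ⟨h5, (sign_height hlam hε h5).1 ?_⟩, ?_⟩
    · rw [h4]; exact h2
    · have h6 : cis (-(t + tauAngle lam / 2)) * zOne q = prof lam (latB lam t q) := by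
        apply Complex.ext
        · rw [← formA_apply]; exact sub_eq_zero.1 h1
        · have : height lam (latB lam t q) = formB lam t q := h4
          rw [height, formB_apply] at this
          linarith
      rw [← h6, ← mul_assoc, cis_mul_neg, one_mul]

/-- If `z₂ ≠ 0`, the first coordinate is unrestricted on the tangent vectors of the sphere. -/
theorem exists_tangent {p : Quat} (hp : zTwo p ≠ 0) (ζ : ℂ) :
    ∃ v : Quat, inner ℝ p v = 0 ∧ zOne v = ζ := by
  have h0 : Complex.normSq (zTwo p) ≠ 0 := by simpa using hp
  refine ⟨mk ζ (((-((zOne p * (starRingEnd ℂ) ζ).re / Complex.normSq (zTwo p)) : ℝ) : ℂ) * zTwo p),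
    ?_, rfl⟩
  have : inner ℝ p (mk ζ (((-((zOne p * (starRingEnd ℂ) ζ).re / Complex.normSq (zTwo p)) : ℝ) : ℂ) *
    zTwo p)) = inner ℝ (mk (zOne p) (zTwo p)) (mk ζ (((-((zOne p * (starRingEnd ℂ) ζ).re /
      Complex.normSq (zTwo p)) : ℝ) : ℂ) * zTwo p)) := by rw [mk_zOne_zTwo]
  rw [this, inner_mk, map_mul, mul_left_comm, Complex.mul_conj, Complex.conj_ofReal,
    ← Complex.ofReal_mul, Complex.ofReal_re]
  field_simp
  ring

/-- The forms `formA`, `formB` take arbitrary values on the tangent vectors of the sphere. -/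
theorem exists_tangent_forms {p : Quat} (hp : zTwo p ≠ 0) (lam t x y : ℝ) :
    ∃ v : Quat, inner ℝ p v = 0 ∧ formA lam t v = x ∧ formB lam t v = y := by
  obtain ⟨v, h1, h2⟩ := exists_tangent hp (cis (t + tauAngle lam / 2) * ⟨x, -y⟩)
  refine ⟨v, h1, ?_, ?_⟩
  · rw [formA_apply, h2, ← mul_assoc, cis_neg_mul, one_mul]
  · rw [formB_apply, h2, ← mul_assoc, cis_neg_mul, one_mul, neg_neg]

theorem fderiv_defFun (hlam : 0 ≤ lam) {p : Quat} (hp : p ∈ equatorNhd lam t) :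
    ∃ x : ℝ, ∀ v, fderiv ℝ (defFun lam t) p v = formA lam t v - x * formB lam t v := by
  have h1 : DifferentiableAt ℝ (fun y => (prof lam (heightInv lam y)).re) (formB lam t p) := by
    have h2 : DifferentiableAt ℝ (heightInv lam) (formB lam t p) :=
      ((heights_smooth hlam).2.contDiffAt ((heights_smooth hlam).1.mem_nhds hp)).differentiableAt
        (by simp)
    exact Complex.reCLM.differentiableAt.comp _
      (((contDiff_prof lam (n := 1)).differentiable (by simp) _).comp _ h2)
  have h3 := (formA lam t).hasFDerivAt.sub
    (h1.hasDerivAt.comp_hasFDerivAt p (formB lam t).hasFDerivAt)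
  have h4 : HasFDerivAt (defFun lam t) _ p := h3
  exact ⟨_, fun v => by rw [h4.fderiv]; rfl⟩

theorem zTwo_gP_ne_zero (hu : u ∈ Ioo (-(Real.pi / 2)) (Real.pi / 2)) :
    zTwo (gP lam t φ u) ≠ 0 := by
  rw [zTwo_gP]
  refine mul_ne_zero ?_ (cis_ne_zero _)
  exact_mod_cast (div_pos (Real.cos_pos_of_mem_Ioo hu) (freq_pos lam)).ne'

theorem isBoundaryPoint_gP (hlam : 0 ≤ lam) (hε : ε = 1 ∨ ε = -1) (t φ : ℝ) :
    IsBoundaryPoint ∞ (leaf lam ε t) (gP lam t φ 0) := by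
  have h0 : (0 : ℝ) ∈ Ioo (-(Real.pi / 2)) (Real.pi / 2) := by
    have := Real.pi_pos
    constructor <;> linarith
  have hU := gP_mem_equatorNhd (lam := lam) (t := t) (φ := φ) h0
  refine ⟨equatorNhd lam t, defFun lam t, ε • formB lam t, isOpen_equatorNhd hlam, hU,
    contDiffOn_defFun hlam, (ε • formB lam t).contDiff.contDiffOn, ?_, ?_, ?_⟩
  · simp [formB_gP, height_zero]
  · intro a b hab
    obtain ⟨x, hx⟩ := fderiv_defFun hlam hU
    obtain ⟨v, hv1, hv2, hv3⟩ := exists_tangent_forms (zTwo_gP_ne_zero (lam := lam) (t := t)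
      (φ := φ) h0) lam t 1 0
    obtain ⟨v', hv1', hv2', hv3'⟩ := exists_tangent_forms (zTwo_gP_ne_zero (lam := lam) (t := t)
      (φ := φ) h0) lam t 0 1
    have e1 := hab v hv1
    have e2 := hab v' hv1'
    have h4 : fderiv ℝ (ε • ⇑(formB lam t)) (gP lam t φ 0) = ε • formB lam t :=
      (ε • formB lam t).fderiv
    rw [h4, hx] at e1 e2
    simp only [hv2, hv3, hv2', hv3', _root_.smul_apply, smul_eq_mul] at e1 e2
    have ha : a = 0 := by linarith
    refine ⟨ha, ?_⟩
    rw [ha] at e2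
    rcases hε with rfl | rfl <;> linarith
  · ext q
    constructor
    · rintro ⟨h1, h2⟩
      exact ⟨h1.1, h2, (mem_leaf_iff_defFun hlam hε h1.1 h2).1 h1⟩
    · rintro ⟨h1, h2, h3⟩
      exact ⟨(mem_leaf_iff_defFun hlam hε h1 h2).2 h3, h2⟩

theorem isInteriorPoint_gP (hlam : 0 ≤ lam) (hε : ε = 1 ∨ ε = -1) (t φ : ℝ) (hu : u ∈ latitudes ε)
    (h0 : u ≠ 0) (hpole : u ≠ ε * (Real.pi / 2)) :
    IsInteriorPoint ∞ (leaf lam ε t) (gP lam t φ u) := by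
  have hI := mem_Ioo_of_not_pole hε hu hpole
  have hU := gP_mem_equatorNhd (lam := lam) (t := t) (φ := φ) hI
  have hpos : 0 < ε * height lam u := by
    refine lt_of_le_of_ne ((sign_height hlam hε hu.1).2 hu.2) fun h => h0 ?_
    have h1 : height lam u = 0 :=
      (mul_eq_zero.1 h.symm).resolve_left (by rcases hε with rfl | rfl <;> norm_num)
    refine (strictMonoOn_height hlam).injOn hu.1 ?_ (h1.trans (height_zero lam).symm)
    have := Real.pi_pos
    constructor <;> linarith
  refine ⟨equatorNhd lam t ∩ {q | 0 < (ε • formB lam t) q}, defFun lam t,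
    (isOpen_equatorNhd hlam).inter (isOpen_lt continuous_const (ε • formB lam t).continuous),
    ⟨hU, ?_⟩, (contDiffOn_defFun hlam).mono inter_subset_left, ?_, ?_⟩
  · simp only [mem_ofPred_eq, _root_.smul_apply, smul_eq_mul, formB_gP]
    exact hpos
  · obtain ⟨x, hx⟩ := fderiv_defFun hlam hU
    obtain ⟨v, hv1, hv2, hv3⟩ := exists_tangent_forms (zTwo_gP_ne_zero (lam := lam) (t := t)
      (φ := φ) hI) lam t 1 0
    exact ⟨v, hv1, by rw [hx, hv2, hv3]; simp⟩
  · ext q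
    constructor
    · rintro ⟨h1, h2⟩
      exact ⟨h1.1, h2, ((mem_leaf_iff_defFun hlam hε h1.1 h2.1).1 h1).1⟩
    · rintro ⟨h1, h2, h3⟩
      exact ⟨(mem_leaf_iff_defFun hlam hε h1 h2.1).2 ⟨h3, le_of_lt h2.2⟩, h2⟩

/-! ### The submersion whose level sets are the leaves -/

/-- The function `z₁ · conj ψ(|z₂|)`, whose argument at a point is the parameter of the leaf through
the point. -/
def leafPhase (lam ε : ℝ) (q : Quat) : ℂ := zOne q * (starRingEnd ℂ) (psi lam ε ‖zTwo q‖)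

/-- The slope `tan(arg z)`. -/
def imDivRe (z : ℂ) : ℝ := z.im / z.re

/-- The points at which the phase lies in the half-plane centred at `e^{it}`. -/
def phaseNhd (lam ε t : ℝ) : Set Quat :=
  {q | freq lam * ‖zTwo q‖ < 1 ∧ 0 < (cis (-t) * leafPhase lam ε q).re}

theorem continuous_leafPhase : Continuous (leafPhase lam ε) :=
  zOne.continuous.mul (Complex.continuous_conj.comp
    (continuous_psi.comp (continuous_norm.comp zTwo.continuous)))

theorem isOpen_phaseNhd : IsOpen (phaseNhd lam ε t) := by
  refine IsOpen.inter (s := {q : Quat | freq lam * ‖zTwo q‖ < 1}) ?_ ?_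
  · exact isOpen_lt (continuous_const.mul (continuous_norm.comp zTwo.continuous)) continuous_const
  · exact isOpen_lt continuous_const (Complex.continuous_re.comp
      (continuous_const.mul continuous_leafPhase))

theorem zTwo_mem_ball {q : Quat} (h : freq lam * ‖zTwo q‖ < 1) :
    zTwo q ∈ Metric.ball (0 : ℂ) (1 / freq lam) := by
  rw [mem_ball_zero_iff, lt_div_iff₀ (freq_pos lam)]; linarith

theorem contDiffOn_leafPhase (hε : ε = 1 ∨ ε = -1) :
    ContDiffOn ℝ 2 (leafPhase lam ε) {q | freq lam * ‖zTwo q‖ < 1} :=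
  zOne.contDiff.contDiffOn.mul (Complex.conjCLE.contDiff.comp_contDiffOn
    ((contDiffOn_psi_norm hε).comp zTwo.contDiff.contDiffOn fun _ hq => zTwo_mem_ball hq))

theorem contDiffOn_slope (hε : ε = 1 ∨ ε = -1) :
    ContDiffOn ℝ 2 (fun q => imDivRe (cis (-t) * leafPhase lam ε q)) (phaseNhd lam ε t) := by
  have h1 : ContDiffOn ℝ 2 (fun q => cis (-t) * leafPhase lam ε q) (phaseNhd lam ε t) :=
    contDiffOn_const.mul ((contDiffOn_leafPhase hε).mono fun q hq => hq.1)
  exact (Complex.imCLM.contDiff.comp_contDiffOn h1).div (Complex.reCLM.contDiff.comp_contDiffOn h1)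
    fun q hq => hq.2.ne'

theorem leafPhase_vertTrans (s : ℝ) (q : Quat) :
    leafPhase lam ε (vertTrans s q) = cis s * leafPhase lam ε q := by
  rw [leafPhase, leafPhase, vertTrans_eq, zOne_mk, zTwo_mk, norm_mul, norm_cis, one_mul, mul_assoc]

/-- The slope of the phase is a submersion: it increases along the vertical translations. -/
theorem fderiv_slope_ne_zero (hε : ε = 1 ∨ ε = -1) {p : Quat} (hp : p ∈ phaseNhd lam ε t) :
    ∃ v : Quat, inner ℝ p v = 0 ∧
      fderiv ℝ (fun q => imDivRe (cis (-t) * leafPhase lam ε q)) p v ≠ 0 := by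
  refine ⟨T p, by rw [real_inner_comm]; exact (inner_E1_T p).2.2.2.2, ?_⟩
  have hd : HasFDerivAt (fun q => imDivRe (cis (-t) * leafPhase lam ε q)) _ p :=
    (((contDiffOn_slope hε).contDiffAt (isOpen_phaseNhd.mem_nhds hp)).differentiableAt
      (by norm_num)).hasFDerivAt
  have hc : HasDerivAt (fun s => vertTrans s p) (T p) 0 := by
    have h1 : ∀ z : ℂ, HasDerivAt (fun s => cis s * z) (Complex.I * z) 0 := fun z => by
      simpa using (hasDerivAt_cis 0).mul_const z
    have := hasDerivAt_mk (h1 (zOne p)) (h1 (zTwo p))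
    rw [← T_eq] at this
    exact this.congr_of_eventuallyEq (Eventually.of_forall fun s => vertTrans_eq s p)
  have h0 : vertTrans 0 p = p := by rw [vertTrans_eq]; simp
  rw [← h0] at hd
  have h2 := HasFDerivAt.comp_hasDerivAt (0 : ℝ) hd hc
  rw [h0] at h2
  set z := cis (-t) * leafPhase lam ε p with hz
  have hzr : 0 < z.re := hp.2
  have h3 : HasDerivAt (fun s => imDivRe (cis s * z)) (1 + (z.im / z.re) ^ 2) 0 := by
    have h4 : HasDerivAt (fun s => cis s * z) (Complex.I * z) 0 := by
      simpa using (hasDerivAt_cis 0).mul_const z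
    have him := Complex.imCLM.hasFDerivAt.comp_hasDerivAt (0 : ℝ) h4
    have hre := Complex.reCLM.hasFDerivAt.comp_hasDerivAt (0 : ℝ) h4
    have := him.div hre (by simpa using hzr.ne')
    refine HasDerivAt.congr_deriv (f := fun s => imDivRe (cis s * z)) this ?_
    simp
    field_simp
  have h5 : (fun q => imDivRe (cis (-t) * leafPhase lam ε q)) ∘ (fun s => vertTrans s p) =
      fun s => imDivRe (cis s * z) := by
    funext s
    simp only [Function.comp_apply, leafPhase_vertTrans, hz]
    congr 1; ring
  rw [h5] at h2
  rw [h2.unique h3]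
  positivity

/-- On the points at which the slope makes sense, a leaf is the zero set of the slope. -/
theorem mem_leaf_iff_slope (hε : ε = 1 ∨ ε = -1) {q : Quat} (hq : q ∈ S3)
    (hU : q ∈ phaseNhd lam ε t) :
    q ∈ leaf lam ε t ↔ imDivRe (cis (-t) * leafPhase lam ε q) = 0 := by
  have hn := norm_psi_sq hε (norm_nonneg (zTwo q)) hU.1.le
  have hz1 : ‖zOne q‖ ^ 2 = ‖psi lam ε ‖zTwo q‖‖ ^ 2 := by
    rw [hn]; linarith [mem_S3.1 hq]
  rw [mem_leaf_iff hε]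
  set ψ := psi lam ε ‖zTwo q‖ with hψ
  constructor
  · rintro ⟨-, -, h⟩
    rw [leafPhase, ← hψ, h, mul_assoc, ← mul_assoc, cis_neg_mul, one_mul, Complex.mul_conj, imDivRe,
      Complex.ofReal_im, zero_div]
  · intro h
    refine ⟨hq, hU.1.le, ?_⟩
    have hre := hU.2
    have him : (cis (-t) * leafPhase lam ε q).im = 0 := by
      rw [imDivRe, div_eq_zero_iff] at h
      exact h.resolve_right hre.ne'
    set z := cis (-t) * leafPhase lam ε q with hz
    have hzn : ‖z‖ = ‖ψ‖ ^ 2 := by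
      rw [hz, norm_mul, norm_cis, one_mul, leafPhase, norm_mul, Complex.norm_conj, ← hψ]
      have : ‖zOne q‖ = ‖ψ‖ := by
        rw [← abs_of_nonneg (norm_nonneg (zOne q)), ← abs_of_nonneg (norm_nonneg ψ)]
        exact (sq_eq_sq_iff_abs_eq_abs _ _).1 hz1
      rw [this, sq]
    have hz' : z = (z.re : ℂ) := by apply Complex.ext <;> simp [him]
    have hzre : z.re = ‖ψ‖ ^ 2 := by
      rw [← hzn, hz', Complex.norm_real, Real.norm_of_nonneg (by simpa using hre.le)]; simp
    have hψ0 : ψ ≠ 0 := by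
      rintro h0
      rw [h0] at hzre; simp at hzre; linarith
    have h1 : cis (-t) * zOne q * (starRingEnd ℂ) ψ = ψ * (starRingEnd ℂ) ψ := by
      rw [Complex.mul_conj, Complex.normSq_eq_norm_sq, ← hzre, ← hz', hz, leafPhase, mul_assoc]
    have h2 : cis (-t) * zOne q = ψ := by
      refine mul_right_cancel₀ ?_ h1
      simpa using hψ0
    rw [← h2, ← mul_assoc, cis_mul_neg, one_mul]

theorem mem_phaseNhd_of_mem_leaf (hε : ε = 1 ∨ ε = -1) {q : Quat} (hq : q ∈ leaf lam ε t)
    (h : freq lam * ‖zTwo q‖ < 1) : q ∈ phaseNhd lam ε t := by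
  have h1 := (mem_leaf_iff hε).1 hq
  have hk : 1 ≤ freq lam := by nlinarith [freq_sq lam, freq_pos lam]
  have hn := norm_psi_sq hε (norm_nonneg (zTwo q)) h.le
  refine ⟨h, ?_⟩
  rw [leafPhase, h1.2.2, mul_assoc, ← mul_assoc, cis_neg_mul, one_mul, Complex.mul_conj,
    Complex.ofReal_re, Complex.normSq_eq_norm_sq, hn]
  nlinarith [norm_nonneg (zTwo q)]

/-- The points off the equator, including the pole, are interior points: there the leaf is a level
set of the slope of the phase, which is of class `C²` but not smooth at the pole. -/
theorem isInteriorPoint_of_lt (hε : ε = 1 ∨ ε = -1) {p : Quat} (hp : p ∈ leaf lam ε t)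
    (h : freq lam * ‖zTwo p‖ < 1) : IsInteriorPoint 2 (leaf lam ε t) p := by
  have hU := mem_phaseNhd_of_mem_leaf hε hp h
  refine ⟨phaseNhd lam ε t, _, isOpen_phaseNhd, hU, contDiffOn_slope hε,
    fderiv_slope_ne_zero hε hU, ?_⟩
  ext q
  constructor
  · rintro ⟨h1, h2⟩
    exact ⟨h1.1, h2, (mem_leaf_iff_slope hε h1.1 h2).1 h1⟩
  · rintro ⟨h1, h2, h3⟩
    exact ⟨(mem_leaf_iff_slope hε h1 h2).2 h3, h2⟩

theorem norm_zTwo_gP (hu : u ∈ Icc (-(Real.pi / 2)) (Real.pi / 2)) :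
    ‖zTwo (gP lam t φ u)‖ = Real.cos u / freq lam :=
  norm_zTwo_of_prof (gP_mem_S3 _ _ _ _) hu (zOne_gP _ _ _ _)

theorem freq_mul_norm_gP_lt (hu : u ∈ latitudes ε) (h0 : u ≠ 0) :
    freq lam * ‖zTwo (gP lam t φ u)‖ < 1 := by
  rw [norm_zTwo_gP hu.1, mul_div_cancel₀ _ (freq_pos lam).ne']
  refine lt_of_le_of_ne (Real.cos_le_one u) fun h => h0 ?_
  have := Real.pi_pos
  exact (Real.cos_eq_one_iff_of_lt_of_lt (by linarith [hu.1.1]) (by linarith [hu.1.2])).1 h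

theorem isSurface_leaf (hlam : 0 ≤ lam) (hε : ε = 1 ∨ ε = -1) (t : ℝ) :
    IsSurface 2 (leaf lam ε t) := by
  refine ⟨fun p hp => hp.1, fun p hp => ?_⟩
  obtain ⟨φ, u, hu, rfl⟩ := exists_gP hp
  by_cases h0 : u = 0
  · subst h0
    exact Or.inr ((isBoundaryPoint_gP hlam hε t φ).of_le two_le_infty)
  · exact Or.inl (isInteriorPoint_of_lt hε hp (freq_mul_norm_gP_lt hu h0))

/-- The pole of the leaf of parameter `t`. -/
def poleP (lam ε t : ℝ) : Quat := gP lam t 0 (ε * (Real.pi / 2))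

theorem gP_eq_poleP_iff (hε : ε = 1 ∨ ε = -1) (hu : u ∈ latitudes ε) :
    gP lam t φ u = poleP lam ε t ↔ u = ε * (Real.pi / 2) := by
  constructor
  · intro h
    by_contra hne
    refine zTwo_gP_ne_zero (lam := lam) (t := t) (φ := φ) (mem_Ioo_of_not_pole hε hu hne) ?_
    rw [h, poleP, zTwo_gP, (trig_pole hε).1]; simp
  · rintro rfl
    exact gP_pole_eq hε _ _

theorem isSurface_leaf_diff_pole (hlam : 0 ≤ lam) (hε : ε = 1 ∨ ε = -1) (t : ℝ) :
    IsSurface ∞ (leaf lam ε t \ {poleP lam ε t}) := by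
  refine ⟨fun p hp => hp.1.1, fun p hp => ?_⟩
  obtain ⟨φ, u, hu, rfl⟩ := exists_gP hp.1
  have hne : u ≠ ε * (Real.pi / 2) := fun h => hp.2 ((gP_eq_poleP_iff hε hu).2 h)
  by_cases h0 : u = 0
  · subst h0
    exact Or.inr ((isBoundaryPoint_gP hlam hε t φ).diff_closed isClosed_singleton hp.2)
  · exact Or.inl ((isInteriorPoint_gP hlam hε t φ hu h0 hne).diff_closed isClosed_singleton hp.2)

theorem eq_of_inner_eq_zero {v : Quat} (h1 : inner ℝ (gP lam t φ u) v = 0) :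
    v = inner ℝ (gY lam t φ u) v • gY lam t φ u + inner ℝ (gS lam t φ u) v • gS lam t φ u +
      inner ℝ (gN lam t φ u) v • gN lam t φ u := by
  have := eq_of_orthonormal (orthonormal_gP lam t φ u) v
  simp only [Matrix.cons_val] at this
  rw [h1, zero_smul, zero_add] at this
  rw [add_comm, ← add_assoc]
  exact this

theorem surfaceBoundary_leaf (hlam : 0 ≤ lam) (hε : ε = 1 ∨ ε = -1) (t : ℝ) :
    surfaceBoundary 2 (leaf lam ε t) = {p | ∃ φ, p = gP lam t φ 0} := by
  ext p
  constructor
  · rintro ⟨hp, hb⟩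
    obtain ⟨φ, u, hu, rfl⟩ := exists_gP hp
    by_cases h0 : u = 0
    · exact ⟨φ, by rw [h0]⟩
    · exact absurd hb (not_isBoundaryPoint (by norm_num) hp
        (fun x hx => ⟨_, _, _, eq_of_inner_eq_zero hx⟩)
        (fun l hl => eq_zero_of_nonneg_posTangentConeAt hε hu h0 l hl))
  · rintro ⟨φ, rfl⟩
    have h0 : (0 : ℝ) ∈ latitudes ε := by
      have := Real.pi_pos
      exact ⟨⟨by linarith, by linarith⟩, by simp⟩
    exact ⟨gP_mem_leaf h0, (isBoundaryPoint_gP hlam hε t φ).of_le two_le_infty⟩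

end

/-! ### Tangent planes and singular points -/

section

variable {lam ε t φ u : ℝ}

/-- A vector `v` whose first coordinate is a real multiple of `-iη` is orthogonal to `(η, 0)`, the
vector from which the unit normal is obtained by projection to the tangent space of the sphere. -/
theorem inner_mk_zero_of_zOne {η : ℂ} {v : Quat} {x : ℝ} (hη : ‖η‖ = 1)
    (h : zOne v = (x : ℂ) * (-Complex.I * η)) : inner ℝ (mk η 0) v = 0 := by
  rw [← mk_zOne_zTwo v, inner_mk, h]
  have : η * (starRingEnd ℂ) ((x : ℂ) * (-Complex.I * η)) =
      (x : ℂ) * (Complex.I * ((‖η‖ ^ 2 : ℝ) : ℂ)) := by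
    rw [← Complex.normSq_eq_norm_sq, ← Complex.mul_conj]
    simp; ring
  rw [this, hη]
  simp

theorem norm_eta (lam t u : ℝ) : ‖eta lam t u‖ = 1 := norm_cis _

/-- The tangent vectors of a leaf are orthogonal to its normal. -/
theorem inner_gN_eq_zero (hlam : 0 ≤ lam) (hε : ε = 1 ∨ ε = -1) (hu : u ∈ latitudes ε) {v : Quat}
    (hv : v ∈ tangentSpan (leaf lam ε t) (gP lam t φ u)) : inner ℝ (gN lam t φ u) v = 0 := by
  have hp : gP lam t φ u ∈ leaf lam ε t := gP_mem_leaf hu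
  have hpv : inner ℝ (gP lam t φ u) v = 0 :=
    inner_eq_zero_of_mem_tangentSpan (fun q hq => hq.1) hp hv
  suffices h : ∃ x : ℝ, zOne v = (x : ℂ) * (-Complex.I * eta lam t u) by
    obtain ⟨x, hx⟩ := h
    have hpv' : inner ℝ (pF lam (eta lam t u) (cis (φ + ratio lam * u)) (Real.cos u / freq lam)
      (Real.sin u)) v = 0 := hpv
    rw [gN, nF_eq', real_inner_smul_left, inner_sub_left, real_inner_smul_left, hpv',
      inner_mk_zero_of_zOne (norm_eta lam t u) hx]
    simp
  by_cases hpole : u = ε * (Real.pi / 2)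
  · refine ⟨0, ?_⟩
    have hz : zTwo (gP lam t φ u) = 0 := by
      rw [zTwo_gP, hpole, (trig_pole hε).1]; simp
    have h1 : HasFDerivAt (fun z : ℂ => psi lam ε ‖z‖) (0 : ℂ →L[ℝ] ℂ) (zTwo (gP lam t φ u)) := by
      have := hasFDerivAt_radial (E := ℂ) (fun r hr => hasDerivAt_psi (lam := lam) hε hr)
        (z := zTwo (gP lam t φ u)) (by
          rw [hz]; simpa using freq_pos lam)
      refine this.congr_fderiv ?_
      ext w; simp [hz]
    have h2 := ((h1.comp (gP lam t φ u) zTwo.hasFDerivAt).const_mul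
      (cis t)).hasFDerivWithinAt (s := leaf lam ε t)
    have h3 := fderiv_eq_of_eqOn (zOne.hasFDerivAt.hasFDerivWithinAt) h2
      (eventually_of_mem self_mem_nhdsWithin fun q hq => ((mem_leaf_iff hε).1 hq).2.2) hp hv
    rw [h3]; simp
  · have hI := mem_Ioo_of_not_pole hε hu hpole
    have hU := gP_mem_equatorNhd (lam := lam) (t := t) (φ := φ) hI
    have hmem := (isOpen_equatorNhd hlam).mem_nhds hU
    have hlat := (mem_Ioo_of_gP_mem hlam hu.1 hU).2
    have h1 : HasFDerivAt (latB lam t) (fderiv ℝ (latB lam t) (gP lam t φ u)) (gP lam t φ u) :=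
      (((contDiffOn_latB hlam).contDiffAt hmem).differentiableAt (by simp)).hasFDerivAt
    have h2 : HasDerivAt (prof lam) _ (latB lam t (gP lam t φ u)) := hasDerivAt_prof lam _
    have h3 := ((h2.hasFDerivAt.comp (gP lam t φ u) h1).const_mul
      (cis (t + tauAngle lam / 2))).hasFDerivWithinAt (s := leaf lam ε t)
    have h4 := fderiv_eq_of_eqOn (zOne.hasFDerivAt.hasFDerivWithinAt) h3 ?_ hp hv
    · refine ⟨fderiv ℝ (latB lam t) (gP lam t φ u) v * (1 / freq lam ^ 2 * Real.cos u), ?_⟩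
      rw [h4, hlat, eta, cis_add (t + tauAngle lam / 2)]
      simp only [_root_.smul_apply, ContinuousLinearMap.comp_apply,
        ContinuousLinearMap.toSpanSingleton_apply, smul_eq_mul, Complex.real_smul]
      push_cast
      ring
    · filter_upwards [self_mem_nhdsWithin, nhdsWithin_le_nhds hmem] with q hq hqU
      obtain ⟨φ', u', hu', rfl⟩ := exists_gP hq
      simp only [Function.comp_apply]
      rw [(mem_Ioo_of_gP_mem hlam hu'.1 hqU).2, zOne_gP]

theorem tangentSpan_leaf_eq (hlam : 0 ≤ lam) (hε : ε = 1 ∨ ε = -1) (hu : u ∈ latitudes ε) :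
    tangentSpan (leaf lam ε t) (gP lam t φ u) =
      Submodule.span ℝ (range ![gY lam t φ u, gS lam t φ u]) := by
  have h := gY_gS_mem_tangentSpan (lam := lam) (t := t) (φ := φ) hε hu
  rw [Matrix.range_cons, Matrix.range_cons, Matrix.range_empty, union_empty]
  apply le_antisymm
  · intro v hv
    have h1 := inner_eq_zero_of_mem_tangentSpan (fun q hq => hq.1) (gP_mem_leaf hu) hv
    have h2 := inner_gN_eq_zero hlam hε hu hv
    have h3 := eq_of_inner_eq_zero h1
    rw [h2, zero_smul, add_zero] at h3
    exact Submodule.mem_span_pair.2 ⟨_, _, h3.symm⟩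
  · refine Submodule.span_le.2 ?_
    rintro v (rfl | rfl)
    · exact h.1
    · exact h.2

theorem orthonormal_gY_gS (lam t φ u : ℝ) : Orthonormal ℝ ![gY lam t φ u, gS lam t φ u] := by
  have h := (orthonormal_gP lam t φ u).comp (![2, 3] : Fin 2 → Fin 4) (by decide)
  convert h using 1
  funext i
  fin_cases i <;> rfl

theorem mem_tangentSpan_leaf (hlam : 0 ≤ lam) (hε : ε = 1 ∨ ε = -1) (hu : u ∈ latitudes ε)
    {v : Quat} : v ∈ tangentSpan (leaf lam ε t) (gP lam t φ u) ↔
      inner ℝ (gP lam t φ u) v = 0 ∧ inner ℝ (gN lam t φ u) v = 0 := by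
  refine ⟨fun hv => ⟨inner_eq_zero_of_mem_tangentSpan (fun q hq => hq.1) (gP_mem_leaf hu) hv,
    inner_gN_eq_zero hlam hε hu hv⟩, fun ⟨h1, h2⟩ => ?_⟩
  have h := gY_gS_mem_tangentSpan (lam := lam) (t := t) (φ := φ) hε hu
  rw [eq_of_inner_eq_zero h1, h2, zero_smul, add_zero]
  exact Submodule.add_mem _ (Submodule.smul_mem _ _ h.1) (Submodule.smul_mem _ _ h.2)

theorem gX_inner (lam t φ u : ℝ) : inner ℝ (gX lam t φ u) (gX lam t φ u) = 1 ∧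
    inner ℝ (gX lam t φ u) (gP lam t φ u) = 0 ∧
    inner ℝ (gX lam t φ u) (T (gP lam t φ u)) = 0 ∧
    inner ℝ (gY lam t φ u) (T (gP lam t φ u)) = 0 ∧
    inner ℝ (gX lam t φ u) (gY lam t φ u) = 0 ∧
    inner ℝ (gY lam t φ u) (gP lam t φ u) = 0 :=
  xF_inner (norm_cis _) (norm_cis _) (gP_rel lam u)

theorem gD_pos (lam u : ℝ) : 0 < √(1 - (lam * (Real.cos u / freq lam)) ^ 2) :=
  Real.sqrt_pos.2 (frame_pos (gP_rel lam u))

theorem gN_eq (lam t φ u : ℝ) : gN lam t φ u = (√(1 - (lam * (Real.cos u / freq lam)) ^ 2))⁻¹ •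
    ((Real.cos u / freq lam) • gX lam t φ u + Real.sin u • T (gP lam t φ u)) :=
  nF_eq (gP_rel lam u)

theorem gS_eq (lam t φ u : ℝ) : gS lam t φ u = (√(1 - (lam * (Real.cos u / freq lam)) ^ 2))⁻¹ •
    (Real.sin u • gX lam t φ u - (Real.cos u / freq lam) • T (gP lam t φ u)) :=
  sF_eq (gP_rel lam u)

theorem inner_T_T {p : Quat} (hp : p ∈ S3) : inner ℝ (T p) (T p) = 1 := by
  have := inner_self_of_mem_S3 hp
  rw [inner_eq] at this ⊢
  simp [T]; linarith

theorem singularSet_leaf (hlam : 0 ≤ lam) (hε : ε = 1 ∨ ε = -1) (t : ℝ) :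
    singularSet (leaf lam ε t) = {poleP lam ε t} := by
  ext p
  rw [mem_singleton_iff]
  constructor
  · rintro ⟨hp, hs⟩
    obtain ⟨φ, u, hu, rfl⟩ := exists_gP hp
    rw [gP_eq_poleP_iff hε hu]
    by_contra hne
    have h1 := (gY_gS_mem_tangentSpan (lam := lam) (t := t) (φ := φ) hε hu).2
    rw [hs, mem_horizontal hp.1] at h1
    have h2 := h1.2
    rw [gS_eq, real_inner_smul_left, inner_sub_left, real_inner_smul_left, real_inner_smul_left,
      inner_T_T hp.1, (gX_inner lam t φ u).2.2.1] at h2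
    have hr := div_pos (cos_pos_of_not_pole hε hu hne) (freq_pos lam)
    have := inv_pos.2 (gD_pos lam u)
    have h3 := (mul_eq_zero.1 h2).resolve_left this.ne'
    linarith
  · rintro rfl
    have hu := pole_mem_latitudes hε
    refine ⟨gP_mem_leaf hu, ?_⟩
    ext v
    rw [poleP, mem_tangentSpan_leaf hlam hε hu, mem_horizontal (gP_mem_S3 _ _ _ _), gN_eq,
      (trig_pole hε).1, (trig_pole hε).2, real_inner_comm, real_inner_comm v]
    have hε0 : ε ≠ 0 := by rcases hε with rfl | rfl <;> norm_num
    simp [inner_smul_right, hε0]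

/-! ### The unit normal -/

/-- The unit normal of the leaf of parameter `t`, extended to `ℝ⁴`: up to normalization, the part
tangent to the sphere of the unit complex number `η`. -/
def normalField (lam ε t : ℝ) (p : Quat) : Quat :=
  (√(1 - (lam * ‖zTwo p‖) ^ 2))⁻¹ •
    (mk (eta lam t (lat lam ε ‖zTwo p‖)) 0 - (lam * ‖zTwo p‖) • p)

theorem translateField_normalField (lam ε t : ℝ) :
    translateField t (normalField lam ε 0) = normalField lam ε t := by
  funext p
  have h1 : ‖zTwo (vertTrans (-t) p)‖ = ‖zTwo p‖ := by rw [vertTrans_eq]; simp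
  have h2 : ∀ (x y : ℝ) (a b : Quat), vertTrans t (x • (a - y • b)) =
      x • (vertTrans t a - y • vertTrans t b) := by
    intro x y a b
    simp only [vertTrans]
    rw [mul_smul_comm, mul_sub, mul_smul_comm]
  rw [translateField, normalField, normalField, h1, h2, vertTrans_vertTrans_neg]
  congr 2
  rw [vertTrans_eq]
  apply quat_ext
  · simp [eta, ← cis_add, add_assoc]
  · simp

theorem normalField_gP (hε : ε = 1 ∨ ε = -1) (hu : u ∈ latitudes ε) :
    normalField lam ε t (gP lam t φ u) = gN lam t φ u := by
  rw [normalField, norm_zTwo_gP hu.1, lat_cos hε hu, gN, nF_eq']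
  rfl

/-- The unit normal near the equator, as a smooth function of the latitude. -/
def normalB (lam t : ℝ) (p : Quat) : Quat :=
  (√(1 - (lam * (Real.cos (latB lam t p) / freq lam)) ^ 2))⁻¹ •
    (mk (eta lam t (latB lam t p)) 0 - (lam * (Real.cos (latB lam t p) / freq lam)) • p)

theorem contDiff_eta {n : WithTop ℕ∞} : ContDiff ℝ n (eta lam t) :=
  contDiff_cis.comp (contDiff_const.add (contDiff_const.mul contDiff_id))

theorem contDiffOn_mk {n : WithTop ℕ∞} {f g : Quat → ℂ} {A : Set Quat}
    (hf : ContDiffOn ℝ n f A) (hg : ContDiffOn ℝ n g A) :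
    ContDiffOn ℝ n (fun q => mk (f q) (g q)) A :=
  mkL.contDiff.comp_contDiffOn (hf.prodMk hg)

theorem contDiffOn_normalB (hlam : 0 ≤ lam) :
    ContDiffOn ℝ ∞ (normalB lam t) (equatorNhd lam t) := by
  have hl := contDiffOn_latB (t := t) hlam
  have hr : ContDiffOn ℝ ∞ (fun p => lam * (Real.cos (latB lam t p) / freq lam))
      (equatorNhd lam t) :=
    contDiffOn_const.mul ((Real.contDiff_cos.comp_contDiffOn hl).div_const _)
  refine ContDiffOn.smul (ContDiffOn.inv (ContDiffOn.sqrt (contDiffOn_const.sub (hr.pow 2)) ?_) ?_)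
    ((contDiffOn_mk (contDiff_eta.comp_contDiffOn hl) contDiffOn_const).sub
      (hr.smul contDiffOn_id))
  · exact fun p _ => (frame_pos (gP_rel lam _)).ne'
  · exact fun p _ => (gD_pos lam _).ne'

/-- The unit normal near the pole, as a function of class `C¹` of the coordinates: here `η` is
multiplied by `|z₂|²`, which makes up for its corner at `z₂ = 0`. -/
def normalPole (lam ε t : ℝ) (p : Quat) : Quat :=
  (√(1 - (lam * ‖zTwo p‖) ^ 2))⁻¹ •
    mk (Complex.I * ((ε * √(1 - (freq lam * ‖zTwo p‖) ^ 2) : ℝ) : ℂ) * zOne p +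
        ((zTwo p).re • ((zTwo p).re • eta lam t (lat lam ε ‖zTwo p‖)) +
          (zTwo p).im • ((zTwo p).im • eta lam t (lat lam ε ‖zTwo p‖))))
      (-((lam : ℂ) * ((((zTwo p).re • ‖zTwo p‖ : ℝ) : ℂ) +
        (((zTwo p).im • ‖zTwo p‖ : ℝ) : ℂ) * Complex.I)))

theorem sub_sq_pos {r : ℝ} (hr : 0 ≤ r) (h : freq lam * r < 1) :
    0 < 1 - (freq lam * r) ^ 2 ∧ 0 < 1 - (lam * r) ^ 2 := by
  have h0 : 0 ≤ freq lam * r := mul_nonneg (freq_pos lam).le hr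
  have h1 : (freq lam * r) ^ 2 < 1 := by nlinarith
  refine ⟨by linarith, ?_⟩
  rw [mul_pow, freq_sq] at h1
  nlinarith [sq_nonneg r]

theorem contDiffOn_normalPole :
    ContDiffOn ℝ 1 (normalPole lam ε t) {p | freq lam * ‖zTwo p‖ < 1} := by
  set A : Set Quat := {p | freq lam * ‖zTwo p‖ < 1} with hA
  have hk := freq_pos lam
  have hmaps : MapsTo zTwo A (Metric.ball (0 : ℂ) (1 / freq lam)) := fun q hq => zTwo_mem_ball hq
  have hsq : ∀ a : ℝ, ContDiffOn ℝ 1 (fun p : Quat => 1 - (a * ‖zTwo p‖) ^ 2) A := by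
    intro a
    have h2 : (fun p : Quat => 1 - (a * ‖zTwo p‖) ^ 2) = fun p => 1 - a ^ 2 * ‖zTwo p‖ ^ 2 := by
      funext p; ring
    rw [h2]
    exact (contDiff_const.sub (contDiff_const.mul (zTwo.contDiff.norm_sq ℝ))).contDiffOn
  have heta : ContDiffOn ℝ 1 (fun r => eta lam t (lat lam ε r))
      (Ioo (-(1 / freq lam)) (1 / freq lam)) := fun r hr =>
    (contDiff_eta.contDiffAt.comp r (contDiffAt_lat (abs_lt.2 hr))).contDiffWithinAt
  have hre : ∀ {F : Type} [NormedAddCommGroup F] [NormedSpace ℝ F] {g : ℝ → F},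
      ContDiffOn ℝ 1 g (Ioo (-(1 / freq lam)) (1 / freq lam)) →
      ContDiffOn ℝ 1 (fun p : Quat => (zTwo p).re • g ‖zTwo p‖) A := by
    intro F _ _ g hg
    have := (contDiffOn_inner_smul_radial hg (1 : ℂ)).comp zTwo.contDiff.contDiffOn hmaps
    refine this.congr fun p _ => ?_
    simp
  have him : ∀ {F : Type} [NormedAddCommGroup F] [NormedSpace ℝ F] {g : ℝ → F},
      ContDiffOn ℝ 1 g (Ioo (-(1 / freq lam)) (1 / freq lam)) →
      ContDiffOn ℝ 1 (fun p : Quat => (zTwo p).im • g ‖zTwo p‖) A := by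
    intro F _ _ g hg
    have := (contDiffOn_inner_smul_radial hg Complex.I).comp zTwo.contDiff.contDiffOn hmaps
    refine this.congr fun p _ => ?_
    simp
  have hcre : ContDiffOn ℝ 1 (fun p : Quat => (zTwo p).re) A :=
    (Complex.reCLM.contDiff.comp zTwo.contDiff).contDiffOn
  have hcim : ContDiffOn ℝ 1 (fun p : Quat => (zTwo p).im) A :=
    (Complex.imCLM.contDiff.comp zTwo.contDiff).contDiffOn
  have hof : ∀ {f : Quat → ℝ}, ContDiffOn ℝ 1 f A → ContDiffOn ℝ 1 (fun p => (f p : ℂ)) A :=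
    fun hf => Complex.ofRealCLM.contDiff.comp_contDiffOn hf
  have hpos : ∀ p ∈ A, 0 < 1 - (freq lam * ‖zTwo p‖) ^ 2 ∧ 0 < 1 - (lam * ‖zTwo p‖) ^ 2 :=
    fun p hp => sub_sq_pos (norm_nonneg _) hp
  refine ContDiffOn.smul (ContDiffOn.inv (ContDiffOn.sqrt (hsq lam) fun p hp => (hpos p hp).2.ne')
    fun p hp => (Real.sqrt_pos.2 (hpos p hp).2).ne') (contDiffOn_mk ?_ ?_)
  · refine ContDiffOn.add (ContDiffOn.mul (contDiffOn_const.mul (hof ?_)) zOne.contDiff.contDiffOn)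
      ((hcre.smul (hre heta)).add (hcim.smul (him heta)))
    exact contDiffOn_const.mul (ContDiffOn.sqrt (hsq _) fun p hp => (hpos p hp).1.ne')
  · refine (contDiffOn_const.mul ((hof (hre contDiffOn_id)).add
      ((hof (him contDiffOn_id)).mul contDiffOn_const))).neg

/-- On the leaf, the first coordinate of the normal is rewritten by the identity
`η (1 - λ²r² + iλrw) = i w z₁ + r² η`, in which `η` carries a factor that vanishes at the pole. -/
theorem normalField_eq_normalPole (hε : ε = 1 ∨ ε = -1) {p : Quat} (hp : p ∈ leaf lam ε t) :
    normalField lam ε t p = normalPole lam ε t p := by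
  obtain ⟨φ, u, hu, rfl⟩ := exists_gP hp
  rw [normalField_gP hε hu, normalPole, ← sin_lat hε, norm_zTwo_gP hu.1, lat_cos hε hu, gN, nF]
  congr 1
  have hz2 : zTwo (gP lam t φ u) = cis (φ + ratio lam * u) * ⟨Real.cos u / freq lam, 0⟩ := rfl
  have hz1 : zOne (gP lam t φ u) =
    eta lam t u * ⟨lam * (Real.cos u / freq lam), -Real.sin u⟩ := rfl
  have h := gP_rel lam u
  have hn : (zTwo (gP lam t φ u)).re ^ 2 + (zTwo (gP lam t φ u)).im ^ 2 =
      (Real.cos u / freq lam) ^ 2 := by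
    rw [← norm_zTwo_gP (lam := lam) (t := t) (φ := φ) hu.1, ← Complex.normSq_eq_norm_sq,
      Complex.normSq_apply]; ring
  set r := Real.cos u / freq lam with hr
  apply quat_ext
  · simp only [zOne_mk, smul_smul, ← add_smul]
    rw [← sq, ← sq, hn, hz1, Complex.real_smul]
    have : (⟨1 - (lam * r) ^ 2, lam * r * Real.sin u⟩ : ℂ) =
        Complex.I * (Real.sin u : ℂ) * ⟨lam * r, -Real.sin u⟩ + ((r ^ 2 : ℝ) : ℂ) := by
      apply Complex.ext
      · simp only [Complex.add_re, Complex.mul_re, Complex.mul_im, Complex.I_re, Complex.I_im,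
          Complex.ofReal_re, Complex.ofReal_im]
        linear_combination -h
      · simp only [Complex.add_im, Complex.mul_re, Complex.mul_im, Complex.I_re, Complex.I_im,
          Complex.ofReal_re, Complex.ofReal_im]
        ring
    rw [this]; ring
  · simp only [zTwo_mk]
    have h2 : ((((zTwo (gP lam t φ u)).re • r : ℝ) : ℂ) +
        (((zTwo (gP lam t φ u)).im • r : ℝ) : ℂ) * Complex.I) = zTwo (gP lam t φ u) * r := by
      apply Complex.ext <;> simp
    have h3 : (⟨-(lam * r ^ 2), 0⟩ : ℂ) = ((-(lam * r ^ 2) : ℝ) : ℂ) := rfl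
    have h4 : (⟨r, 0⟩ : ℂ) = (r : ℂ) := rfl
    rw [h2, hz2, h3, h4]
    push_cast
    ring

theorem isUnitNormal_leaf (hlam : 0 ≤ lam) (hε : ε = 1 ∨ ε = -1) (t : ℝ) :
    IsUnitNormal (leaf lam ε t) (normalField lam ε t) := by
  constructor
  · intro p hp
    obtain ⟨φ, u, hu, rfl⟩ := exists_gP hp
    by_cases h0 : u = 0
    · have hU : gP lam t φ u ∈ equatorNhd lam t := by
        refine gP_mem_equatorNhd ?_
        rw [h0]
        constructor <;> linarith [Real.pi_pos]
      have hmem := (isOpen_equatorNhd hlam).mem_nhds hU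
      have h1 : ContDiffAt ℝ 1 (normalB lam t) (gP lam t φ u) :=
        ((contDiffOn_normalB hlam).contDiffAt hmem).of_le (by simp)
      refine h1.contDiffWithinAt.congr_of_eventuallyEq_of_mem ?_ hp
      filter_upwards [self_mem_nhdsWithin, nhdsWithin_le_nhds hmem] with q hq hqU
      obtain ⟨φ', u', hu', rfl⟩ := exists_gP hq
      rw [normalField, normalB, norm_zTwo_gP hu'.1, lat_cos hε hu',
        (mem_Ioo_of_gP_mem hlam hu'.1 hqU).2]
    · have hmem : {p : Quat | freq lam * ‖zTwo p‖ < 1} ∈ 𝓝 (gP lam t φ u) :=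
        (isOpen_lt (continuous_const.mul (continuous_norm.comp zTwo.continuous))
          continuous_const).mem_nhds (freq_mul_norm_gP_lt hu h0)
      exact (contDiffOn_normalPole.contDiffAt hmem).contDiffWithinAt.congr
        (fun q hq => normalField_eq_normalPole hε hq) (normalField_eq_normalPole hε hp)
  · intro p hp
    obtain ⟨φ, u, hu, rfl⟩ := exists_gP hp
    rw [normalField_gP hε hu]
    have h := orthonormal_gP lam t φ u
    refine ⟨h.1 1, ?_, fun v hv => inner_gN_eq_zero hlam hε hu hv⟩
    exact h.2 (i := 1) (j := 0) (by decide)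

/-! ### The mean curvature -/

theorem horizontalPart_eq {p : Quat} (hp : p ∈ S3) (v : Quat) :
    horizontalPart p v = v - inner ℝ v p • p - inner ℝ v (T p) • T p := by
  have h := eq_frame_sum hp v
  rw [eq_sub_iff_add_eq, eq_sub_iff_add_eq]
  rw [add_comm _ (inner ℝ v p • p), add_comm (horizontalPart p v), ← add_assoc]
  exact h.symm

/-- The unit normal is a combination `(r X + w T) / √(1 - λ²r²)`, so that `X` is its normalized
horizontal part; away from the pole, `r > 0`. -/
theorem horizontalGauss_gP (hε : ε = 1 ∨ ε = -1) (hu : u ∈ latitudes ε)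
    (hpole : u ≠ ε * (Real.pi / 2)) :
    horizontalGauss (normalField lam ε t) (gP lam t φ u) = gX lam t φ u := by
  have hp := gP_mem_S3 lam t φ u
  obtain ⟨hX1, hX2, hX3, -⟩ := gX_inner lam t φ u
  have hTp : inner ℝ (T (gP lam t φ u)) (gP lam t φ u) = 0 := (inner_E1_T _).2.2.2.2
  have hr := div_pos (cos_pos_of_not_pole hε hu hpole) (freq_pos lam)
  have hD := inv_pos.2 (gD_pos lam u)
  have h1 : horizontalPart (gP lam t φ u) (gN lam t φ u) =
      ((√(1 - (lam * (Real.cos u / freq lam)) ^ 2))⁻¹ * (Real.cos u / freq lam)) •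
        gX lam t φ u := by
    rw [horizontalPart_eq hp, gN_eq]
    set D := (√(1 - (lam * (Real.cos u / freq lam)) ^ 2))⁻¹
    simp only [real_inner_smul_left, inner_add_left, hX2, hX3, hTp, inner_T_T hp]
    module
  have hXn : ‖gX lam t φ u‖ = 1 := by
    rw [norm_eq_sqrt_real_inner, hX1, Real.sqrt_one]
  rw [horizontalGauss, normalField_gP hε hu, h1, norm_smul, hXn, mul_one,
    Real.norm_of_nonneg (mul_pos hD hr).le, smul_smul, inv_mul_cancel₀ (mul_pos hD hr).ne',
    one_smul]

/-- The derivative of the horizontal Gauss map along the geodesics of a leaf. -/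
theorem deriv_gY (hε : ε = 1 ∨ ε = -1) (hu : u ∈ latitudes ε) (hpole : u ≠ ε * (Real.pi / 2))
    {X : Quat → Quat} {V' : Quat →L[ℝ] Quat}
    (hX : HasFDerivWithinAt X V' (leaf lam ε t) (gP lam t φ u))
    (h : ∀ᶠ u' in 𝓝[latitudes ε] u, X (gP lam t φ u') = gX lam t φ u') :
    V' (gY lam t φ u) = -(2 * lam) • gY lam t φ u - T (gP lam t φ u) := by
  have hk := freq_pos lam
  have h1 : HasDerivWithinAt (X ∘ gP lam t φ) (V' ((1 / freq lam) • gY lam t φ u))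
      (latitudes ε) u :=
    hX.comp_hasDerivWithinAt u (hasDerivAt_gP lam t φ u).hasDerivWithinAt
      fun u' hu' => gP_mem_leaf hu'
  have h2 : HasDerivWithinAt (X ∘ gP lam t φ) _ (latitudes ε) u :=
    (hasDerivAt_gX lam t φ u).hasDerivWithinAt.congr_of_eventuallyEq h (h.self_of_nhdsWithin hu)
  have hud : UniqueDiffWithinAt ℝ (latitudes ε) u := by
    have := Real.pi_pos
    rcases hε with rfl | rfl
    · have e : latitudes 1 = Icc 0 (Real.pi / 2) := by
        ext x; constructor
        · rintro ⟨⟨h1, h2⟩, h3⟩; exact ⟨by linarith, h2⟩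
        · rintro ⟨h1, h2⟩; exact ⟨⟨by linarith, h2⟩, by linarith⟩
      rw [e] at hu ⊢
      exact uniqueDiffOn_Icc (by positivity) u hu
    · have e : latitudes (-1) = Icc (-(Real.pi / 2)) 0 := by
        ext x; constructor
        · rintro ⟨⟨h1, h2⟩, h3⟩; exact ⟨h1, by linarith⟩
        · rintro ⟨h1, h2⟩; exact ⟨⟨h1, by linarith⟩, by linarith⟩
      rw [e] at hu ⊢
      exact uniqueDiffOn_Icc (by linarith) u hu
  have h3 := hud.eq_deriv _ h1 h2
  rw [map_smul] at h3
  exact smul_right_injective _ (one_div_pos.2 hk).ne' h3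

/-- The horizontal Gauss map near a regular point, as a smooth function of the latitude. -/
def gaussB (lam t : ℝ) (p : Quat) : Quat :=
  (Real.cos (latB lam t p) / freq lam)⁻¹ •
    (mk (eta lam t (latB lam t p)) 0 - (lam * (Real.cos (latB lam t p) / freq lam)) • p -
      Real.sin (latB lam t p) • TL p)

theorem contDiffOn_gaussB (hlam : 0 ≤ lam) :
    ContDiffOn ℝ ∞ (gaussB lam t) (equatorNhd lam t) := by
  have hl := contDiffOn_latB (t := t) hlam
  have hr : ContDiffOn ℝ ∞ (fun p => Real.cos (latB lam t p) / freq lam) (equatorNhd lam t) :=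
    (Real.contDiff_cos.comp_contDiffOn hl).div_const _
  refine ContDiffOn.smul (hr.inv fun p hp => ?_)
    (((contDiffOn_mk (contDiff_eta.comp_contDiffOn hl) contDiffOn_const).sub
      ((contDiffOn_const.mul hr).smul contDiffOn_id)).sub
      ((Real.contDiff_sin.comp_contDiffOn hl).smul TL.contDiff.contDiffOn))
  exact (div_pos (Real.cos_pos_of_mem_Ioo (heightInv_mem hp).1) (freq_pos lam)).ne'

theorem gaussB_gP (hlam : 0 ≤ lam) (hu : u ∈ Ioo (-(Real.pi / 2)) (Real.pi / 2)) :
    gaussB lam t (gP lam t φ u) = gX lam t φ u := by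
  have hr := (div_pos (Real.cos_pos_of_mem_Ioo hu) (freq_pos lam)).ne'
  rw [gaussB, (mem_Ioo_of_gP_mem hlam (Ioo_subset_Icc_self hu) (gP_mem_equatorNhd hu)).2, TL_apply]
  have := smul_xF (η := eta lam t u) (ξ := cis (φ + ratio lam * u)) (gP_rel lam u)
  rw [inv_smul_eq_iff₀ hr]
  exact this.symm

/-- The trace is taken in the frame `Y`, `S`, where `S` is a combination of the Gauss map `X` and
`T` and contributes nothing. -/
theorem hasMeanCurvature_leaf (hlam : 0 ≤ lam) (hε : ε = 1 ∨ ε = -1) {p : Quat}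
    (hp : p ∈ leaf lam ε t) (hne : p ≠ poleP lam ε t) :
    HasMeanCurvature (leaf lam ε t) (normalField lam ε t) p lam := by
  obtain ⟨φ, u, hu, rfl⟩ := exists_gP hp
  have hpole : u ≠ ε * (Real.pi / 2) := fun h => hne ((gP_eq_poleP_iff hε hu).2 h)
  have hI := mem_Ioo_of_not_pole hε hu hpole
  have hU := gP_mem_equatorNhd (lam := lam) (t := t) (φ := φ) hI
  have hmem := (isOpen_equatorNhd hlam).mem_nhds hU
  have h1 : HasFDerivAt (gaussB lam t) (fderiv ℝ (gaussB lam t) (gP lam t φ u)) (gP lam t φ u) :=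
    (((contDiffOn_gaussB hlam).contDiffAt hmem).differentiableAt (by simp)).hasFDerivAt
  have heq : ∀ q ∈ leaf lam ε t, q ∈ equatorNhd lam t → ∃ φ' u',
      q = gP lam t φ' u' ∧ horizontalGauss (normalField lam ε t) q = gX lam t φ' u' ∧
        gaussB lam t q = gX lam t φ' u' := by
    intro q hq hqU
    obtain ⟨φ', u', hu', rfl⟩ := exists_gP hq
    have hI' := (mem_Ioo_of_gP_mem hlam hu'.1 hqU).1
    exact ⟨φ', u', rfl, horizontalGauss_gP hε hu' (not_pole_of_mem_Ioo hε hI'), gaussB_gP hlam hI'⟩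
  have h2 : HasFDerivWithinAt (horizontalGauss (normalField lam ε t))
      (fderiv ℝ (gaussB lam t) (gP lam t φ u)) (leaf lam ε t) (gP lam t φ u) := by
    refine h1.hasFDerivWithinAt.congr_of_eventuallyEq ?_ ?_
    · filter_upwards [self_mem_nhdsWithin, nhdsWithin_le_nhds hmem] with q hq hqU
      obtain ⟨φ', u', -, h3, h4⟩ := heq q hq hqU
      rw [h3, h4]
    · obtain ⟨φ', u', -, h3, h4⟩ := heq _ hp hU
      rw [h3, h4]
  refine ⟨_, h2, ?_⟩
  rw [trace_eq_sum (orthonormal_gY_gS lam t φ u) (tangentSpan_leaf_eq hlam hε hu),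
    Fin.sum_univ_two]
  simp only [Matrix.cons_val_zero, Matrix.cons_val_one]
  have h3 := deriv_gY hε hu hpole h2 ?_
  · have h4 : inner ℝ (gS lam t φ u)
        (fderiv ℝ (gaussB lam t) (gP lam t φ u) (gS lam t φ u)) = 0 := by
      have hS := gS_eq lam t φ u
      set D := (√(1 - (lam * (Real.cos u / freq lam)) ^ 2))⁻¹
      have hS' : gS lam t φ u =
          (D * Real.sin u) • horizontalGauss (normalField lam ε t) (gP lam t φ u) +
          (-(D * (Real.cos u / freq lam))) • T (gP lam t φ u) := by
        rw [hS, horizontalGauss_gP hε hu hpole]; module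
      rw [hS']
      refine inner_deriv_eq_zero hp h2 ?_ ?_ ?_ ?_
      · filter_upwards [self_mem_nhdsWithin, nhdsWithin_le_nhds hmem] with q hq hqU
        obtain ⟨φ', u', -, h3, -⟩ := heq q hq hqU
        rw [h3]; exact (gX_inner _ _ _ _).1
      · filter_upwards [self_mem_nhdsWithin, nhdsWithin_le_nhds hmem] with q hq hqU
        obtain ⟨φ', u', hq', h3, -⟩ := heq q hq hqU
        rw [h3, hq']; exact (gX_inner _ _ _ _).2.2.1
      · rw [horizontalGauss_gP hε hu hpole]; exact (gX_inner _ _ _ _).2.1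
      · rw [← hS']; exact (gY_gS_mem_tangentSpan hε hu).2
    have hY : inner ℝ (gY lam t φ u) (gY lam t φ u) = 1 := by
      rw [real_inner_self_eq_norm_sq,
        show ‖gY lam t φ u‖ = 1 from (orthonormal_gY_gS lam t φ u).1 0]
      norm_num
    rw [h4, h3, inner_sub_right, inner_smul_right, (gX_inner lam t φ u).2.2.2.1, hY]
    ring
  · have h5 : ∀ᶠ u' in 𝓝 u, u' ∈ Ioo (-(Real.pi / 2)) (Real.pi / 2) := Ioo_mem_nhds hI.1 hI.2
    filter_upwards [self_mem_nhdsWithin, nhdsWithin_le_nhds h5] with u' hu' hI'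
    exact horizontalGauss_gP hε hu' (not_pole_of_mem_Ioo hε hI')

end

/-! ### The solid tube -/

/-- The solid tube in terms of the coordinates, for all `λ ≥ 0`. -/
def tube (lam : ℝ) : Set Quat := {p | p ∈ S3 ∧ zOne p ≠ 0 ∧ freq lam * ‖zTwo p‖ ≤ 1}

/-- The nearest point of the axis is `(z₁ / |z₁|, 0)`. -/
theorem distL_eq (p : Quat) : distL p = Real.arccos ‖zOne p‖ := by
  have hin : ∀ q ∈ axisL, inner ℝ p q = (zOne p * (starRingEnd ℂ) (zOne q)).re ∧ ‖zOne q‖ = 1 := by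
    rintro q ⟨h1, h2, h3⟩
    have hz : zTwo q = 0 := Complex.ext h2 h3
    constructor
    · rw [← mk_zOne_zTwo p, ← mk_zOne_zTwo q, inner_mk, hz]; simp
    · have := mem_S3.1 h1
      rw [hz, norm_zero] at this
      nlinarith [norm_nonneg (zOne q)]
  refine IsLeast.csInf_eq ⟨?_, ?_⟩
  · obtain ⟨ζ, hζ, hz⟩ : ∃ ζ : ℂ, ‖ζ‖ = 1 ∧ (zOne p * (starRingEnd ℂ) ζ).re = ‖zOne p‖ := by
      by_cases h0 : zOne p = 0
      · exact ⟨1, by simp, by simp [h0]⟩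
      · have hn : ‖zOne p‖ ≠ 0 := norm_ne_zero_iff.2 h0
        have hnc : (‖zOne p‖ : ℂ) ≠ 0 := by exact_mod_cast hn
        refine ⟨zOne p / ‖zOne p‖, by simp [h0], ?_⟩
        rw [map_div₀, Complex.conj_ofReal, mul_div_assoc', Complex.mul_conj,
          Complex.normSq_eq_norm_sq, ← Complex.ofReal_div, Complex.ofReal_re]
        field_simp
    have hq : mk ζ 0 ∈ axisL := ⟨mem_S3.2 (by simp [hζ]), rfl, rfl⟩
    refine ⟨mk ζ 0, hq, ?_⟩
    rw [sphereDist, (hin _ hq).1, zOne_mk, hz]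
  · rintro _ ⟨q, hq, rfl⟩
    rw [sphereDist, (hin q hq).1]
    refine Real.arccos_le_arccos ?_
    calc _ ≤ ‖zOne p * (starRingEnd ℂ) (zOne q)‖ := Complex.re_le_norm _
      _ = ‖zOne p‖ := by rw [norm_mul, Complex.norm_conj, (hin q hq).2, mul_one]

/-- For `λ > 0`, the cosine of `arctan (1 / λ)` is `λ / κ`, and `|z₁| ≥ λ / κ` means `κ|z₂| ≤ 1`. -/
theorem solidTube_eq {lam : ℝ} (hlam : 0 ≤ lam) : solidTube lam = tube lam := by
  have hk := freq_pos lam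
  have hk2 := freq_sq lam
  ext p
  rcases hlam.eq_or_lt with rfl | hpos
  · rw [solidTube, if_pos rfl]
    have hk1 : freq 0 = 1 := by simp [freq]
    constructor
    · rintro ⟨h1, h2⟩
      refine ⟨h1, fun h => h2 ⟨h1, congrArg Complex.re h, congrArg Complex.im h⟩, ?_⟩
      rw [hk1, one_mul]
      nlinarith [mem_S3.1 h1, sq_nonneg ‖zOne p‖, norm_nonneg (zTwo p)]
    · rintro ⟨h1, h2, -⟩
      exact ⟨h1, fun h => h2 (Complex.ext h.2.1 h.2.2)⟩
  · rw [solidTube, if_neg hpos.ne', mem_ofPred_eq, tube, mem_ofPred_eq]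
    refine and_congr_right fun hp => ?_
    have hS := mem_S3.1 hp
    have h1 : (√(1 + (1 / lam) ^ 2))⁻¹ = lam / freq lam := by
      have h2 : 1 + (1 / lam) ^ 2 = (freq lam / lam) ^ 2 := by
        rw [div_pow, div_pow, hk2]; field_simp; ring
      rw [h2, Real.sqrt_sq (div_pos hk hpos).le, inv_div]
    have hle : lam / freq lam ≤ 1 := by
      rw [div_le_one hk]; nlinarith
    have h0 : 0 < lam / freq lam := div_pos hpos hk
    have hz1 : ‖zOne p‖ ≤ 1 := by nlinarith [sq_nonneg ‖zTwo p‖, norm_nonneg (zOne p)]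
    rw [distL_eq p, Real.arctan_eq_arccos (one_div_pos.2 hpos).le, h1,
      Real.strictAntiOn_arccos.le_iff_ge ⟨by linarith [norm_nonneg (zOne p)], hz1⟩
        ⟨by linarith, hle⟩, div_le_iff₀ hk]
    have hz2 : 0 ≤ freq lam * ‖zTwo p‖ := mul_nonneg hk.le (norm_nonneg _)
    have key : (‖zOne p‖ * freq lam) ^ 2 - lam ^ 2 = 1 - (freq lam * ‖zTwo p‖) ^ 2 := by
      linear_combination freq lam ^ 2 * hS + hk2
    constructor
    · intro h
      refine ⟨fun h' => ?_, ?_⟩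
      · rw [h', norm_zero, zero_mul] at h; linarith
      · nlinarith
    · rintro ⟨-, h⟩
      have : 0 ≤ ‖zOne p‖ * freq lam := mul_nonneg (norm_nonneg _) hk.le
      nlinarith

section

variable {lam ε t : ℝ}

theorem norm_zTwo_lt_one {p : Quat} (hp : p ∈ S3) : zOne p ≠ 0 ↔ ‖zTwo p‖ < 1 := by
  have h := mem_S3.1 hp
  constructor
  · intro h0
    have := norm_pos_iff.2 h0
    nlinarith [norm_nonneg (zTwo p)]
  · rintro h1 h0
    rw [h0, norm_zero] at h
    nlinarith [norm_nonneg (zTwo p)]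

/-- At an interior point of the tube, `κ|z₂| < 1`. -/
theorem lt_of_mem_relInterior {p : Quat} (hp : p ∈ relInterior (tube lam)) :
    p ∈ tube lam ∧ freq lam * ‖zTwo p‖ < 1 := by
  obtain ⟨hpS, hW⟩ := hp
  have hpt : p ∈ tube lam := mem_of_mem_nhdsWithin hpS hW
  refine ⟨hpt, lt_of_le_of_ne hpt.2.2 fun heq => ?_⟩
  have hk := freq_pos lam
  have hr0 : 0 < ‖zTwo p‖ := by
    rcases (norm_nonneg (zTwo p)).eq_or_lt with h | h
    · rw [← h, mul_zero] at heq; exact absurd heq zero_ne_one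
    · exact h
  have hz1 : 0 < ‖zOne p‖ := norm_pos_iff.2 hpt.2.1
  have hS := mem_S3.1 hpS
  -- Scaling `z₂` by `c > 1` inside the sphere leaves the tube.
  let c : ℝ → Quat := fun s =>
    mk (((√(1 - s ^ 2 * ‖zTwo p‖ ^ 2) / ‖zOne p‖ : ℝ) : ℂ) * zOne p) ((s : ℂ) * zTwo p)
  have hc1 : c 1 = p := by
    have : 1 - 1 ^ 2 * ‖zTwo p‖ ^ 2 = ‖zOne p‖ ^ 2 := by linarith
    apply quat_ext
    · simp only [c, zOne_mk]
      rw [this, Real.sqrt_sq hz1.le, div_self hz1.ne', Complex.ofReal_one, one_mul]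
    · simp [c]
  have hcc : Continuous c := by
    have h1 : Continuous fun s : ℝ => (((√(1 - s ^ 2 * ‖zTwo p‖ ^ 2) / ‖zOne p‖ : ℝ) : ℂ) * zOne p,
      (s : ℂ) * zTwo p) := by fun_prop
    exact mkL.continuous.comp h1
  have hcS : ∀ᶠ s in 𝓝 (1 : ℝ), c s ∈ S3 := by
    have h1 : ∀ᶠ s in 𝓝 (1 : ℝ), 0 < 1 - s ^ 2 * ‖zTwo p‖ ^ 2 := by
      have hcont : ContinuousAt (fun s : ℝ => 1 - s ^ 2 * ‖zTwo p‖ ^ 2) 1 := by fun_prop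
      refine hcont.eventually (lt_mem_nhds ?_)
      nlinarith
    filter_upwards [h1] with s hs
    rw [mem_S3]
    simp only [c, zOne_mk, zTwo_mk, norm_mul, Complex.norm_real, norm_div,
      Real.norm_eq_abs, abs_of_nonneg (Real.sqrt_nonneg _)]
    rw [abs_of_pos hz1, div_mul_cancel₀ _ hz1.ne', Real.sq_sqrt hs.le, mul_pow, sq_abs]
    ring
  have h2 : Tendsto c (𝓝 1) (𝓝[S3] p) :=
    tendsto_nhdsWithin_iff.2 ⟨by simpa [hc1] using hcc.tendsto 1, hcS⟩
  have h3 : ∀ᶠ s in 𝓝 (1 : ℝ), c s ∈ tube lam := h2.eventually hW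
  have h3' : ∀ᶠ s in 𝓝[>] (1 : ℝ), c s ∈ tube lam := nhdsWithin_le_nhds h3
  obtain ⟨s, hs1, hs2⟩ := (h3'.and self_mem_nhdsWithin).exists
  have h4 := hs1.2.2
  simp only [c, zTwo_mk, norm_mul, Complex.norm_real, Real.norm_eq_abs] at h4
  have hs : (1 : ℝ) < s := hs2
  rw [abs_of_pos (by linarith)] at h4
  nlinarith [mul_pos hk hr0]

/-! ### The partition into leaves -/

/-- The part of a leaf off the circle `C₀`. -/
def leafT (lam ε t : ℝ) : Set Quat := {p | p ∈ leaf lam ε t ∧ zOne p ≠ 0}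

theorem leafT_subset_tube (hε : ε = 1 ∨ ε = -1) : leafT lam ε t ⊆ tube lam := fun _ hp =>
  ⟨hp.1.1, hp.2, ((mem_leaf_iff hε).1 hp.1).2.1⟩

theorem norm_psi_eq (hε : ε = 1 ∨ ε = -1) {q : Quat} (hq : q ∈ tube lam) :
    ‖psi lam ε ‖zTwo q‖‖ = ‖zOne q‖ := by
  have h1 := norm_psi_sq hε (norm_nonneg (zTwo q)) hq.2.2
  have h2 := mem_S3.1 hq.1
  rw [← abs_of_nonneg (norm_nonneg (zOne q)), ← abs_of_nonneg (norm_nonneg (psi _ _ _))]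
  exact (sq_eq_sq_iff_abs_eq_abs _ _).1 (by linarith)

theorem leafPhase_ne_zero (hε : ε = 1 ∨ ε = -1) {q : Quat} (hq : q ∈ tube lam) :
    leafPhase lam ε q ≠ 0 := by
  refine mul_ne_zero hq.2.1 ?_
  have h := norm_psi_eq hε hq
  have h1 := norm_pos_iff.2 hq.2.1
  rw [← h, norm_pos_iff] at h1
  simpa using h1

/-- The leaf through a point of the tube is determined by the argument of the phase. -/
theorem mem_leafT_iff_phase (hε : ε = 1 ∨ ε = -1) {q : Quat} (hq : q ∈ tube lam) :
    q ∈ leafT lam ε t ↔ leafPhase lam ε q = ‖leafPhase lam ε q‖ * cis t := by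
  have hn := norm_psi_eq hε hq
  have h0 := norm_pos_iff.2 hq.2.1
  have hphn : ‖leafPhase lam ε q‖ = ‖psi lam ε ‖zTwo q‖‖ ^ 2 := by
    rw [leafPhase, norm_mul, Complex.norm_conj, hn, sq]
  rw [hphn, leafPhase]
  set ψ := psi lam ε ‖zTwo q‖ with hψ
  have hψ0 : (starRingEnd ℂ) ψ ≠ 0 := by
    rw [← hn, norm_pos_iff] at h0; simpa using h0
  have e : ((‖ψ‖ ^ 2 : ℝ) : ℂ) * cis t = cis t * ψ * (starRingEnd ℂ) ψ := by
    rw [mul_assoc, Complex.mul_conj, Complex.normSq_eq_norm_sq, mul_comm]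
  rw [e, mul_left_inj' hψ0]
  constructor
  · rintro ⟨h, -⟩
    exact ((mem_leaf_iff hε).1 h).2.2
  · intro h
    exact ⟨(mem_leaf_iff hε).2 ⟨hq.1, hq.2.2, h⟩, hq.2.1⟩

theorem exists_leafT (hε : ε = 1 ∨ ε = -1) {q : Quat} (hq : q ∈ tube lam) :
    ∃ t ∈ Ico (0 : ℝ) (2 * Real.pi), q ∈ leafT lam ε t := by
  have h0 := norm_ne_zero_iff.2 (leafPhase_ne_zero hε hq)
  have h0c : (‖leafPhase lam ε q‖ : ℂ) ≠ 0 := by exact_mod_cast h0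
  obtain ⟨t, ht, h⟩ := exists_cis (leafPhase lam ε q / ‖leafPhase lam ε q‖) (by
    rw [norm_div, Complex.norm_real, norm_norm, div_self h0])
  refine ⟨t, ht, (mem_leafT_iff_phase hε hq).2 ?_⟩
  rw [← h]; field_simp

theorem leafT_eq_of_mem (hε : ε = 1 ∨ ε = -1) {q : Quat} {s t : ℝ}
    (hs : s ∈ Ico (0 : ℝ) (2 * Real.pi)) (ht : t ∈ Ico (0 : ℝ) (2 * Real.pi))
    (h1 : q ∈ leafT lam ε s) (h2 : q ∈ leafT lam ε t) : s = t := by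
  have hq := leafT_subset_tube hε h1
  have h0 : (‖leafPhase lam ε q‖ : ℂ) ≠ 0 := by
    exact_mod_cast norm_ne_zero_iff.2 (leafPhase_ne_zero hε hq)
  rw [mem_leafT_iff_phase hε hq] at h1 h2
  exact cis_injOn hs ht (mul_left_cancel₀ h0 (h1.symm.trans h2))

theorem imDivRe_smul {x : ℝ} (hx : x ≠ 0) (z : ℂ) : imDivRe (x * z) = imDivRe z := by
  rw [imDivRe, imDivRe, Complex.re_ofReal_mul, Complex.im_ofReal_mul, mul_div_mul_left _ _ hx]

/-- The leaves of the tube, with parameter in `[0, 2π)`. -/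
abbrev leaves (lam ε : ℝ) : Ico (0 : ℝ) (2 * Real.pi) → Set Quat := fun t => leafT lam ε t

/-- On a half-plane of phases, the leaf through a point is determined by the slope of the phase. -/
theorem sameLeaf_iff (hε : ε = 1 ∨ ε = -1) {q q' : Quat} (hq : q ∈ tube lam) (hq' : q' ∈ tube lam)
    (h : 0 < (cis (-t) * leafPhase lam ε q).re) (h' : 0 < (cis (-t) * leafPhase lam ε q').re) :
    SameLeaf (leaves lam ε) q q' ↔
      imDivRe (cis (-t) * leafPhase lam ε q) = imDivRe (cis (-t) * leafPhase lam ε q') := by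
  have h0 := norm_ne_zero_iff.2 (leafPhase_ne_zero hε hq)
  have h0' := norm_ne_zero_iff.2 (leafPhase_ne_zero hε hq')
  constructor
  · rintro ⟨s, h1, h2⟩
    rw [mem_leafT_iff_phase hε hq] at h1
    rw [mem_leafT_iff_phase hε hq'] at h2
    rw [h1, h2, mul_left_comm, mul_left_comm (cis (-t)), imDivRe_smul h0, imDivRe_smul h0']
  · intro hs
    obtain ⟨s, hsI, h1⟩ := exists_leafT hε hq
    refine ⟨⟨s, hsI⟩, h1, ?_⟩
    rw [mem_leafT_iff_phase hε hq] at h1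
    rw [mem_leafT_iff_phase hε hq']
    set A := cis (-t) * leafPhase lam ε q with hA
    set B := cis (-t) * leafPhase lam ε q' with hB
    have hc : 0 < B.re / A.re := div_pos h' h
    have hBA : B = ((B.re / A.re : ℝ) : ℂ) * A := by
      rw [imDivRe, imDivRe, div_eq_div_iff h.ne' h'.ne'] at hs
      apply Complex.ext
      · rw [Complex.re_ofReal_mul]; field_simp
      · rw [Complex.im_ofReal_mul]; field_simp; linarith
    have h3 : leafPhase lam ε q' = ((B.re / A.re : ℝ) : ℂ) * leafPhase lam ε q := by
      refine mul_left_cancel₀ (cis_ne_zero (-t)) ?_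
      rw [mul_left_comm, ← hA, ← hBA]
    rw [h3, norm_mul, Complex.norm_real, Real.norm_of_nonneg hc.le]
    conv_lhs => rw [h1]
    push_cast; ring

theorem isConnected_leafT (hε : ε = 1 ∨ ε = -1) (t : ℝ) : IsConnected (leafT lam ε t) := by
  have hk := freq_pos lam
  have h1 : leafT lam ε t = (fun z : ℂ => mk (cis t * psi lam ε ‖z‖) z) ''
      (Metric.closedBall 0 (1 / freq lam) ∩ Metric.ball 0 1) := by
    ext p
    constructor
    · rintro ⟨hp, h0⟩
      have h2 := (mem_leaf_iff hε).1 hp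
      refine ⟨zTwo p, ⟨?_, ?_⟩, ?_⟩
      · rw [mem_closedBall_zero_iff, le_div_iff₀ hk]; linarith [h2.2.1]
      · rw [mem_ball_zero_iff]; exact (norm_zTwo_lt_one hp.1).1 h0
      · simp only; rw [← h2.2.2]; rfl
    · rintro ⟨z, ⟨hz1, hz2⟩, rfl⟩
      rw [mem_closedBall_zero_iff, le_div_iff₀ hk] at hz1
      rw [mem_ball_zero_iff] at hz2
      have hz3 : freq lam * ‖z‖ ≤ 1 := by linarith
      have hS : mk (cis t * psi lam ε ‖z‖) z ∈ S3 := by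
        rw [mem_S3, zOne_mk, zTwo_mk, norm_mul, norm_cis, one_mul,
          norm_psi_sq hε (norm_nonneg z) hz3]; ring
      exact ⟨(mem_leaf_iff hε).2 ⟨hS, hz3, rfl⟩, (norm_zTwo_lt_one hS).2 hz2⟩
  -- The leaf off `C₀` is the graph of a continuous function over a convex set.
  rw [h1]
  refine IsConnected.image ⟨⟨0, ?_⟩, ?_⟩ _ (Continuous.continuousOn ?_)
  · simp [hk.le]
  · exact ((convex_closedBall _ _).inter (convex_ball _ _)).isPreconnected
  · exact mkL.continuous.comp ((continuous_const.mul (continuous_psi.comp continuous_norm)).prodMk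
      continuous_id)

theorem isSurface_leafT (hlam : 0 ≤ lam) (hε : ε = 1 ∨ ε = -1) (t : ℝ) :
    IsSurface 2 (leafT lam ε t) :=
  (isSurface_leaf hlam hε t).diff_closed (isClosed_eq zOne.continuous continuous_const)

/-! ### Foliated charts -/

/-- The Cayley transform, which maps the closed unit disc without the point `1` onto the closed
right half-plane. -/
def cayley (w : ℂ) : ℂ := (1 + w) / (1 - w)

/-- The inverse of the Cayley transform. -/
def cayleyInv (m : ℂ) : ℂ := (m - 1) / (m + 1)

theorem cayley_re_nonneg {w : ℂ} (hw : ‖w‖ ≤ 1) : 0 ≤ (cayley w).re := by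
  rw [cayley, Complex.div_re, ← add_div]
  refine div_nonneg ?_ (Complex.normSq_nonneg _)
  have h : w.re * w.re + w.im * w.im ≤ 1 := by
    rw [← Complex.normSq_apply, Complex.normSq_eq_norm_sq]; nlinarith [norm_nonneg w]
  simp; nlinarith

theorem add_one_ne_zero_of_re {m : ℂ} (hm : 0 ≤ m.re) : m + 1 ≠ 0 := fun h => by
  have := congrArg Complex.re h
  simp at this; linarith

theorem norm_cayleyInv_le {m : ℂ} (hm : 0 ≤ m.re) : ‖cayleyInv m‖ ≤ 1 := by
  have h0 := norm_pos_iff.2 (add_one_ne_zero_of_re hm)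
  rw [cayleyInv, norm_div, div_le_one h0]
  have h1 : ‖m - 1‖ ^ 2 ≤ ‖m + 1‖ ^ 2 := by
    rw [← Complex.normSq_eq_norm_sq, ← Complex.normSq_eq_norm_sq, Complex.normSq_apply,
      Complex.normSq_apply]
    simp; nlinarith
  exact (sq_le_sq₀ (norm_nonneg _) h0.le).1 h1

theorem cayleyInv_cayley {w : ℂ} (hw : w ≠ 1) : cayleyInv (cayley w) = w := by
  have h : 1 - w ≠ 0 := sub_ne_zero.2 hw.symm
  have h2 : (1 + w) / (1 - w) + 1 = 2 / (1 - w) := by field_simp; ring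
  rw [cayleyInv, cayley, h2]
  field_simp; ring

theorem cayley_cayleyInv {m : ℂ} (hm : 0 ≤ m.re) :
    cayley (cayleyInv m) = m ∧ cayleyInv m ≠ 1 := by
  have h := add_one_ne_zero_of_re hm
  have h2 : 1 - (m - 1) / (m + 1) = 2 / (m + 1) := by field_simp; ring
  constructor
  · rw [cayley, cayleyInv, h2]; field_simp; ring
  · intro h3
    rw [cayleyInv] at h3
    rw [h3, sub_self] at h2
    have : (2 : ℂ) / (m + 1) ≠ 0 := div_ne_zero two_ne_zero h
    exact this h2.symm

/-- The unit complex number with positive real part and prescribed slope. -/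
def unitOfSlope (x : ℝ) : ℂ := (((√(1 + x ^ 2))⁻¹ : ℝ) : ℂ) * ⟨1, x⟩

theorem sqrt_one_add_sq_pos (x : ℝ) : 0 < √(1 + x ^ 2) := Real.sqrt_pos.2 (by positivity)

theorem norm_unitOfSlope (x : ℝ) : ‖unitOfSlope x‖ = 1 := by
  have h0 := sqrt_one_add_sq_pos x
  have h1 : ‖(⟨1, x⟩ : ℂ)‖ = √(1 + x ^ 2) := by
    rw [Complex.norm_def, Complex.normSq_apply]; congr 1; ring
  rw [unitOfSlope, norm_mul, h1, Complex.norm_real, Real.norm_of_nonneg (inv_pos.2 h0).le,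
    inv_mul_cancel₀ h0.ne']

theorem unitOfSlope_re (x : ℝ) : (unitOfSlope x).re = (√(1 + x ^ 2))⁻¹ := by
  rw [unitOfSlope, Complex.re_ofReal_mul, mul_one]

theorem imDivRe_unitOfSlope (x : ℝ) : imDivRe (unitOfSlope x) = x := by
  rw [unitOfSlope, imDivRe_smul (inv_pos.2 (sqrt_one_add_sq_pos x)).ne', imDivRe, div_one]

theorem continuous_unitOfSlope : Continuous unitOfSlope := by
  have h : unitOfSlope = fun x : ℝ => (((√(1 + x ^ 2))⁻¹ : ℝ) : ℂ) * (1 + x * Complex.I) := by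
    funext x; rw [unitOfSlope]; congr 1; apply Complex.ext <;> simp
  rw [h]
  refine Continuous.mul (Complex.continuous_ofReal.comp
    (Continuous.inv₀ (by fun_prop) fun x => (sqrt_one_add_sq_pos x).ne')) (by fun_prop)

theorem unitOfSlope_imDivRe {z : ℂ} (hz : 0 < z.re) : (‖z‖ : ℂ) * unitOfSlope (imDivRe z) = z := by
  have h1 : √(1 + (imDivRe z) ^ 2) = ‖z‖ / z.re := by
    rw [imDivRe, Complex.norm_def, Complex.normSq_apply, ← Real.sqrt_sq hz.le,
      ← Real.sqrt_div' _ (by positivity), Real.sqrt_sq hz.le]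
    congr 1; field_simp
  have hn : ‖z‖ ≠ 0 := norm_ne_zero_iff.2 fun h => by simp [h] at hz
  rw [unitOfSlope, h1, inv_div, ← mul_assoc, ← Complex.ofReal_mul, mul_div_cancel₀ _ hn]
  apply Complex.ext
  · rw [Complex.re_ofReal_mul, mul_one]
  · rw [Complex.im_ofReal_mul, imDivRe]; field_simp

/-- The point of the half-plane with given complex coordinate. -/
def halfPt (m : ℂ) (hm : 0 ≤ m.re) : EuclideanHalfSpace 2 := ⟨!₂[m.re, m.im], hm⟩

/-- The complex coordinate of a point of the half-plane. -/
def halfCoord (x : EuclideanHalfSpace 2) : ℂ := ⟨x.1 0, x.1 1⟩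

theorem halfCoord_re (x : EuclideanHalfSpace 2) : 0 ≤ (halfCoord x).re := x.2

theorem halfCoord_halfPt (m : ℂ) (hm : 0 ≤ m.re) : halfCoord (halfPt m hm) = m := by
  apply Complex.ext <;> simp [halfCoord, halfPt]

theorem halfPt_halfCoord (x : EuclideanHalfSpace 2) (m : ℂ) (hm : 0 ≤ m.re)
    (h : m = halfCoord x) : halfPt m hm = x := by
  subst h
  apply Subtype.ext
  ext i
  fin_cases i <;> simp [halfPt, halfCoord]

theorem continuous_halfCoord : Continuous halfCoord := by
  have h : halfCoord = fun x : EuclideanHalfSpace 2 => (x.1 0 : ℂ) + (x.1 1 : ℂ) * Complex.I := by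
    funext x; apply Complex.ext <;> simp [halfCoord]
  rw [h]
  have h1 : ∀ i, Continuous fun x : EuclideanHalfSpace 2 => x.1 i := fun i => by
    have : Continuous fun x : EuclideanHalfSpace 2 => x.1 := continuous_subtype_val
    fun_prop
  exact (Complex.continuous_ofReal.comp (h1 0)).add
    ((Complex.continuous_ofReal.comp (h1 1)).mul continuous_const)

/-- The inverse of a foliated chart. -/
def chartInv (lam ε sg t : ℝ) (y : EuclideanHalfSpace 2 × ℝ) : Quat :=
  mk (cis t * unitOfSlope y.2 * psi lam ε ‖((sg / freq lam : ℝ) : ℂ) * cayleyInv (halfCoord y.1)‖)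
    (((sg / freq lam : ℝ) : ℂ) * cayleyInv (halfCoord y.1))

theorem continuous_chartInv (lam ε sg t : ℝ) : Continuous (chartInv lam ε sg t) := by
  have h1 : Continuous fun y : EuclideanHalfSpace 2 × ℝ =>
      ((sg / freq lam : ℝ) : ℂ) * cayleyInv (halfCoord y.1) := by
    have h2 : Continuous fun y : EuclideanHalfSpace 2 × ℝ => halfCoord y.1 :=
      continuous_halfCoord.comp continuous_fst
    exact continuous_const.mul ((h2.sub continuous_const).div (h2.add continuous_const)
      fun y => add_one_ne_zero_of_re (halfCoord_re y.1))
  exact mkL.continuous.comp (((continuous_const.mul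
    (continuous_unitOfSlope.comp continuous_snd)).mul
      (continuous_psi.comp (continuous_norm.comp h1))).prodMk h1)

theorem chartInv_norm {sg : ℝ} (hsg : sg = 1 ∨ sg = -1) (y : EuclideanHalfSpace 2 × ℝ) :
    freq lam * ‖zTwo (chartInv lam ε sg t y)‖ ≤ 1 := by
  have hk := freq_pos lam
  have h := norm_cayleyInv_le (halfCoord_re y.1)
  have hsg1 : |sg| = 1 := by rcases hsg with rfl | rfl <;> simp
  rw [chartInv, zTwo_mk, norm_mul, Complex.norm_real, Real.norm_eq_abs, abs_div, hsg1,
    abs_of_pos hk]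
  field_simp
  exact h

theorem chartInv_mem_S3 (hε : ε = 1 ∨ ε = -1) {sg : ℝ} (hsg : sg = 1 ∨ sg = -1)
    (y : EuclideanHalfSpace 2 × ℝ) : chartInv lam ε sg t y ∈ S3 := by
  have h := chartInv_norm (lam := lam) (ε := ε) (t := t) hsg y
  rw [chartInv, zTwo_mk] at h
  rw [mem_S3, chartInv, zOne_mk, zTwo_mk, norm_mul, norm_mul, norm_cis, norm_unitOfSlope, one_mul,
    one_mul, norm_psi_sq hε (norm_nonneg _) h]
  ring

theorem leafPhase_chartInv (sg : ℝ) (y : EuclideanHalfSpace 2 × ℝ) :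
    cis (-t) * leafPhase lam ε (chartInv lam ε sg t y) =
      ((‖psi lam ε ‖zTwo (chartInv lam ε sg t y)‖‖ ^ 2 : ℝ) : ℂ) * unitOfSlope y.2 := by
  have h1 : zOne (chartInv lam ε sg t y) =
      cis t * unitOfSlope y.2 * psi lam ε ‖zTwo (chartInv lam ε sg t y)‖ := rfl
  rw [leafPhase, h1, mul_assoc (cis t * _), Complex.mul_conj, Complex.normSq_eq_norm_sq,
    ← mul_assoc, ← mul_assoc, cis_neg_mul, one_mul, mul_comm]

/-- The disc coordinate used in the foliated charts. -/
def discCoord (lam sg : ℝ) (q : Quat) : ℂ := ((freq lam * sg : ℝ) : ℂ) * zTwo q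

theorem norm_discCoord {sg : ℝ} (hsg : sg = 1 ∨ sg = -1) {q : Quat} (hq : q ∈ tube lam) :
    ‖discCoord lam sg q‖ ≤ 1 := by
  have hsg1 : |sg| = 1 := by rcases hsg with rfl | rfl <;> simp
  rw [discCoord, norm_mul, Complex.norm_real, Real.norm_eq_abs, abs_mul, hsg1, mul_one,
    abs_of_pos (freq_pos lam)]
  exact hq.2.2

theorem div_mul_discCoord {sg : ℝ} (hsg : sg = 1 ∨ sg = -1) (z : ℂ) :
    ((sg / freq lam : ℝ) : ℂ) * (((freq lam * sg : ℝ) : ℂ) * z) = z := by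
  rw [← mul_assoc, ← Complex.ofReal_mul]
  have hk := (freq_pos lam).ne'
  have : sg / freq lam * (freq lam * sg) = 1 := by
    rcases hsg with rfl | rfl <;> field_simp
  rw [this, Complex.ofReal_one, one_mul]

/-- The foliated charts: the slope of the phase singles out the leaf, and the point on the leaf is
given by the Cayley transform of `κ z₂` or of `-κ z₂`. -/
theorem exists_chart (hε : ε = 1 ∨ ε = -1) (p : tube lam) :
    ∃ e : OpenPartialHomeomorph (tube lam) (EuclideanHalfSpace 2 × ℝ), p ∈ e.source ∧
      ∀ q ∈ e.source, ∀ q' ∈ e.source,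
        (SameLeaf (leaves lam ε) (q : Quat) (q' : Quat) ↔ (e q).2 = (e q').2) := by
  classical
  -- A sign `sg` for which the chart of the disc is defined at `p`.
  obtain ⟨sg, hsg, hsgp⟩ : ∃ sg : ℝ, (sg = 1 ∨ sg = -1) ∧ discCoord lam sg p ≠ 1 := by
    by_cases h : discCoord lam 1 p = 1
    · refine ⟨-1, Or.inr rfl, fun h' => ?_⟩
      have h2 : discCoord lam (-1) p = -discCoord lam 1 p := by simp [discCoord]
      rw [h2, h] at h'
      norm_num at h'
    · exact ⟨1, Or.inl rfl, h⟩
  obtain ⟨t, -, ht⟩ := exists_leafT hε p.2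
  have htp : 0 < (cis (-t) * leafPhase lam ε p).re := by
    rw [(mem_leafT_iff_phase hε p.2).1 ht, mul_left_comm, cis_neg_mul, mul_one, Complex.ofReal_re]
    exact norm_pos_iff.2 (leafPhase_ne_zero hε p.2)
  have hcont1 : Continuous fun q : tube lam => discCoord lam sg q :=
    continuous_const.mul (zTwo.continuous.comp continuous_subtype_val)
  have hcont2 : Continuous fun q : tube lam => cis (-t) * leafPhase lam ε q :=
    continuous_const.mul (continuous_leafPhase.comp continuous_subtype_val)
  let e : OpenPartialHomeomorph (tube lam) (EuclideanHalfSpace 2 × ℝ) :=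
    { toFun := fun q => (halfPt (cayley (discCoord lam sg q))
        (cayley_re_nonneg (norm_discCoord hsg q.2)), imDivRe (cis (-t) * leafPhase lam ε q))
      invFun := fun y => if h : zOne (chartInv lam ε sg t y) ≠ 0 then
        ⟨chartInv lam ε sg t y, chartInv_mem_S3 hε hsg y, h, chartInv_norm hsg y⟩ else p
      source := {q | discCoord lam sg q ≠ 1 ∧ 0 < (cis (-t) * leafPhase lam ε q).re}
      target := {y | zOne (chartInv lam ε sg t y) ≠ 0}
      map_source' := by
        rintro q ⟨h1, h2⟩
        simp only [mem_ofPred_eq, chartInv, zOne_mk, halfCoord_halfPt]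
        rw [cayleyInv_cayley h1, discCoord, div_mul_discCoord hsg]
        refine mul_ne_zero (mul_ne_zero (cis_ne_zero _) ?_) ?_
        · rw [← norm_ne_zero_iff, norm_unitOfSlope]; exact one_ne_zero
        · rw [← norm_ne_zero_iff, norm_psi_eq hε q.2]; exact norm_ne_zero_iff.2 q.2.2.1
      map_target' := by
        intro y hy
        have hy' : zOne (chartInv lam ε sg t y) ≠ 0 := hy
        simp only [hy', ne_eq, not_false_eq_true, dif_pos, mem_ofPred_eq]
        constructor
        · have h1 : discCoord lam sg (chartInv lam ε sg t y) = cayleyInv (halfCoord y.1) := by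
            rw [discCoord, chartInv, zTwo_mk, mul_left_comm]
            exact div_mul_discCoord hsg _
          rw [h1]
          exact (cayley_cayleyInv (halfCoord_re y.1)).2
        · rw [leafPhase_chartInv, Complex.re_ofReal_mul, unitOfSlope_re]
          have h1 := norm_psi_eq hε (q := chartInv lam ε sg t y)
            ⟨chartInv_mem_S3 hε hsg y, hy', chartInv_norm hsg y⟩
          rw [h1]
          have := norm_pos_iff.2 hy'
          have := sqrt_one_add_sq_pos y.2
          positivity
      left_inv' := by
        rintro q ⟨h1, h2⟩
        have h3 : chartInv lam ε sg t (halfPt (cayley (discCoord lam sg q))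
            (cayley_re_nonneg (norm_discCoord hsg q.2)),
            imDivRe (cis (-t) * leafPhase lam ε q)) = q := by
          have h5 := unitOfSlope_imDivRe h2
          simp only [chartInv, halfCoord_halfPt]
          rw [cayleyInv_cayley h1, discCoord, div_mul_discCoord hsg]
          refine quat_ext ?_ rfl
          rw [zOne_mk]
          have hn := norm_psi_eq hε q.2
          have h0 := norm_ne_zero_iff.2 q.2.2.1
          have hnn : ‖cis (-t) * leafPhase lam ε q‖ = ‖zOne (q : Quat)‖ ^ 2 := by
            rw [norm_mul, norm_cis, one_mul, leafPhase, norm_mul, Complex.norm_conj, hn, sq]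
          rw [hnn] at h5
          have h6 : (((‖zOne (q : Quat)‖ ^ 2 : ℝ)) : ℂ) ≠ 0 := by
            exact_mod_cast pow_ne_zero 2 h0
          refine mul_left_cancel₀ h6 ?_
          calc _ = cis t * ((((‖zOne (q : Quat)‖ ^ 2 : ℝ)) : ℂ) *
                unitOfSlope (imDivRe (cis (-t) * leafPhase lam ε q))) *
                psi lam ε ‖zTwo (q : Quat)‖ := by ring
            _ = _ := by
              rw [h5, ← mul_assoc (cis t), cis_mul_neg, one_mul, leafPhase, mul_assoc,
                mul_comm ((starRingEnd ℂ) _), Complex.mul_conj, Complex.normSq_eq_norm_sq, hn,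
                mul_comm]
        have h4 : zOne (q : Quat) ≠ 0 := q.2.2.1
        apply Subtype.ext
        simp only [h3, h4, ne_eq, not_false_eq_true, dif_pos]
      right_inv' := by
        intro y hy
        have hy' : zOne (chartInv lam ε sg t y) ≠ 0 := hy
        simp only [hy', ne_eq, not_false_eq_true, dif_pos]
        have h1 : discCoord lam sg (chartInv lam ε sg t y) = cayleyInv (halfCoord y.1) := by
          rw [discCoord, chartInv, zTwo_mk, mul_left_comm]
          exact div_mul_discCoord hsg _
        refine Prod.ext ?_ ?_
        · refine halfPt_halfCoord _ _ _ ?_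
          rw [h1, (cayley_cayleyInv (halfCoord_re y.1)).1]
        · simp only
          rw [leafPhase_chartInv, imDivRe_smul, imDivRe_unitOfSlope]
          rw [norm_psi_eq hε (q := chartInv lam ε sg t y)
            ⟨chartInv_mem_S3 hε hsg y, hy', chartInv_norm hsg y⟩]
          exact pow_ne_zero 2 (norm_ne_zero_iff.2 hy')
      open_source := by
        refine IsOpen.inter (s := {q : tube lam | discCoord lam sg q ≠ 1}) ?_ ?_
        · exact isOpen_ne_fun hcont1 continuous_const
        · exact isOpen_lt continuous_const (Complex.continuous_re.comp hcont2)
      open_target :=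
        isOpen_ne_fun (zOne.continuous.comp (continuous_chartInv _ _ _ _)) continuous_const
      continuousOn_toFun := by
        refine ContinuousOn.prodMk ?_ ?_
        · have hind : Topology.IsInducing
              (Subtype.val : EuclideanHalfSpace 2 → EuclideanSpace ℝ (Fin 2)) :=
            Topology.IsInducing.subtypeVal
          rw [hind.continuousOn_iff]
          have h1 : ContinuousOn (fun q : tube lam => cayley (discCoord lam sg q))
              {q | discCoord lam sg q ≠ 1 ∧ 0 < (cis (-t) * leafPhase lam ε q).re} :=
            (continuousOn_const.add hcont1.continuousOn).div
              (continuousOn_const.sub hcont1.continuousOn)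
              fun q hq => sub_ne_zero.2 (Ne.symm hq.1)
          refine (PiLp.continuous_toLp 2 _).comp_continuousOn (continuousOn_pi.2 fun i => ?_)
          fin_cases i
          · exact Complex.continuous_re.comp_continuousOn h1
          · exact Complex.continuous_im.comp_continuousOn h1
        · exact (Complex.continuous_im.comp hcont2).continuousOn.div
            (Complex.continuous_re.comp hcont2).continuousOn fun q hq => hq.2.ne'
      continuousOn_invFun := by
        rw [Topology.IsInducing.subtypeVal.continuousOn_iff]
        refine (continuous_chartInv lam ε sg t).continuousOn.congr fun y hy => ?_
        have hy' : zOne (chartInv lam ε sg t y) ≠ 0 := hy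
        simp only [Function.comp_apply, hy', ne_eq, not_false_eq_true, dif_pos] }
  exact ⟨e, ⟨hsgp, htp⟩, fun q hq q' hq' => sameLeaf_iff hε q.2 q'.2 hq.2 hq'.2⟩

theorem isFoliation_tube (hlam : 0 ≤ lam) (hε : ε = 1 ∨ ε = -1) :
    IsFoliation 2 (tube lam) (leaves lam ε) where
  subset_sphere := fun _ hp => hp.1
  isConnected := fun t => isConnected_leafT hε t
  isSurface := fun t => isSurface_leafT hlam hε t
  disjoint := fun s t hst => Set.disjoint_left.2 fun _ h1 h2 =>
    hst (Subtype.ext (leafT_eq_of_mem hε s.2 t.2 h1 h2))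
  cover := by
    ext q
    rw [mem_iUnion]
    constructor
    · rintro ⟨t, ht⟩; exact leafT_subset_tube hε ht
    · intro hq
      obtain ⟨t, ht, h⟩ := exists_leafT hε hq
      exact ⟨⟨t, ht⟩, h⟩
  chart := exists_chart hε
  submersion := by
    intro p hp
    obtain ⟨hpt, hlt⟩ := lt_of_mem_relInterior hp
    obtain ⟨t, -, ht⟩ := exists_leafT hε hpt
    have hpU : p ∈ phaseNhd lam ε t := mem_phaseNhd_of_mem_leaf hε ht.1 hlt
    have hsub : phaseNhd lam ε t ∩ S3 ⊆ tube lam := by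
      rintro q ⟨h1, h2⟩
      refine ⟨h2, fun h0 => ?_, h1.1.le⟩
      have := h1.2
      rw [leafPhase, h0] at this
      simp at this
    exact ⟨phaseNhd lam ε t, _, isOpen_phaseNhd, hpU, contDiffOn_slope hε,
      fderiv_slope_ne_zero hε hpU, hsub, fun q hq q' hq' =>
        sameLeaf_iff hε (hsub hq) (hsub hq') hq.1.2 hq'.1.2⟩

end

/-! ### The horizontal field of the foliation -/

section

variable {lam ε t φ u : ℝ}

/-- The complex factor `λr + iw`, with `r = |z₂|` and `w` the sine of the latitude of the point
on the leaf through it. -/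
def gaussFactor (lam ε : ℝ) (p : Quat) : ℂ :=
  ((lam * ‖zTwo p‖ : ℝ) : ℂ) + ((ε * √(1 - (freq lam * ‖zTwo p‖) ^ 2) : ℝ) : ℂ) * Complex.I

/-- The horizontal field that restricts to the horizontal Gauss maps of the leaves. -/
def gaussField (lam ε : ℝ) (p : Quat) : Quat :=
  mk (((‖zTwo p‖ / ‖zOne p‖ ^ 2 : ℝ) : ℂ) * (zOne p * gaussFactor lam ε p))
    (-(((‖zTwo p‖⁻¹ : ℝ) : ℂ) * (zTwo p * gaussFactor lam ε p)))

/-- On a leaf, `z₁ = η (λr - iw)` and `z₂ = ξ r`, so that `η` and `ξ` can be recovered from the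
coordinates of the point. -/
theorem gaussField_gP (hε : ε = 1 ∨ ε = -1) (hu : u ∈ latitudes ε)
    (hpole : u ≠ ε * (Real.pi / 2)) (h0 : zOne (gP lam t φ u) ≠ 0) :
    gaussField lam ε (gP lam t φ u) = gX lam t φ u := by
  have hr := div_pos (cos_pos_of_not_pole hε hu hpole) (freq_pos lam)
  have hz1 : zOne (gP lam t φ u) =
    eta lam t u * ⟨lam * (Real.cos u / freq lam), -Real.sin u⟩ := rfl
  have hz2 : zTwo (gP lam t φ u) = cis (φ + ratio lam * u) * ⟨Real.cos u / freq lam, 0⟩ := rfl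
  have hf : gaussFactor lam ε (gP lam t φ u) =
      ⟨lam * (Real.cos u / freq lam), Real.sin u⟩ := by
    rw [gaussFactor, ← sin_lat hε, norm_zTwo_gP hu.1, lat_cos hε hu]
    apply Complex.ext <;>
      simp only [Complex.add_re, Complex.add_im, Complex.mul_re, Complex.mul_im, Complex.ofReal_re,
        Complex.ofReal_im, Complex.I_re, Complex.I_im] <;> ring
  have hn : ‖zOne (gP lam t φ u)‖ ^ 2 = (lam * (Real.cos u / freq lam)) ^ 2 + Real.sin u ^ 2 := by
    rw [hz1, norm_mul, norm_eta, one_mul, ← Complex.normSq_eq_norm_sq, Complex.normSq_apply]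
    ring
  have hn0 : (lam * (Real.cos u / freq lam)) ^ 2 + Real.sin u ^ 2 ≠ 0 := by
    rw [← hn]; exact pow_ne_zero 2 (norm_ne_zero_iff.2 h0)
  rw [gaussField, hf, hn, norm_zTwo_gP hu.1, hz1, hz2, gX, xF]
  set r := Real.cos u / freq lam
  apply quat_ext
  · rw [zOne_mk, zOne_mk, mul_assoc, mul_left_comm]
    congr 1
    apply Complex.ext
    · rw [Complex.re_ofReal_mul, Complex.mul_re, div_mul_eq_mul_div, div_eq_iff hn0]
      dsimp only
      ring
    · rw [Complex.im_ofReal_mul, Complex.mul_im]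
      dsimp only
      ring
  · rw [zTwo_mk, zTwo_mk, mul_assoc, mul_left_comm, ← mul_neg]
    congr 1
    apply Complex.ext
    · rw [Complex.neg_re, Complex.re_ofReal_mul, Complex.mul_re]; field_simp; ring
    · rw [Complex.neg_im, Complex.im_ofReal_mul, Complex.mul_im]; field_simp; ring

theorem mem_axisL {p : Quat} (hp : p ∈ S3) : p ∈ axisL ↔ zTwo p = 0 :=
  ⟨fun h => Complex.ext h.2.1 h.2.2, fun h => ⟨hp, congrArg Complex.re h, congrArg Complex.im h⟩⟩

/-- A point of the tube off the vertical axis lies on a leaf, away from its pole. -/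
theorem exists_gP_of_mem_tube (hε : ε = 1 ∨ ε = -1) {p : Quat} (hp : p ∈ tube lam \ axisL) :
    ∃ t φ, ∃ u ∈ latitudes ε, u ≠ ε * (Real.pi / 2) ∧ p = gP lam t φ u := by
  obtain ⟨t, -, h⟩ := exists_leafT hε hp.1
  obtain ⟨φ, u, hu, rfl⟩ := exists_gP h.1
  refine ⟨t, φ, u, hu, ?_, rfl⟩
  rintro rfl
  refine hp.2 ((mem_axisL hp.1.1).2 ?_)
  rw [zTwo_gP, (trig_pole hε).1]; simp

theorem gaussField_unit_horizontal (hε : ε = 1 ∨ ε = -1) {p : Quat} (hp : p ∈ tube lam \ axisL) :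
    inner ℝ (gaussField lam ε p) (gaussField lam ε p) = 1 ∧ inner ℝ (gaussField lam ε p) p = 0 ∧
      inner ℝ (gaussField lam ε p) (T p) = 0 := by
  obtain ⟨t, φ, u, hu, hpole, rfl⟩ := exists_gP_of_mem_tube hε hp
  rw [gaussField_gP hε hu hpole hp.1.2.1]
  have h := gX_inner lam t φ u
  exact ⟨h.1, h.2.1, h.2.2.1⟩

theorem zTwo_ne_zero_of_mem {p : Quat} (hp : p ∈ tube lam \ axisL) : zTwo p ≠ 0 :=
  fun h => hp.2 ((mem_axisL hp.1.1).2 h)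

theorem continuousOn_gaussField : ContinuousOn (gaussField lam ε) (tube lam \ axisL) := by
  have h1 : Continuous fun p => ‖zOne p‖ := continuous_norm.comp zOne.continuous
  have h2 : Continuous fun p => ‖zTwo p‖ := continuous_norm.comp zTwo.continuous
  have hf : Continuous (gaussFactor lam ε) := by
    unfold gaussFactor
    fun_prop
  refine mkL.continuous.comp_continuousOn (ContinuousOn.prodMk ?_ (ContinuousOn.neg ?_))
  · refine (Complex.continuous_ofReal.comp_continuousOn (h2.continuousOn.div
      (h1.continuousOn.pow 2) fun p hp => ?_)).mul (zOne.continuous.mul hf).continuousOn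
    exact pow_ne_zero 2 (norm_ne_zero_iff.2 hp.1.2.1)
  · refine (Complex.continuous_ofReal.comp_continuousOn (h2.continuousOn.inv₀ fun p hp => ?_)).mul
      (zTwo.continuous.mul hf).continuousOn
    exact norm_ne_zero_iff.2 (zTwo_ne_zero_of_mem hp)

theorem contDiffAt_gaussField {p : Quat} (h1 : zOne p ≠ 0) (h2 : zTwo p ≠ 0)
    (h : freq lam * ‖zTwo p‖ < 1) : ContDiffAt ℝ ∞ (gaussField lam ε) p := by
  have hn1 : ContDiffAt ℝ ∞ (fun q => ‖zOne q‖) p := zOne.contDiff.contDiffAt.norm ℝ h1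
  have hn2 : ContDiffAt ℝ ∞ (fun q => ‖zTwo q‖) p := zTwo.contDiff.contDiffAt.norm ℝ h2
  have hof : ∀ {f : Quat → ℝ}, ContDiffAt ℝ ∞ f p → ContDiffAt ℝ ∞ (fun q => (f q : ℂ)) p :=
    fun hf => Complex.ofRealCLM.contDiff.contDiffAt.comp p hf
  have hf : ContDiffAt ℝ ∞ (gaussFactor lam ε) p :=
    (hof (contDiffAt_const.mul hn2)).add ((hof (contDiffAt_const.mul
      ((contDiffAt_const.sub ((contDiffAt_const.mul hn2).pow 2)).sqrt
        (sub_sq_pos (norm_nonneg _) h).1.ne'))).mul contDiffAt_const)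
  exact mkL.contDiff.contDiffAt.comp p (ContDiffAt.prodMk
    ((hof (hn2.div (hn1.pow 2) (pow_ne_zero 2 (norm_ne_zero_iff.2 h1)))).mul
      (zOne.contDiff.contDiffAt.mul hf))
    ((hof (hn2.inv (norm_ne_zero_iff.2 h2))).mul (zTwo.contDiff.contDiffAt.mul hf)).neg)

theorem contDiffAt_gaussField_of_mem {p : Quat} (hp : p ∈ relInterior (tube lam) \ axisL) :
    ContDiffAt ℝ ∞ (gaussField lam ε) p := by
  obtain ⟨h1, h2⟩ := lt_of_mem_relInterior hp.1
  exact contDiffAt_gaussField h1.2.1 (zTwo_ne_zero_of_mem ⟨h1, hp.2⟩) h2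

/-! ### The divergence -/

theorem mem_tangentSpan_S3 {p v : Quat} (hp : p ∈ S3) (hv : inner ℝ v v = 1)
    (hpv : inner ℝ p v = 0) : v ∈ tangentSpan S3 p := by
  refine mem_tangentSpan_of_pos (mem_tangentConeAt_of_curve
    (c := fun s => Real.cos s • p + Real.sin s • v) (by simp) ?_
    (Eventually.frequently (Eventually.of_forall fun s => ?_)))
  · have h := ((Real.hasDerivAt_cos 0).smul_const p).add ((Real.hasDerivAt_sin 0).smul_const v)
    simp only [Real.sin_zero, neg_zero, zero_smul, Real.cos_zero, one_smul, zero_add] at h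
    exact h.hasDerivWithinAt
  · have h1 := inner_self_of_mem_S3 hp
    have h2 : ‖Real.cos s • p + Real.sin s • v‖ ^ 2 = 1 := by
      rw [← real_inner_self_eq_norm_sq]
      simp only [inner_add_left, inner_add_right, real_inner_smul_left, real_inner_smul_right, h1,
        hv, hpv, real_inner_comm p v]
      linear_combination Real.sin_sq_add_cos_sq s
    exact (pow_eq_one_iff_of_nonneg (norm_nonneg _) two_ne_zero).1 h2

theorem orthonormal_T_gX_gY (lam t φ u : ℝ) :
    Orthonormal ℝ ![gP lam t φ u, T (gP lam t φ u), gX lam t φ u, gY lam t φ u] := by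
  have hp := gP_mem_S3 lam t φ u
  obtain ⟨h1, h2, h3, h4, h5, h6⟩ := gX_inner lam t φ u
  have hpp := inner_self_of_mem_S3 hp
  have hTT := inner_T_T hp
  have hTp : inner ℝ (T (gP lam t φ u)) (gP lam t φ u) = 0 := (inner_E1_T _).2.2.2.2
  have hYY : inner ℝ (gY lam t φ u) (gY lam t φ u) = 1 := by
    have := (orthonormal_gP lam t φ u).1 2
    rw [real_inner_self_eq_norm_sq]
    change ‖gY lam t φ u‖ = 1 at this
    rw [this, one_pow]
  rw [orthonormal_iff_ite]
  have h2' := (real_inner_comm _ _).trans h2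
  have h3' := (real_inner_comm _ _).trans h3
  have h4' := (real_inner_comm _ _).trans h4
  have h5' := (real_inner_comm _ _).trans h5
  have h6' := (real_inner_comm _ _).trans h6
  have hTp' := (real_inner_comm _ _).trans hTp
  intro i j
  have hn : ∀ v : Quat, inner ℝ v v = 1 → ‖v‖ = 1 := fun v hv => by
    rw [norm_eq_sqrt_real_inner, hv, Real.sqrt_one]
  fin_cases i <;> fin_cases j <;> simp <;> first | assumption | exact Or.inl (hn _ (by assumption))

theorem tangentSpan_S3_gP (lam t φ u : ℝ) : tangentSpan S3 (gP lam t φ u) =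
    Submodule.span ℝ (range ![T (gP lam t φ u), gX lam t φ u, gY lam t φ u]) := by
  have ho := orthonormal_T_gX_gY lam t φ u
  have hp := gP_mem_S3 lam t φ u
  have hself : ∀ i, inner ℝ (![gP lam t φ u, T (gP lam t φ u), gX lam t φ u, gY lam t φ u] i)
      (![gP lam t φ u, T (gP lam t φ u), gX lam t φ u, gY lam t φ u] i) = (1 : ℝ) := fun i => by
    rw [real_inner_self_eq_norm_sq, ho.1, one_pow]
  apply le_antisymm
  · intro v hv
    have h1 := inner_eq_zero_of_mem_tangentSpan (fun q hq => hq) hp hv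
    have h2 := eq_of_orthonormal ho v
    simp only [Matrix.cons_val] at h2
    rw [h1, zero_smul, zero_add] at h2
    rw [h2]
    refine Submodule.add_mem _ (Submodule.add_mem _ ?_ ?_) ?_ <;>
      refine Submodule.smul_mem _ _ (Submodule.subset_span ?_)
    · exact ⟨0, rfl⟩
    · exact ⟨1, rfl⟩
    · exact ⟨2, rfl⟩
  · refine Submodule.span_le.2 ?_
    rintro _ ⟨i, rfl⟩
    have h := mem_tangentSpan_S3 hp (hself i.succ) (ho.2 (Fin.succ_ne_zero i).symm)
    exact h

/-- The field has divergence `-2λ`: in the orthonormal frame `T, X, Y` the first two directions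
do not contribute, and the contribution of `Y` is that of the leaf. -/
theorem hasDivergenceAlong_gaussField (hε : ε = 1 ∨ ε = -1) {p : Quat}
    (hp : p ∈ relInterior (tube lam) \ axisL) :
    HasDivergenceAlong S3 (gaussField lam ε) p (-2 * lam) := by
  have hpt : p ∈ tube lam := (lt_of_mem_relInterior hp.1).1
  have hd : HasFDerivAt (gaussField lam ε) (fderiv ℝ (gaussField lam ε) p) p :=
    ((contDiffAt_gaussField_of_mem hp).differentiableAt (by simp)).hasFDerivAt
  set V' := fderiv ℝ (gaussField lam ε) p
  have hdS := hd.hasFDerivWithinAt (s := S3)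
  have hmem : ∀ᶠ q in 𝓝[S3] p, q ∈ tube lam \ axisL := by
    have h2 : ∀ᶠ q in 𝓝 p, zTwo q ≠ 0 :=
      zTwo.continuous.continuousAt.eventually_ne (zTwo_ne_zero_of_mem ⟨hpt, hp.2⟩)
    filter_upwards [hp.1.2, nhdsWithin_le_nhds h2] with q hq hq2
    exact ⟨hq, fun h => hq2 ((mem_axisL hq.1).1 h)⟩
  have hI1 := hmem.mono fun q hq => (gaussField_unit_horizontal hε hq).1
  have hI2 := hmem.mono fun q hq => (gaussField_unit_horizontal hε hq).2.2
  have hIp := (gaussField_unit_horizontal hε ⟨hpt, hp.2⟩).2.1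
  refine ⟨V', hdS, ?_⟩
  obtain ⟨t, φ, u, hu, hpole, rfl⟩ := exists_gP_of_mem_tube hε ⟨hpt, hp.2⟩
  have hX : gaussField lam ε (gP lam t φ u) = gX lam t φ u := gaussField_gP hε hu hpole hpt.2.1
  have hpS := gP_mem_S3 lam t φ u
  have ho := orthonormal_T_gX_gY lam t φ u
  have hspan := tangentSpan_S3_gP lam t φ u
  have ho3 : Orthonormal ℝ ![T (gP lam t φ u), gX lam t φ u, gY lam t φ u] := by
    have h := ho.comp Fin.succ (Fin.succ_injective 3)
    convert h using 1
    funext i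
    fin_cases i <;> rfl
  rw [trace_eq_sum ho3 hspan, Fin.sum_univ_three]
  simp only [Matrix.cons_val]
  have hTt : T (gP lam t φ u) ∈ tangentSpan S3 (gP lam t φ u) := by
    rw [hspan]; exact Submodule.subset_span ⟨0, rfl⟩
  have hXt : gX lam t φ u ∈ tangentSpan S3 (gP lam t φ u) := by
    rw [hspan]; exact Submodule.subset_span ⟨1, rfl⟩
  have e1 : inner ℝ (T (gP lam t φ u)) (V' (T (gP lam t φ u))) = 0 := by
    have := inner_deriv_eq_zero hpS hdS hI1 hI2 hIp (a := 0) (b := 1) (by simpa using hTt)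
    simpa using this
  have e2 : inner ℝ (gX lam t φ u) (V' (gX lam t φ u)) = 0 := by
    have := inner_deriv_eq_zero hpS hdS hI1 hI2 hIp (a := 1) (b := 0) (by simpa [hX] using hXt)
    simpa [hX] using this
  have hev : ∀ᶠ u' in 𝓝[latitudes ε] u, gaussField lam ε (gP lam t φ u') = gX lam t φ u' := by
    have hc : ContinuousAt (fun u' => zOne (gP lam t φ u')) u :=
      zOne.continuous.continuousAt.comp (hasDerivAt_gP lam t φ u).continuousAt
    filter_upwards [self_mem_nhdsWithin, nhdsWithin_le_nhds (hc.eventually_ne hpt.2.1),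
      nhdsWithin_le_nhds (isOpen_ne.mem_nhds hpole)] with u' h1 h2 h3
    exact gaussField_gP hε h1 h3 h2
  have hY := deriv_gY hε hu hpole (hdS.mono fun q hq => hq.1) hev
  have hYY := ho.1 3
  have hYT := (gX_inner lam t φ u).2.2.2.1
  rw [e1, e2, hY, inner_sub_right, real_inner_smul_right, hYT, real_inner_self_eq_norm_sq]
  change ‖gY lam t φ u‖ = 1 at hYY
  rw [hYY]; ring

/-! ### The half-spheres -/

theorem poleP_one (lam : ℝ) : poleP lam 1 0 = southPole := by
  apply quat_ext
  · rw [poleP, zOne_gP, prof, ← mul_assoc, ← cis_add, one_mul, Real.cos_pi_div_two,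
      Real.sin_pi_div_two, tauAngle_half]
    apply Complex.ext <;> simp [southPole, zOne, cis]
  · rw [poleP, zTwo_gP, (trig_pole (Or.inl rfl)).1]
    apply Complex.ext <;> simp [southPole, zTwo]

theorem poleP_neg_one (lam : ℝ) : poleP lam (-1) 0 = northPole lam := by
  have hk := (freq_pos lam).ne'
  have h : freq lam * (Real.pi / freq lam) = Real.pi := by field_simp
  apply quat_ext
  · rw [poleP, zOne_gP, northPole, zOne_geod, h, zero_add]
    congr 2; ring
  · rw [poleP, zTwo_gP, northPole, zTwo_geod, h, (trig_pole (Or.inr rfl)).1]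
    simp

theorem vertTrans_poleP (hε : ε = 1 ∨ ε = -1) (t : ℝ) :
    vertTrans t (poleP lam ε 0) = poleP lam ε t := by
  rw [vertTrans_eq]
  apply quat_ext
  · rw [zOne_mk, poleP, poleP, zOne_gP, zOne_gP, ← mul_assoc, ← cis_add, zero_add]
  · have h : Real.cos (ε * (Real.pi / 2)) = 0 := (trig_pole hε).1
    rw [zTwo_mk, poleP, poleP, zTwo_gP, zTwo_gP, h]; simp

theorem vertTrans_equator (lam t : ℝ) :
    vertTrans t '' equator lam = {p | ∃ φ, p = gP lam t φ 0} := by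
  have hk := (freq_pos lam).ne'
  have h : freq lam * (Real.pi / (2 * freq lam)) = Real.pi / 2 := by field_simp
  have h1 : ∀ θ, vertTrans t (geod lam θ (Real.pi / (2 * freq lam))) =
      gP lam t (θ - lam * (Real.pi / (2 * freq lam)) + t) 0 := by
    intro θ
    rw [vertTrans_eq]
    apply quat_ext
    · rw [zOne_mk, zOne_geod, h, sub_self, zOne_gP, ← mul_assoc, ← cis_add]
    · rw [zTwo_mk, zTwo_geod, h, zTwo_gP, mul_zero, add_zero, cis_add _ t, Real.sin_pi_div_two,
        Real.cos_zero]
      ring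
  ext p
  constructor
  · rintro ⟨_, ⟨θ, -, rfl⟩, rfl⟩
    exact ⟨_, h1 θ⟩
  · rintro ⟨φ, rfl⟩
    obtain ⟨θ, hθ, h2⟩ := exists_polar (norm_cis φ)
      (-(lam * (Real.pi / (2 * freq lam))) + t)
    refine ⟨_, ⟨θ, hθ, rfl⟩, ?_⟩
    rw [h1]
    apply quat_ext
    · rw [zOne_gP, zOne_gP]
    · rw [zTwo_gP, zTwo_gP, mul_zero, add_zero, add_zero, h2, Complex.ofReal_one, one_mul,
        sub_eq_add_neg, add_assoc]

theorem rotInvariant_leaf (hε : ε = 1 ∨ ε = -1) (t : ℝ) : RotInvariant (leaf lam ε t) := by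
  have h : ∀ θ, ∀ p ∈ leaf lam ε t, rot θ p ∈ leaf lam ε t := by
    intro θ p hp
    obtain ⟨h1, h2, h3⟩ := (mem_leaf_iff hε).1 hp
    rw [rot_eq, mem_leaf_iff hε, mem_S3, zOne_mk, zTwo_mk, norm_mul, norm_cis, one_mul]
    exact ⟨mem_S3.1 h1, h2, h3⟩
  intro θ _
  refine Subset.antisymm (image_subset_iff.2 (h θ)) fun p hp => ⟨rot (-θ) p, h _ p hp, ?_⟩
  rw [rot_eq, rot_eq]
  apply quat_ext
  · simp
  · simp [← mul_assoc, cis_mul_neg]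

theorem leafT_eq_leaf (hlam : 0 < lam) (t : ℝ) (hε : ε = 1 ∨ ε = -1) :
    leafT lam ε t = leaf lam ε t := by
  refine Subset.antisymm (fun p hp => hp.1) fun p hp => ⟨hp, ?_⟩
  have h := ((mem_leaf_iff hε).1 hp).2.1
  have hk := freq_sq lam
  have hk1 := freq_pos lam
  rw [norm_zTwo_lt_one hp.1]
  by_contra! hge
  have : freq lam ≤ 1 := by nlinarith
  nlinarith

theorem leafT_eq_diff_circleC0 (lam ε t : ℝ) : leafT lam ε t = leaf lam ε t \ circleC0 := by
  ext p
  refine and_congr_right fun hp => not_congr ⟨fun h => ?_, fun h => Complex.ext h.2.1 h.2.2⟩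
  exact ⟨hp.1, congrArg Complex.re h, congrArg Complex.im h⟩

end

end PansuSphere

end

theorem proposition3p2 (lam : ℝ) (hlam : 0 ≤ lam) (S : Set Quat) (pole : Quat)
    (hS : (S = halfPlus lam ∧ pole = southPole) ∨ (S = halfMinus lam ∧ pole = northPole lam)) :
    ∃ N : Quat → Quat,
      (∀ t ∈ Set.Ico (0 : ℝ) (2 * Real.pi),
        IsSurface 2 (vertTrans t '' S) ∧
        surfaceBoundary 2 (vertTrans t '' S) = vertTrans t '' equator lam ∧
        IsSurface ∞ (vertTrans t '' S \ {vertTrans t pole}) ∧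
        RotInvariant (vertTrans t '' S) ∧
        singularSet (vertTrans t '' S) = {vertTrans t pole} ∧
        IsUnitNormal (vertTrans t '' S) (translateField t N) ∧
        ∀ p ∈ vertTrans t '' S, p ≠ vertTrans t pole →
          HasMeanCurvature (vertTrans t '' S) (translateField t N) p lam) ∧
      (0 < lam →
        IsFoliation 2 (solidTube lam)
          (fun t : Set.Ico (0 : ℝ) (2 * Real.pi) => vertTrans t '' S)) ∧
      (lam = 0 →
        IsFoliation 2 (solidTube 0)
          (fun t : Set.Ico (0 : ℝ) (2 * Real.pi) => vertTrans t '' S \ circleC0)) ∧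
      ∃ X : Quat → Quat,
        ContinuousOn X (solidTube lam \ axisL) ∧
        ContDiffOn ℝ ∞ X (relInterior (solidTube lam) \ axisL) ∧
        (∀ p ∈ solidTube lam \ axisL, ‖X p‖ = 1 ∧ X p ∈ horizontal p) ∧
        (∀ t ∈ Set.Ico (0 : ℝ) (2 * Real.pi), ∀ p ∈ vertTrans t '' S ∩ solidTube lam,
          p ≠ vertTrans t pole → X p = horizontalGauss (translateField t N) p) ∧
        (∀ p ∈ relInterior (solidTube lam) \ axisL,
          HasDivergenceAlong S3 X p (-2 * lam)) := by
  obtain ⟨ε, hε, rfl, rfl⟩ : ∃ ε : ℝ, (ε = 1 ∨ ε = -1) ∧ S = leaf lam ε 0 ∧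
      pole = poleP lam ε 0 := by
    rcases hS with ⟨h1, h2⟩ | ⟨h1, h2⟩
    · exact ⟨1, Or.inl rfl, h1.trans (half_eq_leaf hlam).1, h2.trans (poleP_one lam).symm⟩
    · exact ⟨-1, Or.inr rfl, h1.trans (half_eq_leaf hlam).2, h2.trans (poleP_neg_one lam).symm⟩
  simp only [vertTrans_leaf, vertTrans_poleP hε]
  refine ⟨normalField lam ε 0, fun t _ => ?_, fun hpos => ?_, ?_, gaussField lam ε, ?_⟩
  · rw [translateField_normalField]
    exact ⟨isSurface_leaf hlam hε t,
      (surfaceBoundary_leaf hlam hε t).trans (vertTrans_equator lam t).symm,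
      isSurface_leaf_diff_pole hlam hε t, rotInvariant_leaf hε t, singularSet_leaf hlam hε t,
      isUnitNormal_leaf hlam hε t, fun p hp hne => hasMeanCurvature_leaf hlam hε hp hne⟩
  · have h := isFoliation_tube hlam hε
    have e : leaves lam ε = fun t : Set.Ico (0 : ℝ) (2 * Real.pi) => leaf lam ε t :=
      funext fun t => leafT_eq_leaf hpos t hε
    rwa [← solidTube_eq hlam, e] at h
  · rintro rfl
    have h := isFoliation_tube hlam hε
    have e : leaves 0 ε = fun t : Set.Ico (0 : ℝ) (2 * Real.pi) => leaf 0 ε t \ circleC0 :=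
      funext fun t => leafT_eq_diff_circleC0 0 ε t
    rwa [← solidTube_eq hlam, e] at h
  · rw [solidTube_eq hlam]
    refine ⟨continuousOn_gaussField,
      fun p hp => (contDiffAt_gaussField_of_mem hp).contDiffWithinAt, fun p hp => ?_, ?_,
      fun p hp => hasDivergenceAlong_gaussField hε hp⟩
    · obtain ⟨h1, h2, h3⟩ := gaussField_unit_horizontal hε hp
      exact ⟨by rw [norm_eq_sqrt_real_inner, h1, Real.sqrt_one],
        (mem_horizontal hp.1.1).2 ⟨h2, h3⟩⟩
    · rintro t - p ⟨hp, hpt⟩ hne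
      obtain ⟨φ, u, hu, rfl⟩ := exists_gP hp
      have hpole : u ≠ ε * (Real.pi / 2) := fun h => hne ((gP_eq_poleP_iff hε hu).2 h)
      rw [translateField_normalField, horizontalGauss_gP hε hu hpole,
        gaussField_gP hε hu hpole hpt.2.1]
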